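/- Let $0\le l\le n-1$, let $\Omega\subset\subset\mathbb C^n$ be a bounded pseudoconvex domain, and let $z^0\in b\Omega$. Assume that in an open neighborhood $V$ of $z^0$ the boundary $b\Omega$ is smooth, i.e. there is $r\in C^\infty(V,\mathbb R)$ with $\Omega\cap V=\{r<0\}$, $b\Omega\cap V=\{r=0\}$ and $dr\neq0$ on $b\Omega\cap V$, and that its Levi form $L_r(z;X,Y)=\sum_{j,k}\frac{\partial^2 r}{\partial z_j\partial\bar z_k}(z)X_j\overline{Y}_k$, restricted to $T^{1,0}_z(b\Omega)=\{X\in\mathbb C^n:\sum_j\frac{\partial r}{\partial z_j}(z)X_j=0\}$, has rank $n-l-1$ at every $z\in b\Omega\cap V$. Then each $p\in b\Omega\cap V$ is a local weak peak point of $\Omega$: there are an open neighborhood $U_p$ of $p$ and a function $f_p$, holomorphic on $\Omega\cap U_p$ and continuous on $\overline\Omega\cap U_p$, such that $f_p(p)=1$, $|f_p|<1$ on $\Omega\cap U_p$ and $|f_p|\le1$ on $\overline\Omega\cap U_p$. More precisely, for each $p\in b\Omega\cap V$ there are an open neighborhood $\widehat U_p$ of $p$ and a biholomorphic map $\zeta=\Phi_p(z)$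 of $\widehat U_p$ onto the unit ball $B(0,1)$ with $\Phi_p(p)=0$, such that near $0$ the set $\Phi_p(b\Omega\cap\widehat U_p)$ has a smooth defining function (negative on $\Phi_p(\Omega\cap\widehat U_p)$) of the form $$\rho(\zeta)=\operatorname{Re}\zeta_1+\sum_{j=2}^{n-l}\lambda_j|\zeta_j|^2+O\bigl(|\zeta'|^2|\zeta''|+|\zeta'|^3+|\operatorname{Im}\zeta_1|\,|\zeta|\bigr),\qquad \lambda_j>0,$$ where $\zeta'=(\zeta_2,\dots,\zeta_{n-l})$ and $\zeta''=(\zeta_{n-l+1},\dots,\zeta_n)$, and such that for some open neighborhood $U_p\subset\widehat U_p$ of $p$ the function $$f_p(z)=h(\Phi_p(z)),\qquad h(\zeta)=\exp\bigl(-(-\zeta_1)^{2/3}\bigr)$$ (principal branch of the power) has the properties above. -/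

import Mathlib

open scoped ContDiff Topology

noncomputable section

/-- Complex Euclidean space `ℂⁿ`. -/
abbrev Cn (n : ℕ) : Type := EuclideanSpace ℂ (Fin n)

/-- The coordinate vector `e_j` of `ℂⁿ`. -/
def coordVec {n : ℕ} (j : Fin n) : Cn n := EuclideanSpace.single j 1

/-- The Wirtinger derivative `∂f/∂z_j = (∂f/∂x_j - i ∂f/∂y_j) / 2`. -/
def dz {n : ℕ} (j : Fin n) (f : Cn n → ℂ) (z : Cn n) : ℂ :=
  (fderiv ℝ f z (coordVec j) - Complex.I * fderiv ℝ f z (Complex.I • coordVec j)) / 2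

/-- The Wirtinger derivative `∂f/∂z̄_j = (∂f/∂x_j + i ∂f/∂y_j) / 2`. -/
def dzbar {n : ℕ} (j : Fin n) (f : Cn n → ℂ) (z : Cn n) : ℂ :=
  (fderiv ℝ f z (coordVec j) + Complex.I * fderiv ℝ f z (Complex.I • coordVec j)) / 2

/-- `∂r/∂z_j` for a real-valued function `r`. -/
def complexGradient {n : ℕ} (r : Cn n → ℝ) (z : Cn n) (j : Fin n) : ℂ :=
  dz j (fun w => (r w : ℂ)) z

/-- `∂²r/∂z_j∂z̄_k` for a real-valued function `r`. -/
def complexHessian {n : ℕ} (r : Cn n → ℝ) (z : Cn n) (j k : Fin n) : ℂ :=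
  dz j (fun w => dzbar k (fun v => (r v : ℂ)) w) z

/-- The complex tangent space `T^{1,0}_z` of the level set of `r` through `z`, identified with
the subspace of all `X ∈ ℂⁿ` such that `∑ (∂r/∂z_j)(z) X_j = 0`. -/
def complexTangent {n : ℕ} (r : Cn n → ℝ) (z : Cn n) : Submodule ℂ (Cn n) where
  carrier := {X | ∑ j, complexGradient r z j * X j = 0}
  zero_mem' := by simp
  add_mem' := by
    intro X Y hX hY
    simp only [Set.mem_ofPred_eq, PiLp.add_apply, mul_add, Finset.sum_add_distrib] at *
    rw [hX, hY, add_zero]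
  smul_mem' := by
    intro c X hX
    simp only [Set.mem_ofPred_eq, PiLp.smul_apply, smul_eq_mul] at *
    have : ∑ j, complexGradient r z j * (c * X j)
        = c * ∑ j, complexGradient r z j * X j := by
      rw [Finset.mul_sum]; exact Finset.sum_congr rfl fun j _ => by ring
    rw [this, hX, mul_zero]

/-- The Levi form `L_r(z; X, Y) = ∑ (∂²r/∂z_j∂z̄_k)(z) X_j conj(Y_k)` for `X, Y ∈ T^{1,0}_z`,
linear in `X` and conjugate-linear in `Y`. -/
def leviForm {n : ℕ} (r : Cn n → ℝ) (z : Cn n) :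
    complexTangent r z →ₗ[ℂ] complexTangent r z →ₗ⋆[ℂ] ℂ :=
  LinearMap.mk₂'ₛₗ (RingHom.id ℂ) (starRingEnd ℂ)
    (fun X Y => ∑ j, ∑ k, complexHessian r z j k * (X : Cn n) j * star ((Y : Cn n) k))
    (by intro X X' Y; simp [mul_add, add_mul, Finset.sum_add_distrib])
    (by
      intro c X Y
      simp only [Submodule.coe_smul, PiLp.smul_apply, smul_eq_mul, RingHom.id_apply,
        Finset.mul_sum]
      exact Finset.sum_congr rfl fun j _ => Finset.sum_congr rfl fun k _ => by ring)
    (by intro X Y Y'; simp [mul_add, Finset.sum_add_distrib])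
    (by
      intro c X Y
      simp only [Submodule.coe_smul, PiLp.smul_apply, smul_eq_mul, star_mul', Finset.mul_sum,
        starRingEnd_apply]
      exact Finset.sum_congr rfl fun j _ => Finset.sum_congr rfl fun k _ => by ring)

/-- The Levi rank: the rank of the Hermitian form `L_r(z; ·, ·)` on `T^{1,0}_z`, that is, the
number of its nonzero eigenvalues counted with multiplicity. -/
def leviRank {n : ℕ} (r : Cn n → ℝ) (z : Cn n) : ℕ :=
  Module.finrank ℂ (LinearMap.range (leviForm r z))

/-- `r` is a smooth defining function on the open set `V` of the part of `Ω` in `V`: the boundary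
of `Ω` is smooth in `V` (with `Ω` locally on one side of it) when such an `r` exists. -/
structure IsSmoothDefiningFunctionOn {n : ℕ} (Ω V : Set (Cn n)) (r : Cn n → ℝ) : Prop where
  smooth : ContDiffOn ℝ ∞ r V
  mem_iff : ∀ z ∈ V, z ∈ Ω ↔ r z < 0
  frontier_iff : ∀ z ∈ V, z ∈ frontier Ω ↔ r z = 0
  fderiv_ne_zero : ∀ z ∈ V, z ∈ frontier Ω → fderiv ℝ r z ≠ 0

/-- Continuous plurisubharmonic functions on an open set `Ω ⊆ ℂⁿ`: the sub-mean value property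
holds on every closed disc `{z + τ w : |τ| ≤ 1}`, lying in `Ω`, of every complex line. -/
structure IsContinuousPlurisubharmonicOn {n : ℕ} (u : Cn n → ℝ) (Ω : Set (Cn n)) : Prop where
  continuousOn : ContinuousOn u Ω
  le_circleAverage : ∀ z w : Cn n, (∀ τ : ℂ, ‖τ‖ ≤ 1 → z + τ • w ∈ Ω) →
    u z ≤ Real.circleAverage (fun τ : ℂ => u (z + τ • w)) 0 1

/-- Pseudoconvexity: minus the logarithm of the Euclidean distance to the boundary is
plurisubharmonic. -/
def IsPseudoconvex {n : ℕ} (Ω : Set (Cn n)) : Prop :=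
  IsContinuousPlurisubharmonicOn (fun z => -Real.log (Metric.infDist z (frontier Ω))) Ω

/-- `f` is a local weak peak function of `Ω` at `p`, on the neighborhood `U` of `p`. -/
structure IsLocalWeakPeakFunction {n : ℕ} (Ω : Set (Cn n)) (p : Cn n) (U : Set (Cn n))
    (f : Cn n → ℂ) : Prop where
  isOpen : IsOpen U
  mem : p ∈ U
  holomorphic : DifferentiableOn ℂ f (Ω ∩ U)
  continuousOn : ContinuousOn f (closure Ω ∩ U)
  peak : f p = 1
  norm_lt_one : ∀ z ∈ Ω ∩ U, ‖f z‖ < 1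
  norm_le_one : ∀ z ∈ closure Ω ∩ U, ‖f z‖ ≤ 1

/-- `p` is a local weak peak point of `Ω`. -/
def IsLocalWeakPeakPoint {n : ℕ} (Ω : Set (Cn n)) (p : Cn n) : Prop :=
  p ∈ frontier Ω ∧ ∃ (U : Set (Cn n)) (f : Cn n → ℂ), IsLocalWeakPeakFunction Ω p U f

/-- A homeomorphism between open subsets of `ℂⁿ`, holomorphic together with its inverse. -/
def IsBiholomorphism {n : ℕ} (Φ : OpenPartialHomeomorph (Cn n) (Cn n)) : Prop :=
  DifferentiableOn ℂ Φ Φ.source ∧ DifferentiableOn ℂ Φ.symm Φ.target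

/-- The coordinates are numbered from `0`, so that `ζ_1` of the usual numbering is `ζ 0`.
These are the indices of `ζ' = (ζ_2, …, ζ_{n-l})`. -/
def primeIndices (n l : ℕ) : Finset (Fin n) :=
  Finset.univ.filter fun j => 0 < j.val ∧ j.val < n - l

/-- The indices of `ζ'' = (ζ_{n-l+1}, …, ζ_n)`. -/
def doublePrimeIndices (n l : ℕ) : Finset (Fin n) :=
  Finset.univ.filter fun j => n - l ≤ j.val

/-- The Euclidean norm of the coordinates of `ζ` with index in `s`. -/
def partNorm {n : ℕ} (s : Finset (Fin n)) (ζ : Cn n) : ℝ :=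
  Real.sqrt (∑ j ∈ s, ‖ζ j‖ ^ 2)

/-- `ρ(ζ) = Re ζ_1 + ∑_{j=2}^{n-l} λ_j |ζ_j|² + O(|ζ'|² |ζ''| + |ζ'|³ + |Im ζ_1| |ζ|)` near `0`,
with positive constants `λ_j`. -/
def HasLeviNormalForm {n : ℕ} [NeZero n] (l : ℕ) (ρ : Cn n → ℝ) : Prop :=
  ∃ lam : Fin n → ℝ, (∀ j ∈ primeIndices n l, 0 < lam j) ∧
    (fun ζ : Cn n => ρ ζ - ((ζ 0).re + ∑ j ∈ primeIndices n l, lam j * ‖ζ j‖ ^ 2)) =O[𝓝 0]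
      fun ζ : Cn n =>
        partNorm (primeIndices n l) ζ ^ 2 * partNorm (doublePrimeIndices n l) ζ
          + partNorm (primeIndices n l) ζ ^ 3 + |(ζ 0).im| * ‖ζ‖

/-- `Φ` gives normal-form coordinates for `Ω` at `p`: it maps a neighborhood of `p`
biholomorphically onto the unit ball, takes `p` to `0`, and near `0` the image of `Ω` has a smooth
defining function in normal form. -/
structure IsNormalFormChart {n : ℕ} [NeZero n] (l : ℕ) (Ω : Set (Cn n)) (p : Cn n)
    (Φ : OpenPartialHomeomorph (Cn n) (Cn n)) : Prop where
  biholomorphism : IsBiholomorphism Φ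
  mem_source : p ∈ Φ.source
  target_eq : Φ.target = Metric.ball 0 1
  map_zero : Φ p = 0
  normalForm : ∃ (ε : ℝ) (ρ : Cn n → ℝ), 0 < ε ∧ ε ≤ 1 ∧
    IsSmoothDefiningFunctionOn (Φ '' (Ω ∩ Φ.source)) (Metric.ball 0 ε) ρ ∧
    HasLeviNormalForm l ρ

/-- The function `exp(-(-ζ_1)^{2/3})`, with the principal branch of the power. -/
def modelPeak {n : ℕ} [NeZero n] (ζ : Cn n) : ℂ :=
  Complex.exp (-((-(ζ 0)) ^ (2 / 3 : ℂ)))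

end

/-! Pseudoconvexity enters only through the sign of the Levi form at `p`
(`IsSmoothDefiningFunctionOn.leviC_nonneg`). No smoothness of the boundary distance `d` is used. If
the Levi form were negative in some tangent direction, then `g = -r - ε|z - p|² - t` would have
positive Levi form near `p`. Maximizing `g / d²` over a small compact set makes `-(log g)/2`, up to
a constant, touch `-log d` from above at an interior point. The sub-mean value inequality on small
discs in two directions `w` and `iw` excludes this.

The constant rank makes the null spaces of the Levi form `l`-dimensional along the hypersurface. The
Levi form is the differential of `θ = dr ∘ J`, hence closed, so brackets of null fields are null
(`leviTwoForm_bracket_eq_zero`). A frame of null fields normalized to have constant `ζ''`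
coordinates therefore commutes (`bracket_nullFrame_eq_zero`), and its flows give a leaf `φ`
(`exists_integral_of_commuting_frame`). The derivative of `φ` is complex linear, so the leaf is a
complex manifold. Along it the null condition is exactly the Cauchy-Riemann equation for the
direction of `∂r`: the complex tangent spaces vary holomorphically
(`IsLeviLeaf.differentiableAt_gradRatio`).

Consequently there are holomorphic coordinates (`adaptedMap`) in which the leaf is flat, `r` and its
`ζ'`-derivatives vanish along it, and the pluriharmonic quadratic part in `ζ'` is gone. Taylor
expansion in `ζ'` from points of the leaf then gives `λ|ζ'|² + O(|ζ'|²(|ζ'| + |ζ''|))` on `{ζ₁ =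
0}`, without any pure `ζ''` term. Passing to a defining function that is a graph over `{Re ζ₁ = 0}`
removes the errors that involve `Re ζ₁` and leaves only `|Im ζ₁||ζ|`
(`HasNormalJet.exists_hasLeviNormalForm`).

In the normal form the positive quadratic term absorbs the errors in `ζ'`, and the last error is at
most `|Im ζ₁|`. So `Re ζ₁ < |Im ζ₁|` on `Ω` near `p`, that is, `|arg(-ζ₁)| < 3π/4`. The power `2/3`
maps this sector into the right half-plane, where `exp(-·)` has modulus less than one. -/

/-! ### Real analysis: Taylor estimate, constrained derivatives, flows of commuting frames -/

/-- Second order Taylor estimate along a segment. -/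
theorem abs_taylor_two_le {E : Type*} [NormedAddCommGroup E] [NormedSpace ℝ E]
    {f : E → ℝ} {a v : E} {B ε : ℝ}
    (hf : ∀ t ∈ Set.Icc (0 : ℝ) 1, ContDiffAt ℝ 2 f (a + t • v))
    (hB : ∀ t ∈ Set.Icc (0 : ℝ) 1, |fderiv ℝ (fderiv ℝ f) (a + t • v) v v - B| ≤ ε) :
    |f (a + v) - f a - fderiv ℝ f a v - B / 2| ≤ ε := by
  have hline : ∀ t : ℝ, HasDerivAt (fun t : ℝ => a + t • v) v t := fun t => by
    simpa using ((hasDerivAt_id t).smul_const v).const_add a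
  have h1 : ∀ t ∈ Set.Icc (0 : ℝ) 1,
      HasDerivAt (fun t : ℝ => f (a + t • v)) (fderiv ℝ f (a + t • v) v) t := fun t ht =>
    ((hf t ht).differentiableAt (by simp)).hasFDerivAt.comp_hasDerivAt t (hline t)
  have h2 : ∀ t ∈ Set.Icc (0 : ℝ) 1, HasDerivAt (fun t : ℝ => fderiv ℝ f (a + t • v) v)
      (fderiv ℝ (fderiv ℝ f) (a + t • v) v v) t := fun t ht => by
    have hd : DifferentiableAt ℝ (fderiv ℝ f) (a + t • v) :=
      ((hf t ht).fderiv_right (m := 1) (by norm_num)).differentiableAt (by simp)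
    exact (ContinuousLinearMap.apply ℝ ℝ v).hasFDerivAt.comp_hasDerivAt t
      (hd.hasFDerivAt.comp_hasDerivAt t (hline t))
  have hε : 0 ≤ ε := (abs_nonneg _).trans (hB 0 (by simp))
  have h3 : ∀ t ∈ Set.Icc (0 : ℝ) 1,
      |fderiv ℝ f (a + t • v) v - fderiv ℝ f a v - t * B| ≤ ε := by
    intro t ht
    have hd : ∀ s ∈ Set.Icc (0 : ℝ) t, HasDerivWithinAt
        (fun s : ℝ => fderiv ℝ f (a + s • v) v - s * B)
        (fderiv ℝ (fderiv ℝ f) (a + s • v) v v - B) (Set.Icc 0 t) s := fun s hs => by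
      have e1 : HasDerivAt (fun s : ℝ => s * B) B s := hasDerivAt_mul_const B
      exact ((h2 s ⟨hs.1, hs.2.trans ht.2⟩).sub e1).hasDerivWithinAt
    have := norm_image_sub_le_of_norm_deriv_le_segment' hd
      (fun s hs => hB s ⟨hs.1, hs.2.le.trans ht.2⟩) t (by simp [ht.1])
    simp only [Real.norm_eq_abs, zero_smul, add_zero, zero_mul, sub_zero] at this
    have e : fderiv ℝ f (a + t • v) v - fderiv ℝ f a v - t * B =
      fderiv ℝ f (a + t • v) v - t * B - fderiv ℝ f a v := by ring
    rw [e]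
    exact this.trans (mul_le_of_le_one_right hε ht.2)
  have hd : ∀ s ∈ Set.Icc (0 : ℝ) 1, HasDerivWithinAt
      (fun s : ℝ => f (a + s • v) - s * fderiv ℝ f a v - s ^ 2 * (B / 2))
      (fderiv ℝ f (a + s • v) v - fderiv ℝ f a v - s * B) (Set.Icc 0 1) s := fun s hs => by
    have e1 : HasDerivAt (fun s : ℝ => s * fderiv ℝ f a v) (fderiv ℝ f a v) s :=
      hasDerivAt_mul_const _
    have e2 : HasDerivAt (fun s : ℝ => s ^ 2 * (B / 2)) (s * B) s :=
      ((hasDerivAt_pow 2 s).mul_const (B / 2)).congr_deriv (by norm_num; ring)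
    exact (((h1 s hs).sub e1).sub e2).hasDerivWithinAt
  have := norm_image_sub_le_of_norm_deriv_le_segment_01' hd
    (fun s hs => h3 s ⟨hs.1, hs.2.le⟩)
  simp only [Real.norm_eq_abs, zero_smul, add_zero, zero_mul, sub_zero, one_smul, one_mul, one_pow,
    ne_eq, OfNat.ofNat_ne_zero, not_false_eq_true, zero_pow] at this
  have e : f (a + v) - f a - fderiv ℝ f a v - B / 2 =
    f (a + v) - fderiv ℝ f a v - B / 2 - f a := by ring
  rwa [e]

/-- A function that vanishes on a regular level set has vanishing tangential derivatives. -/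
theorem fderiv_eq_zero_of_eqOn_levelSet {E : Type*} [NormedAddCommGroup E] [NormedSpace ℝ E]
    [CompleteSpace E] {r F : E → ℝ} {z v : E} (hr : ContDiffAt ℝ 1 r z)
    (hF : ContDiffAt ℝ 1 F z) (h0 : ∀ᶠ w in 𝓝 z, r w = r z → F w = 0)
    (hdr : fderiv ℝ r z ≠ 0) (hv : fderiv ℝ r z v = 0) : fderiv ℝ F z v = 0 := by
  -- `F` is constant on the level set, so `z` is trivially a constrained extremum, and Lagrange
  -- multipliers make `dF` a multiple of `dr`.
  have hex : IsLocalExtrOn F {w | r w = r z} z := by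
    left
    filter_upwards [mem_nhdsWithin_of_mem_nhds h0, self_mem_nhdsWithin] with w hw hwr
    rw [hw hwr, h0.self_of_nhds rfl]
  obtain ⟨a, b, hab, h⟩ := hex.exists_multipliers_of_hasStrictFDerivAt_1d
    (hr.hasStrictFDerivAt (by simp)) (hF.hasStrictFDerivAt (by simp))
  have hb : b ≠ 0 := by
    rintro rfl
    simp only [zero_smul, add_zero, smul_eq_zero, hdr, or_false] at h
    simp [h] at hab
  have := congrArg (fun L => L v) h
  simpa [hv, hb] using this

theorem exists_integralCurve_mem_closedBall {E : Type*} [NormedAddCommGroup E] [NormedSpace ℝ E]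
    [CompleteSpace E] {f : E → E} {p : E} {a L K : NNReal}
    (hb : ∀ x ∈ Metric.closedBall p a, ‖f x‖ ≤ L)
    (hl : LipschitzOnWith K f (Metric.closedBall p a)) (hm : L * 2 ≤ a) :
    ∃ γ : ℝ → E, γ 0 = p ∧ ∀ t ∈ Set.Icc (0 : ℝ) 1,
      γ t ∈ Metric.closedBall p a ∧ HasDerivAt γ (f (γ t)) t := by
  have hm' : (L : ℝ) * 2 ≤ a := by exact_mod_cast hm
  -- The interval `[-1, 2]` contains `[0, 1]` in its interior, which gives two-sided derivatives at
  -- the endpoints. Its points lie within `2` of the initial time, whence the factor in `hm`.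
  let t₀ : Set.Icc (-1 : ℝ) 2 := ⟨0, by norm_num, by norm_num⟩
  have hf : IsPicardLindelof (fun _ => f) t₀ p a 0 L K :=
    IsPicardLindelof.of_time_independent hb hl (by
      have : max ((2 : ℝ) - (t₀ : ℝ)) ((t₀ : ℝ) - (-1)) = 2 := by simp [t₀]
      rw [this]; simpa using hm')
  have hp : p ∈ Metric.closedBall p ((0 : NNReal) : ℝ) := by simp
  obtain ⟨α, hα⟩ := ODE.FunSpace.exists_isFixedPt_next hf hp
  refine ⟨α.compProj, ?_, fun t ht => ⟨α.compProj_mem_closedBall hf.mul_max_le, ?_⟩⟩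
  · have : α.compProj (t₀ : ℝ) = p := by
      rw [ODE.FunSpace.compProj_val, ← hα, ODE.FunSpace.next_apply₀]
    exact this
  · have ht' : t ∈ Set.Icc (-1 : ℝ) 2 := ⟨by linarith [ht.1], by linarith [ht.2]⟩
    have h : HasDerivWithinAt α.compProj (f (α.compProj t)) (Set.Icc (-1 : ℝ) 2) t := by
      apply ODE.hasDerivWithinAt_picard_Icc t₀.2 hf.continuousOn_uncurry
        α.continuous_compProj.continuousOn (fun _ ht' ↦ α.compProj_mem_closedBall hf.mul_max_le)
        p ht' |>.congr_of_mem _ ht'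
      intro t' ht'
      nth_rw 1 [← hα]
      rw [ODE.FunSpace.compProj_of_mem ht', ODE.FunSpace.next_apply]
    exact h.hasDerivAt (Icc_mem_nhds (by linarith [ht.1]) (by linarith [ht.2]))

theorem norm_sub_sub_fderiv_le_of_lipschitzOnWith {E F : Type*} [NormedAddCommGroup E]
    [NormedSpace ℝ E] [NormedAddCommGroup F] [NormedSpace ℝ F] {f : E → F} {s : Set E} {K : NNReal}
    (hs : Convex ℝ s) (hd : ∀ z ∈ s, DifferentiableAt ℝ f z)
    (hK : LipschitzOnWith K (fderiv ℝ f) s) {z w : E} (hz : z ∈ s) (hw : w ∈ s) :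
    ‖f w - f z - fderiv ℝ f z (w - z)‖ ≤ K * ‖w - z‖ ^ 2 := by
  have hseg : segment ℝ z w ⊆ s := hs.segment_subset hz hw
  have := (convex_segment z w).norm_image_sub_le_of_norm_hasFDerivWithin_le'
    (f := f) (f' := fderiv ℝ f) (φ := fderiv ℝ f z) (C := K * ‖w - z‖)
    (fun y hy => (hd y (hseg hy)).hasFDerivAt.hasFDerivWithinAt)
    (fun y hy => by
      refine (hK.norm_sub_le (hseg hy) hz).trans ?_
      gcongr
      obtain ⟨a, b, ha, hb, hab, rfl⟩ := hy
      have : a • z + b • w - z = b • (w - z) := by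
        rw [← eq_sub_iff_add_eq] at hab
        rw [hab]; module
      rw [this, norm_smul, Real.norm_of_nonneg hb]
      exact mul_le_of_le_one_left (norm_nonneg _) (by linarith))
    (left_mem_segment ℝ z w) (right_mem_segment ℝ z w)
  calc _ ≤ _ := this
    _ = _ := by ring

theorem ContinuousAt.eventually_norm_lt {E F : Type*} [TopologicalSpace E]
    [SeminormedAddCommGroup F] {f : E → F} {p : E} (h : ContinuousAt f p) :
    ∀ᶠ z in 𝓝 p, ‖f z‖ < ‖f p‖ + 1 :=
  h.norm.eventually_lt continuousAt_const (lt_add_one _)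

theorem gronwallBound_zero_eq_mul (K ε x : ℝ) :
    gronwallBound 0 K ε x = ε * gronwallBound 0 K 1 x := by
  unfold gronwallBound
  split_ifs <;> ring

/-- A frame of vector fields `z ↦ X z x`, linear in the parameter `x`, which commute along a level
set of `r` to which they are tangent, integrates to a parametrized submanifold of the level set. -/
theorem exists_integral_of_commuting_frame {E : Type*} [NormedAddCommGroup E] [NormedSpace ℝ E]
    [CompleteSpace E] {X : E → E →L[ℝ] E} {p : E} {r : E → ℝ} {W : Set E} (hW : W ∈ 𝓝 p)
    (hX : ContDiffAt ℝ 2 X p)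
    (hr : ∀ᶠ z in 𝓝 p, DifferentiableAt ℝ r z ∧ ∀ x, fderiv ℝ r z (X z x) = 0)
    (hcomm : ∀ᶠ z in 𝓝 p, r z = r p →
      ∀ x v, fderiv ℝ X z (X z x) v = fderiv ℝ X z (X z v) x) :
    ∃ (φ : E → E) (δ : ℝ), 0 < δ ∧ φ 0 = p ∧ ∀ x ∈ Metric.ball (0 : E) δ,
      φ x ∈ W ∧ r (φ x) = r p ∧ HasFDerivAt φ (X (φ x)) x ∧
        ((∀ z ∈ W, X z x = 0) → φ x = p) := by
  obtain ⟨K₁, s₁, hs₁, hK₁⟩ := (hX.of_le (by norm_num)).exists_lipschitzOnWith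
  have hX' : ContDiffAt ℝ 1 (fderiv ℝ X) p := hX.fderiv_right (by norm_num)
  obtain ⟨K₂, s₂, hs₂, hK₂⟩ := hX'.exists_lipschitzOnWith
  have hM₁ : ∀ᶠ z in 𝓝 p, ‖X z‖ < ‖X p‖ + 1 :=
    hX.continuousAt.eventually_norm_lt
  have hM₂ : ∀ᶠ z in 𝓝 p, ‖fderiv ℝ X z‖ < ‖fderiv ℝ X p‖ + 1 :=
    hX'.continuousAt.eventually_norm_lt
  have hd : ∀ᶠ z in 𝓝 p, DifferentiableAt ℝ X z :=
    (hX.eventually (by simp)).mono fun z hz => hz.differentiableAt (by simp)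
  obtain ⟨ρ, hρ, hball⟩ := Metric.eventually_nhds_iff_ball.1
    ((hr.and hcomm).and ((hM₁.and hM₂).and (hd.and
      ((Filter.eventually_mem_set.2 hs₁).and ((Filter.eventually_mem_set.2 hs₂).and
        (Filter.eventually_mem_set.2 hW))))))
  set M : ℝ := max (‖X p‖ + 1) (‖fderiv ℝ X p‖ + 1) with hMdef
  have hM0 : 0 < M := lt_of_lt_of_le (by positivity) (le_max_left _ _)
  have bX : ∀ z ∈ Metric.ball p ρ, ‖X z‖ ≤ M := fun z hz =>
    ((hball z hz).2.1.1.le).trans (le_max_left _ _)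
  have bX' : ∀ z ∈ Metric.ball p ρ, ‖fderiv ℝ X z‖ ≤ M := fun z hz =>
    ((hball z hz).2.1.2.le).trans (le_max_right _ _)
  have hdX : ∀ z ∈ Metric.ball p ρ, DifferentiableAt ℝ X z := fun z hz => (hball z hz).2.2.1
  have lX : LipschitzOnWith K₁ X (Metric.ball p ρ) :=
    hK₁.mono fun z hz => (hball z hz).2.2.2.1
  have lX' : LipschitzOnWith K₂ (fderiv ℝ X) (Metric.ball p ρ) :=
    hK₂.mono fun z hz => (hball z hz).2.2.2.2.1
  have hWb : ∀ z ∈ Metric.ball p ρ, z ∈ W := fun z hz => (hball z hz).2.2.2.2.2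
  let a : NNReal := ⟨ρ / 2, by positivity⟩
  have ha : (a : ℝ) = ρ / 2 := rfl
  have hsub : Metric.closedBall p a ⊆ Metric.ball p ρ :=
    Metric.closedBall_subset_ball (by rw [ha]; linarith)
  -- The flows of the fields with parameter in the `δ`-ball stay within `ρ / 2` of `p`, leaving
  -- another `ρ / 2` of room for the comparison curves below. The bound by `1` gives all these
  -- fields the Lipschitz constant `K₁`.
  set δ : ℝ := min 1 (ρ / (4 * M)) with hδdef
  have hδ : 0 < δ := lt_min one_pos (by positivity)
  have hδ1 : δ ≤ 1 := min_le_left _ _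
  have hδM : M * δ * 2 ≤ ρ / 2 := by
    have : δ ≤ ρ / (4 * M) := min_le_right _ _
    rw [le_div_iff₀ (by positivity)] at this
    linarith
  have lip : ∀ x : E, ‖x‖ ≤ 1 → LipschitzOnWith K₁ (fun z => X z x) (Metric.ball p ρ) := by
    intro x hx
    refine LipschitzOnWith.of_dist_le_mul fun z hz w hw => ?_
    rw [dist_eq_norm, ← sub_apply, dist_eq_norm]
    calc ‖(X z - X w) x‖ ≤ ‖X z - X w‖ * ‖x‖ := ContinuousLinearMap.le_opNorm _ _
      _ ≤ ‖X z - X w‖ := mul_le_of_le_one_right (norm_nonneg _) hx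
      _ ≤ K₁ * ‖z - w‖ := lX.norm_sub_le hz hw
  have hflow : ∀ x : E, ∃ γ : ℝ → E, x ∈ Metric.ball (0 : E) δ → γ 0 = p ∧
      ∀ t ∈ Set.Icc (0 : ℝ) 1, γ t ∈ Metric.closedBall p a ∧ HasDerivAt γ (X (γ t) x) t := by
    intro x
    by_cases hx : x ∈ Metric.ball (0 : E) δ
    · rw [mem_ball_zero_iff] at hx
      let L : NNReal := ⟨M * δ, by positivity⟩
      obtain ⟨γ, h0, h⟩ := exists_integralCurve_mem_closedBall (f := fun z => X z x) (p := p)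
        (a := a) (L := L) (K := K₁) (fun z hz => (ContinuousLinearMap.le_opNorm _ _).trans (by
          have := bX z (hsub hz)
          change _ ≤ M * δ
          gcongr)) ((lip x (hx.le.trans hδ1)).mono hsub) (by
          rw [← NNReal.coe_le_coe]; exact hδM)
      exact ⟨γ, fun _ => ⟨h0, h⟩⟩
    · exact ⟨fun _ => p, fun h => absurd h hx⟩
  choose γ hγ using hflow
  have hcont : ∀ x ∈ Metric.ball (0 : E) δ, ContinuousOn (γ x) (Set.Icc 0 1) := fun x hx t ht =>
    (((hγ x hx).2 t ht).2).continuousAt.continuousWithinAt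
  have hlevel : ∀ x ∈ Metric.ball (0 : E) δ, ∀ t ∈ Set.Icc (0 : ℝ) 1, r (γ x t) = r p := by
    intro x hx
    have hder : ∀ t ∈ Set.Icc (0 : ℝ) 1, HasDerivAt (fun t => r (γ x t)) 0 t := fun t ht => by
      have hz := (hball _ (hsub ((hγ x hx).2 t ht).1)).1.1
      have := hz.1.hasFDerivAt.comp_hasDerivAt t ((hγ x hx).2 t ht).2
      rwa [hz.2 x] at this
    intro t ht
    have := constant_of_has_deriv_right_zero (f := fun t => r (γ x t)) (a := 0) (b := 1)
      (fun t ht => (hder t ht).continuousAt.continuousWithinAt)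
      (fun t ht => (hder t ⟨ht.1, ht.2.le⟩).hasDerivWithinAt) t ht
    simpa [(hγ x hx).1] using this
  have h1 : (1 : ℝ) ∈ Set.Icc (0 : ℝ) 1 := by simp
  have hconst : ∀ x ∈ Metric.ball (0 : E) δ, (∀ z ∈ W, X z x = 0) → γ x 1 = p := by
    intro x hx hz
    have := constant_of_has_deriv_right_zero (hcont x hx) (fun t ht => by
      have := ((hγ x hx).2 t ⟨ht.1, ht.2.le⟩)
      have h2 := this.2
      rw [hz _ (hWb _ (hsub this.1))] at h2
      exact h2.hasDerivWithinAt) 1 h1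
    rw [this, (hγ x hx).1]
  refine ⟨fun x => γ x 1, δ, hδ, hconst 0 (by simpa using hδ) (by simp), fun x hx =>
    ⟨hWb _ (hsub ((hγ x hx).2 1 h1).1), hlevel x hx 1 h1, ?_, hconst x hx⟩⟩
  set C : ℝ := M ^ 2 + K₂ * M ^ 2 with hC
  have hxδ : ‖x‖ < δ := by simpa using hx
  -- The value `φ x` is the time-one flow of the field with parameter `x`. The curve `t ↦ γ x t + t
  -- • X (γ x t) v` solves the equation with parameter `x + v` up to an error `O(‖v‖²)`, so
  -- Grönwall's inequality compares it with `γ (x + v)`; at time one this is differentiability with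
  -- derivative `X (φ x)`.
  have key : ∀ᶠ v in 𝓝 (0 : E), ‖γ (x + v) 1 - γ x 1 - X (γ x 1) v‖ ≤
      (C * gronwallBound 0 K₁ 1 1) * ‖v‖ ^ 2 := by
    have hv0 : ∀ᶠ v in 𝓝 (0 : E), ‖v‖ < min (δ - ‖x‖) (ρ / (2 * M)) := by
      have := Metric.ball_mem_nhds (0 : E) (ε := min (δ - ‖x‖) (ρ / (2 * M)))
        (lt_min (by linarith) (by positivity))
      filter_upwards [this] with v hv
      simpa using hv
    filter_upwards [hv0] with v hv
    have hv1 : ‖v‖ < δ - ‖x‖ := hv.trans_le (min_le_left _ _)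
    have hv2 : M * ‖v‖ < ρ / 2 := by
      have := hv.trans_le (min_le_right _ _)
      rw [lt_div_iff₀ (by positivity)] at this
      linarith
    have hxvn : ‖x + v‖ < δ := (norm_add_le _ _).trans_lt (by linarith)
    have hxv : x + v ∈ Metric.ball (0 : E) δ := by simpa using hxvn
    have hγb : ∀ t ∈ Set.Icc (0 : ℝ) 1, γ x t ∈ Metric.ball p ρ := fun t ht =>
      hsub ((hγ x hx).2 t ht).1
    have hXv : ∀ t ∈ Set.Icc (0 : ℝ) 1, ‖t • X (γ x t) v‖ ≤ M * ‖v‖ := fun t ht => by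
      rw [norm_smul, Real.norm_of_nonneg ht.1]
      calc t * ‖X (γ x t) v‖ ≤ 1 * (M * ‖v‖) := by
            gcongr
            · exact ht.2
            · exact (ContinuousLinearMap.le_opNorm _ _).trans (by gcongr; exact bX _ (hγb t ht))
        _ = M * ‖v‖ := one_mul _
    have hηb : ∀ t ∈ Set.Icc (0 : ℝ) 1, γ x t + t • X (γ x t) v ∈ Metric.ball p ρ := by
      intro t ht
      have h1 := ((hγ x hx).2 t ht).1
      rw [mem_closedBall_iff_norm, ha] at h1
      rw [mem_ball_iff_norm]
      calc ‖γ x t + t • X (γ x t) v - p‖ = ‖(γ x t - p) + t • X (γ x t) v‖ := by congr 1; abel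
        _ ≤ ‖γ x t - p‖ + ‖t • X (γ x t) v‖ := norm_add_le _ _
        _ < ρ := by linarith [hXv t ht]
    have hη' : ∀ t ∈ Set.Icc (0 : ℝ) 1, HasDerivAt (fun t => γ x t + t • X (γ x t) v)
        (X (γ x t) x + (t • fderiv ℝ X (γ x t) (X (γ x t) x) v + X (γ x t) v)) t := by
      intro t ht
      have hg := ((hγ x hx).2 t ht).2
      have e1 : HasDerivAt (fun t => X (γ x t) v) (fderiv ℝ X (γ x t) (X (γ x t) x) v) t :=
        (ContinuousLinearMap.apply ℝ E v).hasFDerivAt.comp_hasDerivAt t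
          ((hdX _ (hγb t ht)).hasFDerivAt.comp_hasDerivAt t hg)
      have e2 := (hasDerivAt_id t).smul e1
      simp only [id, one_smul] at e2
      exact hg.add e2
    have hgr := dist_le_of_approx_trajectories_ODE_of_mem (v := fun _ z => X z (x + v))
      (s := fun _ => Metric.ball p ρ) (K := K₁) (a := 0) (b := 1) (εf := C * ‖v‖ ^ 2) (εg := 0)
      (δ := 0) (f := fun t => γ x t + t • X (γ x t) v) (g := γ (x + v))
      (f' := fun t => X (γ x t) x + (t • fderiv ℝ X (γ x t) (X (γ x t) x) v + X (γ x t) v))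
      (g' := fun t => X (γ (x + v) t) (x + v))
      (fun t _ => lip _ (hxvn.le.trans hδ1))
      (fun t ht => (hη' t ht).continuousAt.continuousWithinAt)
      (fun t ht => (hη' t ⟨ht.1, ht.2.le⟩).hasDerivWithinAt)
      ?_ (fun t ht => hηb t ⟨ht.1, ht.2.le⟩) (hcont _ hxv)
      (fun t ht => ((hγ _ hxv).2 t ⟨ht.1, ht.2.le⟩).2.hasDerivWithinAt)
      (fun t _ => by simp) (fun t ht => hsub ((hγ _ hxv).2 t ⟨ht.1, ht.2.le⟩).1)
      (by simp [(hγ x hx).1, (hγ _ hxv).1]) 1 h1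
    · rw [dist_comm, dist_eq_norm, add_zero, sub_zero, gronwallBound_zero_eq_mul, one_smul] at hgr
      calc _ = ‖γ (x + v) 1 - (γ x 1 + X (γ x 1) v)‖ := by congr 1; abel
        _ ≤ _ := hgr
        _ = _ := by ring
    · intro t ht'
      have ht : t ∈ Set.Icc (0 : ℝ) 1 := ⟨ht'.1, ht'.2.le⟩
      have hc := (hball _ (hγb t ht)).1.2 (hlevel x hx t ht) x v
      have hrem := norm_sub_sub_fderiv_le_of_lipschitzOnWith (convex_ball p ρ) hdX lX'
        (hγb t ht) (hηb t ht)
      rw [add_sub_cancel_left] at hrem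
      set z := γ x t
      set h := t • X z v with hh
      set R := X (z + h) - X z - fderiv ℝ X z h with hR
      -- Commutation cancels the only term of first order in `v`. It is available because the curve
      -- stays in the level set.
      have e : X z x + (t • fderiv ℝ X z (X z x) v + X z v) - X (z + h) (x + v) =
          -(R (x + v)) - fderiv ℝ X z h v := by
        have : X (z + h) = R + X z + fderiv ℝ X z h := by rw [hR]; abel
        rw [this, hc]
        simp only [add_apply, map_add, hh, map_smul,
          smul_apply]
        abel
      rw [dist_eq_norm]
      change ‖X z x + (t • fderiv ℝ X z (X z x) v + X z v) - X (z + h) (x + v)‖ ≤ _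
      rw [e]
      have b1 : ‖R (x + v)‖ ≤ K₂ * M ^ 2 * ‖v‖ ^ 2 :=
        calc ‖R (x + v)‖ ≤ ‖R‖ * ‖x + v‖ := ContinuousLinearMap.le_opNorm _ _
          _ ≤ ‖R‖ := mul_le_of_le_one_right (norm_nonneg _) (hxvn.le.trans hδ1)
          _ ≤ K₂ * ‖h‖ ^ 2 := hrem
          _ ≤ K₂ * (M * ‖v‖) ^ 2 := by gcongr; exact hXv t ht
          _ = _ := by ring
      have b2 : ‖fderiv ℝ X z h v‖ ≤ M ^ 2 * ‖v‖ ^ 2 :=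
        calc ‖fderiv ℝ X z h v‖ ≤ ‖fderiv ℝ X z h‖ * ‖v‖ := ContinuousLinearMap.le_opNorm _ _
          _ ≤ (‖fderiv ℝ X z‖ * ‖h‖) * ‖v‖ := by
            gcongr; exact ContinuousLinearMap.le_opNorm _ _
          _ ≤ (M * (M * ‖v‖)) * ‖v‖ := by
            gcongr
            · exact bX' _ (hγb t ht)
            · exact hXv t ht
          _ = _ := by ring
      calc _ ≤ ‖-(R (x + v))‖ + ‖fderiv ℝ X z h v‖ := norm_sub_le _ _
        _ ≤ C * ‖v‖ ^ 2 := by rw [norm_neg, hC]; linarith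
  rw [hasFDerivAt_iff_isLittleO_nhds_zero]
  refine Asymptotics.IsBigO.trans_isLittleO ?_ (Asymptotics.isLittleO_norm_pow_id one_lt_two)
  refine Asymptotics.IsBigO.of_bound (C * gronwallBound 0 K₁ 1 1) (key.mono fun v hv => ?_)
  rwa [norm_pow, norm_norm]

/-! ### The real Levi two-form and the involutivity of its null directions -/

section RealCalculus

variable {E : Type*} [NormedAddCommGroup E] [NormedSpace ℝ E]

/-- The derivative of `θ = dr ∘ J`, that is, `dθ(u, v) = D²r(u, Jv) - D²r(v, Ju)`. For `J` the
multiplication by `i` it is the real form of the Levi form. -/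
noncomputable def leviTwoForm (J : E →L[ℝ] E) (r : E → ℝ) (z u v : E) : ℝ :=
  fderiv ℝ (fderiv ℝ r) z u (J v) - fderiv ℝ (fderiv ℝ r) z v (J u)

theorem leviTwoForm_swap (J : E →L[ℝ] E) (r : E → ℝ) (z u v : E) :
    leviTwoForm J r z v u = -leviTwoForm J r z u v := by
  simp [leviTwoForm]

theorem leviTwoForm_add_left (J : E →L[ℝ] E) (r : E → ℝ) (z u u' v : E) :
    leviTwoForm J r z (u + u') v = leviTwoForm J r z u v + leviTwoForm J r z u' v := by
  simp only [leviTwoForm, map_add, add_apply]; ring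

theorem leviTwoForm_smul_left (J : E →L[ℝ] E) (r : E → ℝ) (z u v : E) (c : ℝ) :
    leviTwoForm J r z (c • u) v = c * leviTwoForm J r z u v := by
  simp only [leviTwoForm, map_smul, smul_apply, smul_eq_mul]; ring

theorem leviTwoForm_add_right (J : E →L[ℝ] E) (r : E → ℝ) (z u v v' : E) :
    leviTwoForm J r z u (v + v') = leviTwoForm J r z u v + leviTwoForm J r z u v' := by
  simp only [leviTwoForm, map_add, add_apply]; ring

theorem leviTwoForm_smul_right (J : E →L[ℝ] E) (r : E → ℝ) (z u v : E) (c : ℝ) :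
    leviTwoForm J r z u (c • v) = c * leviTwoForm J r z u v := by
  simp only [leviTwoForm, map_smul, smul_apply, smul_eq_mul]; ring

theorem leviTwoForm_sub_left (J : E →L[ℝ] E) (r : E → ℝ) (z u u' v : E) :
    leviTwoForm J r z (u - u') v = leviTwoForm J r z u v - leviTwoForm J r z u' v := by
  simp only [leviTwoForm, map_sub, sub_apply]; ring

theorem fderiv_clm_apply_apply {B : E → E →L[ℝ] E →L[ℝ] ℝ} {U V : E → E} {z : E}
    (hB : DifferentiableAt ℝ B z) (hU : DifferentiableAt ℝ U z) (hV : DifferentiableAt ℝ V z)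
    (v : E) :
    HasFDerivAt (fun w => B w (U w) (V w)) (fderiv ℝ (fun w => B w (U w) (V w)) z) z ∧
    fderiv ℝ (fun w => B w (U w) (V w)) z v =
      fderiv ℝ B z v (U z) (V z) + B z (fderiv ℝ U z v) (V z) + B z (U z) (fderiv ℝ V z v) := by
  have h1 := hB.hasFDerivAt.clm_apply hU.hasFDerivAt
  have h := h1.clm_apply hV.hasFDerivAt
  refine ⟨h.differentiableAt.hasFDerivAt, ?_⟩
  rw [h.fderiv]
  simp only [add_apply, ContinuousLinearMap.comp_apply, ContinuousLinearMap.flip_apply]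
  ring

theorem fderiv_fderiv_apply {r : E → ℝ} {U : E → E} {z : E}
    (hr : ContDiffAt ℝ 2 r z) (hU : DifferentiableAt ℝ U z) (v : E) :
    fderiv ℝ (fun w => fderiv ℝ r w (U w)) z v =
      fderiv ℝ (fderiv ℝ r) z v (U z) + fderiv ℝ r z (fderiv ℝ U z v) := by
  have hD : DifferentiableAt ℝ (fderiv ℝ r) z :=
    (hr.fderiv_right (m := 1) (by norm_num)).differentiableAt (by simp)
  rw [(hD.hasFDerivAt.clm_apply hU.hasFDerivAt).fderiv]
  simp only [add_apply, ContinuousLinearMap.comp_apply, ContinuousLinearMap.flip_apply]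
  ring

theorem fderiv_leviTwoForm {J : E →L[ℝ] E} {r : E → ℝ} {U V : E → E} {z : E}
    (hr : ContDiffAt ℝ 3 r z) (hU : ContDiffAt ℝ 1 U z) (hV : ContDiffAt ℝ 1 V z) (v : E) :
    ContDiffAt ℝ 1 (fun w => leviTwoForm J r w (U w) (V w)) z ∧
    fderiv ℝ (fun w => leviTwoForm J r w (U w) (V w)) z v =
      fderiv ℝ (fderiv ℝ (fderiv ℝ r)) z v (U z) (J (V z)) -
        fderiv ℝ (fderiv ℝ (fderiv ℝ r)) z v (V z) (J (U z)) +
      leviTwoForm J r z (fderiv ℝ U z v) (V z) + leviTwoForm J r z (U z) (fderiv ℝ V z v) := by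
  have hD2 : ContDiffAt ℝ 1 (fderiv ℝ (fderiv ℝ r)) z :=
    (hr.fderiv_right (m := 2) (by norm_num)).fderiv_right (m := 1) (by norm_num)
  have hJU : ContDiffAt ℝ 1 (fun w => J (U w)) z := J.contDiff.contDiffAt.comp z hU
  have hJV : ContDiffAt ℝ 1 (fun w => J (V w)) z := J.contDiff.contDiffAt.comp z hV
  refine ⟨((hD2.clm_apply hU).clm_apply hJV).sub ((hD2.clm_apply hV).clm_apply hJU), ?_⟩
  have dU := hU.differentiableAt one_ne_zero
  have dV := hV.differentiableAt one_ne_zero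
  have dD := hD2.differentiableAt one_ne_zero
  have dJU := hJU.differentiableAt one_ne_zero
  have dJV := hJV.differentiableAt one_ne_zero
  have eJU : fderiv ℝ (fun w => J (U w)) z v = J (fderiv ℝ U z v) := by
    rw [HasFDerivAt.fderiv (f := fun w => J (U w)) (J.hasFDerivAt.comp z dU.hasFDerivAt)]; rfl
  have eJV : fderiv ℝ (fun w => J (V w)) z v = J (fderiv ℝ V z v) := by
    rw [HasFDerivAt.fderiv (f := fun w => J (V w)) (J.hasFDerivAt.comp z dV.hasFDerivAt)]; rfl
  have h1 := fderiv_clm_apply_apply dD dU dJV v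
  have h2 := fderiv_clm_apply_apply dD dV dJU v
  have e : fderiv ℝ (fun w => leviTwoForm J r w (U w) (V w)) z =
      fderiv ℝ (fun w => fderiv ℝ (fderiv ℝ r) w (U w) (J (V w))) z -
      fderiv ℝ (fun w => fderiv ℝ (fderiv ℝ r) w (V w) (J (U w))) z :=
    (h1.1.sub h2.1).fderiv
  rw [e, sub_apply, h1.2, h2.2, eJU, eJV]
  simp only [leviTwoForm]
  ring

/-- The bracket of two fields of Levi-null vectors along a level set is Levi-null again. -/
theorem leviTwoForm_bracket_eq_zero [CompleteSpace E] {J : E →L[ℝ] E} {r : E → ℝ} {z : E}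
    {X₁ X₂ Y : E → E} (hr : ContDiffAt ℝ 3 r z) (hdr : fderiv ℝ r z ≠ 0)
    (hX₁ : ContDiffAt ℝ 1 X₁ z) (hX₂ : ContDiffAt ℝ 1 X₂ z) (hY : ContDiffAt ℝ 1 Y z)
    (h₁ : ∀ᶠ w in 𝓝 z, fderiv ℝ r w (X₁ w) = 0 ∧ fderiv ℝ r w (J (X₁ w)) = 0)
    (h₂ : ∀ᶠ w in 𝓝 z, fderiv ℝ r w (X₂ w) = 0 ∧ fderiv ℝ r w (J (X₂ w)) = 0)
    (h₃ : ∀ᶠ w in 𝓝 z, fderiv ℝ r w (Y w) = 0 ∧ fderiv ℝ r w (J (Y w)) = 0)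
    (hT : ∀ᶠ w in 𝓝 z, r w = r z → leviTwoForm J r w (X₁ w) (Y w) = 0 ∧
      leviTwoForm J r w (X₂ w) (Y w) = 0 ∧ leviTwoForm J r w (X₁ w) (X₂ w) = 0)
    (hN₁ : ∃ a b : ℝ, ∀ u, leviTwoForm J r z (X₁ z) u =
      a * fderiv ℝ r z u + b * fderiv ℝ r z (J u))
    (hN₂ : ∃ a b : ℝ, ∀ u, leviTwoForm J r z (X₂ z) u =
      a * fderiv ℝ r z u + b * fderiv ℝ r z (J u)) :
    fderiv ℝ r z (fderiv ℝ X₂ z (X₁ z) - fderiv ℝ X₁ z (X₂ z)) = 0 ∧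
    fderiv ℝ r z (J (fderiv ℝ X₂ z (X₁ z) - fderiv ℝ X₁ z (X₂ z))) = 0 ∧
    leviTwoForm J r z (fderiv ℝ X₂ z (X₁ z) - fderiv ℝ X₁ z (X₂ z)) (Y z) = 0 := by
  have hr2 : ContDiffAt ℝ 2 r z := hr.of_le (by norm_num)
  have hdr1 : ContDiffAt ℝ 2 (fderiv ℝ r) z := hr.fderiv_right (by norm_num)
  have symb : ∀ u v, fderiv ℝ (fderiv ℝ r) z u v = fderiv ℝ (fderiv ℝ r) z v u :=
    fun u v => hr2.isSymmSndFDerivAt (by simp) u v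
  have symc : ∀ u v, fderiv ℝ (fderiv ℝ (fderiv ℝ r)) z u v =
      fderiv ℝ (fderiv ℝ (fderiv ℝ r)) z v u :=
    fun u v => hdr1.isSymmSndFDerivAt (by simp) u v
  have tang : ∀ {U : E → E}, ContDiffAt ℝ 1 U z →
      (∀ᶠ w in 𝓝 z, fderiv ℝ r w (U w) = 0 ∧ fderiv ℝ r w (J (U w)) = 0) → ∀ v,
      fderiv ℝ (fderiv ℝ r) z v (U z) + fderiv ℝ r z (fderiv ℝ U z v) = 0 ∧
      fderiv ℝ (fderiv ℝ r) z v (J (U z)) + fderiv ℝ r z (J (fderiv ℝ U z v)) = 0 := by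
    intro U hU h v
    have dU := hU.differentiableAt one_ne_zero
    have dJU : HasFDerivAt (fun w => J (U w)) (J.comp (fderiv ℝ U z)) z :=
      J.hasFDerivAt.comp z dU.hasFDerivAt
    constructor
    · rw [← fderiv_fderiv_apply hr2 dU]
      have : (fun w => fderiv ℝ r w (U w)) =ᶠ[𝓝 z] fun _ => 0 := h.mono fun w hw => hw.1
      rw [this.fderiv_eq]; simp
    · have e := fderiv_fderiv_apply hr2 dJU.differentiableAt v
      rw [dJU.fderiv] at e
      have : (fun w => fderiv ℝ r w (J (U w))) =ᶠ[𝓝 z] fun _ => 0 := h.mono fun w hw => hw.2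
      rw [this.fderiv_eq] at e
      simpa using e.symm
  have t₁ := tang hX₁ h₁
  have t₂ := tang hX₂ h₂
  have t₃ := tang hY h₃
  obtain ⟨a₁, b₁, hN₁⟩ := hN₁
  obtain ⟨a₂, b₂, hN₂⟩ := hN₂
  have hr1 : ContDiffAt ℝ 1 r z := hr.of_le (by norm_num)
  -- The three pairings vanish on the level set, so each has zero derivative in the direction of the
  -- remaining tangent field.
  obtain ⟨d₁, e₁⟩ := fderiv_leviTwoForm (J := J) hr hX₁ hY (X₂ z)
  obtain ⟨d₂, e₂⟩ := fderiv_leviTwoForm (J := J) hr hX₂ hY (X₁ z)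
  obtain ⟨d₃, e₃⟩ := fderiv_leviTwoForm (J := J) hr hX₁ hX₂ (Y z)
  rw [fderiv_eq_zero_of_eqOn_levelSet hr1 d₁ (hT.mono fun w hw h => (hw h).1) hdr
    h₂.self_of_nhds.1] at e₁
  rw [fderiv_eq_zero_of_eqOn_levelSet hr1 d₂ (hT.mono fun w hw h => (hw h).2.1) hdr
    h₁.self_of_nhds.1] at e₂
  rw [fderiv_eq_zero_of_eqOn_levelSet hr1 d₃ (hT.mono fun w hw h => (hw h).2.2) hdr
    h₃.self_of_nhds.1] at e₃
  obtain ⟨z₁, z₂, z₃⟩ := hT.self_of_nhds rfl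
  -- Derivatives of the fields need not be tangent. The null conditions turn their pairings with
  -- `X₁` and `X₂` into values of `dr` and `dr ∘ J`, which the differentiated tangency relations
  -- evaluate.
  rw [hN₁] at e₁
  rw [hN₂] at e₂
  rw [leviTwoForm_swap J r z (X₂ z) (fderiv ℝ X₁ z (Y z)), hN₁, hN₂] at e₃
  rw [symc (X₁ z) (X₂ z), symc (X₁ z) (Y z)] at e₂
  rw [symc (X₂ z) (Y z)] at e₁
  -- The three claims are, in order: symmetry of the Hessian; Cartan's formula `θ([X₁, X₂]) =
  -- -dθ(X₁, X₂)`; and `d(dθ) = 0`, by cancellation of the third derivatives of `r` in the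
  -- combination `e₁ - e₂ - e₃`.
  refine ⟨?_, ?_, ?_⟩
  · rw [map_sub]
    linear_combination (t₂ (X₁ z)).1 - (t₁ (X₂ z)).1 - symb (X₁ z) (X₂ z)
  · rw [map_sub, map_sub]
    unfold leviTwoForm at z₃
    linear_combination (t₂ (X₁ z)).2 - (t₁ (X₂ z)).2 - z₃
  · rw [leviTwoForm_sub_left]
    unfold leviTwoForm at z₁ z₂
    linear_combination e₁ - e₂ - e₃ + a₁ * (t₃ (X₂ z)).1 + b₁ * (t₃ (X₂ z)).2 - a₂ * (t₃ (X₁ z)).1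
      - b₂ * (t₃ (X₁ z)).2 - a₁ * (t₂ (Y z)).1 - b₁ * (t₂ (Y z)).2 + a₂ * (t₁ (Y z)).1
      + b₂ * (t₁ (Y z)).2 + b₂ * z₁ - b₁ * z₂ - a₁ * symb (X₂ z) (Y z) + a₂ * symb (X₁ z) (Y z)

end RealCalculus

noncomputable section

/-! ### The complex gradient and the complex-valued Levi form -/

section ComplexCalculus

variable {n : ℕ}

/-- Multiplication by `i`, as a real-linear map. -/
def mulI (n : ℕ) : Cn n →L[ℝ] Cn n :=
  (Complex.I • ContinuousLinearMap.id ℂ (Cn n)).restrictScalars ℝ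

@[simp] theorem mulI_apply (u : Cn n) : mulI n u = Complex.I • u := rfl

theorem I_smul_I_smul (u : Cn n) : Complex.I • Complex.I • u = -u := by
  rw [smul_smul, Complex.I_mul_I, neg_one_smul]

theorem complex_smul_eq (c : ℂ) (u : Cn n) : c • u = c.re • u + c.im • Complex.I • u := by
  conv_lhs => rw [← Complex.re_add_im c]
  rw [add_smul, mul_smul]
  rfl

/-- The complex-linear form `2∂r`, whose real part is `dr`. -/
def dC (r : Cn n → ℝ) (z : Cn n) : Cn n →L[ℂ] ℂ :=
  StrongDual.extendRCLike (𝕜 := ℂ) (fderiv ℝ r z)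

theorem dC_apply (r : Cn n → ℝ) (z u : Cn n) :
    dC r z u = (fderiv ℝ r z u : ℂ) - Complex.I * fderiv ℝ r z (Complex.I • u) := by
  simp [dC, StrongDual.extendRCLike_apply]

theorem dC_re (r : Cn n → ℝ) (z u : Cn n) : (dC r z u).re = fderiv ℝ r z u := by
  simp [dC_apply]

theorem dC_im (r : Cn n → ℝ) (z u : Cn n) :
    (dC r z u).im = -fderiv ℝ r z (Complex.I • u) := by
  simp [dC_apply]

theorem dC_eq_zero_iff {r : Cn n → ℝ} {z u : Cn n} :
    dC r z u = 0 ↔ fderiv ℝ r z u = 0 ∧ fderiv ℝ r z (Complex.I • u) = 0 := by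
  rw [Complex.ext_iff, dC_re, dC_im]; simp

theorem contDiffAt_dC {r : Cn n → ℝ} {z : Cn n} (hr : ContDiffAt ℝ ∞ r z) :
    ContDiffAt ℝ ∞ (dC r) z := by
  have h : ContDiffAt ℝ ∞ (fderiv ℝ r) z := hr.fderiv_right (by simp)
  exact (StrongDual.extendRCLikeₗᵢ (𝕜 := ℂ)
    (F := Cn n)).toContinuousLinearEquiv.contDiff.contDiffAt.comp z h

theorem leviTwoForm_I_left {r : Cn n → ℝ} {z : Cn n} (hr : ContDiffAt ℝ 2 r z) (u v : Cn n) :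
    leviTwoForm (mulI n) r z (Complex.I • u) v = -leviTwoForm (mulI n) r z u (Complex.I • v) := by
  have hs := hr.isSymmSndFDerivAt (by simp)
  simp only [leviTwoForm, mulI_apply, I_smul_I_smul, map_neg]
  rw [hs.eq v u, hs.eq (Complex.I • u) (Complex.I • v)]
  ring

/-- The Levi form as a complex number, on all of `ℂⁿ` (four times the Levi form). -/
def leviC (r : Cn n → ℝ) (z u v : Cn n) : ℂ :=
  ⟨-leviTwoForm (mulI n) r z u (Complex.I • v), leviTwoForm (mulI n) r z u v⟩

theorem leviC_eq_zero_iff {r : Cn n → ℝ} {z u v : Cn n} :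
    leviC r z u v = 0 ↔ leviTwoForm (mulI n) r z u v = 0 ∧
      leviTwoForm (mulI n) r z u (Complex.I • v) = 0 := by
  rw [Complex.ext_iff]; simp [leviC, and_comm]

theorem leviC_add_left (r : Cn n → ℝ) (z u u' v : Cn n) :
    leviC r z (u + u') v = leviC r z u v + leviC r z u' v := by
  apply Complex.ext <;> simp [leviC, leviTwoForm_add_left, add_comm]

theorem leviC_add_right (r : Cn n → ℝ) (z u v v' : Cn n) :
    leviC r z u (v + v') = leviC r z u v + leviC r z u v' := by
  apply Complex.ext <;> simp [leviC, leviTwoForm_add_right, add_comm]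

theorem leviC_smul_left {r : Cn n → ℝ} {z : Cn n} (hr : ContDiffAt ℝ 2 r z) (c : ℂ) (u v : Cn n) :
    leviC r z (c • u) v = c * leviC r z u v := by
  rw [complex_smul_eq]
  have hneg : leviTwoForm (mulI n) r z u (-v) = -leviTwoForm (mulI n) r z u v := by
    rw [← neg_one_smul ℝ v, leviTwoForm_smul_right]; ring
  apply Complex.ext
  · simp only [leviC, leviTwoForm_add_left, leviTwoForm_smul_left, leviTwoForm_I_left hr,
      I_smul_I_smul, Complex.mul_re, hneg]
    ring
  · simp only [leviC, leviTwoForm_add_left, leviTwoForm_smul_left, leviTwoForm_I_left hr,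
      Complex.mul_im]

theorem leviC_smul_right {r : Cn n → ℝ} {z : Cn n} (c : ℂ) (u v : Cn n) :
    leviC r z u (c • v) = (starRingEnd ℂ) c * leviC r z u v := by
  rw [complex_smul_eq]
  have hI : ∀ w : Cn n, Complex.I • (c.re • v + c.im • Complex.I • v) =
      c.re • Complex.I • v + c.im • (-1 : ℝ) • v := fun w => by
    rw [smul_add, smul_comm, smul_comm Complex.I c.im, I_smul_I_smul, neg_one_smul]
  apply Complex.ext <;>
  · simp only [leviC, leviTwoForm_add_right, leviTwoForm_smul_right, hI v,
      Complex.mul_re, Complex.mul_im, Complex.conj_re, Complex.conj_im]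
    ring

theorem leviC_zero_left (r : Cn n → ℝ) (z v : Cn n) : leviC r z 0 v = 0 := by
  simp [leviC_eq_zero_iff, leviTwoForm]

theorem leviC_sum_left {ι : Type*} (s : Finset ι) (r : Cn n → ℝ) (z v : Cn n) (u : ι → Cn n) :
    leviC r z (∑ i ∈ s, u i) v = ∑ i ∈ s, leviC r z (u i) v := by
  classical
  induction s using Finset.induction_on with
  | empty => simp [leviC_zero_left]
  | insert a s ha ih => rw [Finset.sum_insert ha, Finset.sum_insert ha, leviC_add_left, ih]

theorem contDiffAt_leviC {r : Cn n → ℝ} {z : Cn n} {U V : Cn n → Cn n} (hr : ContDiffAt ℝ ∞ r z)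
    (hU : ContDiffAt ℝ ∞ U z) (hV : ContDiffAt ℝ ∞ V z) :
    ContDiffAt ℝ ∞ (fun w => leviC r w (U w) (V w)) z := by
  have h2 : ContDiffAt ℝ ∞ (fderiv ℝ (fderiv ℝ r)) z :=
    ContDiffAt.fderiv_right (m := ∞) (n := ∞) (hr.fderiv_right (by simp)) (by simp)
  have hJ : ∀ {W : Cn n → Cn n}, ContDiffAt ℝ ∞ W z →
      ContDiffAt ℝ ∞ (fun w => mulI n (W w)) z := fun hW =>
    (mulI n).contDiff.contDiffAt.comp z hW
  have hT : ∀ {U V : Cn n → Cn n}, ContDiffAt ℝ ∞ U z → ContDiffAt ℝ ∞ V z →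
      ContDiffAt ℝ ∞ (fun w => leviTwoForm (mulI n) r w (U w) (V w)) z := fun hU hV =>
    ((h2.clm_apply hU).clm_apply (hJ hV)).sub ((h2.clm_apply hV).clm_apply (hJ hU))
  have e : (fun w => leviC r w (U w) (V w)) = fun w =>
      Complex.equivRealProdCLM.symm (-leviTwoForm (mulI n) r w (U w) (mulI n (V w)),
        leviTwoForm (mulI n) r w (U w) (V w)) := by
    funext w
    rfl
  rw [e]
  exact Complex.equivRealProdCLM.symm.contDiff.contDiffAt.comp z
    ((hT hU (hJ hV)).neg.prodMk (hT hU hV))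

/-- The orthogonal projection to the span of the coordinate vectors with index in `s`. -/
def coordProj (s : Finset (Fin n)) : Cn n →L[ℂ] Cn n :=
  ∑ j ∈ s, (EuclideanSpace.proj (𝕜 := ℂ) j).smulRight (coordVec j)

theorem coordVec_apply (i j : Fin n) : (coordVec j : Cn n) i = if i = j then 1 else 0 := by
  simp [coordVec]

theorem coordProj_apply (s : Finset (Fin n)) (u : Cn n) (i : Fin n) :
    coordProj s u i = if i ∈ s then u i else 0 := by
  simp [coordProj, coordVec_apply]

theorem sum_smul_coordVec (u : Cn n) : ∑ j, u j • (coordVec j : Cn n) = u := by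
  ext i; simp [coordVec_apply]

theorem ContDiffAt.clm_apply_const {F G : Type*} [NormedAddCommGroup F] [NormedSpace ℂ F]
    [NormedAddCommGroup G] [NormedSpace ℂ G] {k : WithTop ℕ∞}
    {f : Cn n → F →L[ℂ] G} {z : Cn n} (hf : ContDiffAt ℝ k f z) (u : F) :
    ContDiffAt ℝ k (fun z => f z u) z :=
  (((ContinuousLinearMap.apply ℂ G u).contDiff (n := k)).restrict_scalars ℝ).contDiffAt.comp z hf

end ComplexCalculus

/-! ### A smooth frame for the Levi null spaces -/

section Frame

variable {n : ℕ} [NeZero n]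

/-- `∂r / ∂r(e₁)`. -/
def gradRatio (r : Cn n → ℝ) (z : Cn n) : Cn n →L[ℂ] ℂ :=
  (dC r z (coordVec 0))⁻¹ • dC r z

/-- The projection along `e₁` to the complex tangent space of the level set of `r`. -/
def tangentProj (r : Cn n → ℝ) (z : Cn n) : Cn n →L[ℂ] Cn n :=
  ContinuousLinearMap.id ℂ (Cn n) - (gradRatio r z).smulRight (coordVec 0)

theorem tangentProj_apply (r : Cn n → ℝ) (z u : Cn n) :
    tangentProj r z u = u - gradRatio r z u • coordVec 0 := by
  simp [tangentProj]

theorem gradRatio_apply (r : Cn n → ℝ) (z u : Cn n) :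
    gradRatio r z u = (dC r z (coordVec 0))⁻¹ * dC r z u := by
  simp [gradRatio]

theorem contDiffAt_gradRatio {r : Cn n → ℝ} {z : Cn n} (hr : ContDiffAt ℝ ∞ r z)
    (h0 : dC r z (coordVec 0) ≠ 0) : ContDiffAt ℝ ∞ (gradRatio r) z := by
  have h := contDiffAt_dC hr
  have h1 : ContDiffAt ℝ ∞ (fun z => dC r z (coordVec 0)) z :=
    (((ContinuousLinearMap.apply ℂ ℂ (coordVec 0 : Cn n)).contDiff
      (n := ∞)).restrict_scalars ℝ).contDiffAt.comp z h
  exact (h1.inv h0).smul h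

theorem contDiffAt_tangentProj {r : Cn n → ℝ} {z : Cn n} (hr : ContDiffAt ℝ ∞ r z)
    (h0 : dC r z (coordVec 0) ≠ 0) : ContDiffAt ℝ ∞ (tangentProj r) z := by
  have h := contDiffAt_gradRatio hr h0
  have h1 : ContDiffAt ℝ ∞ (fun z => (gradRatio r z).smulRight (coordVec 0 : Cn n)) z :=
    ((((ContinuousLinearMap.smulRightL ℂ (Cn n) (Cn n)).flip (coordVec 0)).contDiff
      (n := ∞)).restrict_scalars ℝ).contDiffAt.comp z h
  exact contDiffAt_const.sub h1

theorem dC_tangentProj {r : Cn n → ℝ} {z : Cn n} (h0 : dC r z (coordVec 0) ≠ 0) (u : Cn n) :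
    dC r z (tangentProj r z u) = 0 := by
  rw [tangentProj_apply, gradRatio_apply, map_sub, map_smul, smul_eq_mul]
  field_simp
  ring

theorem tangentProj_eq_self {r : Cn n → ℝ} {z u : Cn n} (hu : dC r z u = 0) :
    tangentProj r z u = u := by
  simp [tangentProj_apply, gradRatio_apply, hu]

theorem tangentProj_coordVec_zero {r : Cn n → ℝ} {z : Cn n} (h0 : dC r z (coordVec 0) ≠ 0) :
    tangentProj r z (coordVec 0) = 0 := by
  simp [tangentProj_apply, gradRatio_apply, h0]

theorem tangentProj_apply_ne_zero (r : Cn n → ℝ) (z u : Cn n) {i : Fin n} (hi : i ≠ 0) :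
    tangentProj r z u i = u i := by
  simp [tangentProj_apply, coordVec_apply, hi]

/-- `u ↦ L_r(z; P u, P e_i)`, where `P` is the tangential projection. -/
def leviFunctional (r : Cn n → ℝ) (z : Cn n) (i : Fin n) : Cn n →L[ℂ] ℂ :=
  ∑ j, leviC r z (tangentProj r z (coordVec j)) (tangentProj r z (coordVec i)) •
    EuclideanSpace.proj (𝕜 := ℂ) j

theorem leviFunctional_apply {r : Cn n → ℝ} {z : Cn n} (hr : ContDiffAt ℝ 2 r z) (i : Fin n)
    (u : Cn n) : leviFunctional r z i u =
      leviC r z (tangentProj r z u) (tangentProj r z (coordVec i)) := by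
  conv_rhs => rw [← sum_smul_coordVec u, map_sum, leviC_sum_left]
  simp [leviFunctional, leviC_smul_left hr, mul_comm]

/-- The linear map replacing the coordinates `u_i` of `u` with index in `ζ'` by
`L_r(z; P u, P e_i)`. -/
def leviMap (l : ℕ) (r : Cn n → ℝ) (z : Cn n) : Cn n →L[ℂ] Cn n :=
  ∑ i, (if i ∈ primeIndices n l then leviFunctional r z i
    else EuclideanSpace.proj (𝕜 := ℂ) i).smulRight (coordVec i)

theorem leviMap_apply (l : ℕ) (r : Cn n → ℝ) (z u : Cn n) (i : Fin n) :
    leviMap l r z u i = if i ∈ primeIndices n l then leviFunctional r z i u else u i := by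
  simp only [leviMap, sum_apply, ContinuousLinearMap.smulRight_apply,
    WithLp.ofLp_sum, Finset.sum_apply, PiLp.smul_apply, coordVec_apply, smul_eq_mul, mul_ite,
    mul_one, mul_zero, Finset.sum_ite_eq, Finset.mem_univ, if_true]
  split_ifs <;> rfl

theorem contDiffAt_leviMap (l : ℕ) {r : Cn n → ℝ} {z : Cn n} (hr : ContDiffAt ℝ ∞ r z)
    (h0 : dC r z (coordVec 0) ≠ 0) : ContDiffAt ℝ ∞ (leviMap l r) z := by
  have hP := contDiffAt_tangentProj hr h0
  have hL : ∀ i, ContDiffAt ℝ ∞ (fun z => leviFunctional r z i) z := fun i =>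
    ContDiffAt.sum fun j _ => (contDiffAt_leviC hr (hP.clm_apply_const _)
      (hP.clm_apply_const _)).smul contDiffAt_const
  refine ContDiffAt.sum fun i _ => ?_
  have h1 : ContDiffAt ℝ ∞ (fun z => if i ∈ primeIndices n l then leviFunctional r z i
    else EuclideanSpace.proj (𝕜 := ℂ) i) z := by
    split_ifs
    · exact hL i
    · exact contDiffAt_const
  exact ((((ContinuousLinearMap.smulRightL ℂ (Cn n) (Cn n)).flip (coordVec i)).contDiff
      (n := ∞)).restrict_scalars ℝ).contDiffAt.comp z h1

/-- The frame of the Levi null spaces which projects to the coordinate vectors of `ζ''`. -/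
def nullFrame (l : ℕ) (r : Cn n → ℝ) (z : Cn n) : Cn n →L[ℂ] Cn n :=
  (tangentProj r z).comp ((Ring.inverse (leviMap l r z)).comp
    (coordProj (doublePrimeIndices n l)))

theorem contDiffAt_nullFrame (l : ℕ) {r : Cn n → ℝ} {z : Cn n} (hr : ContDiffAt ℝ ∞ r z)
    (h0 : dC r z (coordVec 0) ≠ 0) (hB : IsUnit (leviMap l r z)) :
    ContDiffAt ℝ ∞ (nullFrame l r) z := by
  obtain ⟨u, hu⟩ := hB
  have h1 := (contDiffAt_ringInverse ℂ u (n := ∞)).restrict_scalars ℝ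
  rw [hu] at h1
  have h2 : ContDiffAt ℝ ∞ (fun z => Ring.inverse (leviMap l r z)) z :=
    h1.comp z (contDiffAt_leviMap l hr h0)
  have h3 : ContDiffAt ℝ ∞ (fun z => (Ring.inverse (leviMap l r z)).comp
      (coordProj (doublePrimeIndices n l))) z :=
    ((((ContinuousLinearMap.compL ℂ (Cn n) (Cn n) (Cn n)).flip
      (coordProj (doublePrimeIndices n l))).contDiff
      (n := ∞)).restrict_scalars ℝ).contDiffAt.comp z h2
  have hc : ContDiff ℝ ∞ fun p : (Cn n →L[ℂ] Cn n) × (Cn n →L[ℂ] Cn n) => p.1.comp p.2 :=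
    ((ContinuousLinearMap.compL ℂ (Cn n) (Cn n)
      (Cn n)).isBoundedBilinearMap.contDiff (n := ∞)).restrict_scalars ℝ
  exact hc.contDiffAt.comp z ((contDiffAt_tangentProj hr h0).prodMk h3)

end Frame
end

noncomputable section

/-! ### The index sets of `ζ'` and `ζ''` -/

section Indices

variable {n l : ℕ}

theorem notMem_primeIndices_of_mem {i : Fin n} (h : i ∈ doublePrimeIndices n l) :
    i ∉ primeIndices n l := by
  simp only [primeIndices, doublePrimeIndices, Finset.mem_filter, Finset.mem_univ, true_and] at *
  omega

theorem card_doublePrimeIndices (hl : l < n) : (doublePrimeIndices n l).card = l := by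
  have : (doublePrimeIndices n l).map Fin.valEmbedding = Finset.Ico (n - l) n := by
    ext k
    simp only [doublePrimeIndices, Finset.mem_map, Finset.mem_filter, Finset.mem_univ, true_and,
      Fin.valEmbedding_apply, Finset.mem_Ico]
    constructor
    · rintro ⟨j, hj, rfl⟩
      exact ⟨hj, j.2⟩
    · intro hk
      exact ⟨⟨k, hk.2⟩, hk.1, rfl⟩
  rw [← Finset.card_map, this, Nat.card_Ico]
  omega

theorem two_le_infty : (2 : WithTop ℕ∞) ≤ ∞ := WithTop.coe_le_coe.2 le_top

theorem three_le_infty : (3 : WithTop ℕ∞) ≤ ∞ := WithTop.coe_le_coe.2 le_top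

end Indices

/-! ### The frame spans the null spaces and commutes -/

section NormalizedFunction

variable {n : ℕ} [NeZero n] {l : ℕ} {r : Cn n → ℝ} {z : Cn n}

theorem zero_notMem_primeIndices : (0 : Fin n) ∉ primeIndices n l := by
  simp [primeIndices]

theorem zero_notMem_doublePrimeIndices (hl : l < n) : (0 : Fin n) ∉ doublePrimeIndices n l := by
  simp [doublePrimeIndices]; omega

theorem mem_doublePrimeIndices_of_notMem {i : Fin n} (h0 : i ≠ 0) (h : i ∉ primeIndices n l) :
    i ∈ doublePrimeIndices n l := by
  have : i.val ≠ 0 := fun h => h0 (Fin.ext h)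
  simp only [primeIndices, doublePrimeIndices, Finset.mem_filter, Finset.mem_univ, true_and] at *
  omega

/-- There is an `l`-dimensional space of null vectors of the Levi form of `r` at `z`. -/
def HasLeviNullSpace (l : ℕ) (r : Cn n → ℝ) (z : Cn n) : Prop :=
  ∃ N : Submodule ℂ (Cn n), l ≤ Module.finrank ℂ N ∧
    ∀ u ∈ N, dC r z u = 0 ∧ ∀ v, dC r z v = 0 → leviC r z u v = 0

/-- A defining function in adapted linear coordinates. -/
structure IsLeviNormalized (l : ℕ) (r : Cn n → ℝ) : Prop where
  smooth : ∀ᶠ z in 𝓝 0, ContDiffAt ℝ ∞ r z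
  map_zero : r 0 = 0
  fderiv_zero : ∀ u, fderiv ℝ r 0 u = (u 0).re
  leviC_zero : ∀ u, ∀ i ∈ primeIndices n l, leviC r 0 (u - u 0 • coordVec 0) (coordVec i) = u i
  null : ∀ᶠ z in 𝓝 0, r z = 0 → HasLeviNullSpace l r z

/-- The open conditions under which the frame of null spaces is defined. -/
structure IsFramePoint (l : ℕ) (r : Cn n → ℝ) (z : Cn n) : Prop where
  smooth : ContDiffAt ℝ ∞ r z
  dC_ne_zero : dC r z (coordVec 0) ≠ 0
  isUnit : IsUnit (leviMap l r z)
  null : r z = 0 → HasLeviNullSpace l r z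

theorem IsFramePoint.fderiv_ne_zero (h : IsFramePoint l r z) : fderiv ℝ r z ≠ 0 := by
  intro h0
  apply h.dC_ne_zero
  simp [dC_apply, h0]

theorem IsFramePoint.two (h : IsFramePoint l r z) : ContDiffAt ℝ 2 r z :=
  h.smooth.of_le two_le_infty

/-- Uniqueness behind the frame: up to the `e₁` direction, which the tangential projection kills,
such a vector lies in the kernel of the invertible map `leviMap`. -/
theorem IsFramePoint.eq_zero (h : IsFramePoint l r z) {w : Cn n} (hw : dC r z w = 0)
    (hdp : ∀ j ∈ doublePrimeIndices n l, w j = 0)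
    (hp : ∀ i ∈ primeIndices n l, leviC r z w (tangentProj r z (coordVec i)) = 0) : w = 0 := by
  have hP := tangentProj_eq_self hw
  have e : tangentProj r z (w - w 0 • coordVec 0) = w := by
    rw [map_sub, map_smul, tangentProj_coordVec_zero h.dC_ne_zero, hP, smul_zero, sub_zero]
  have hB : leviMap l r z (w - w 0 • coordVec 0) = 0 := by
    ext i
    rw [leviMap_apply]
    split_ifs with hi
    · rw [leviFunctional_apply h.two, e, hp i hi]; rfl
    · by_cases h0 : i = 0
      · subst h0; simp [coordVec_apply]
      · simp [coordVec_apply, h0, hdp i (mem_doublePrimeIndices_of_notMem h0 hi)]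
  have h1 : w - w 0 • coordVec 0 = 0 := by
    have := Ring.inverse_mul_cancel _ h.isUnit
    calc _ = (Ring.inverse (leviMap l r z) * leviMap l r z) (w - w 0 • coordVec 0) := by
          rw [this]; rfl
      _ = Ring.inverse (leviMap l r z) (leviMap l r z (w - w 0 • coordVec 0)) := rfl
      _ = 0 := by rw [hB, map_zero]
  rw [← e, h1, map_zero]

/-- The equations against the `P e_i` alone define a space `K` containing the null space `N`. By
`IsFramePoint.eq_zero` the `ζ''` coordinates are injective on `K`, so `dim K ≤ l ≤ dim N` and `K =
N`. This is where the rank hypothesis acts at points other than the base point. -/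
theorem IsFramePoint.leviC_eq_zero (hl : l < n) (h : IsFramePoint l r z) (hz : r z = 0) {u : Cn n}
    (hu : dC r z u = 0)
    (hp : ∀ i ∈ primeIndices n l, leviC r z u (tangentProj r z (coordVec i)) = 0) {v : Cn n}
    (hv : dC r z v = 0) : leviC r z u v = 0 := by
  obtain ⟨N, hN, hN'⟩ := h.null hz
  let K : Submodule ℂ (Cn n) :=
    { carrier := {u | dC r z u = 0 ∧
        ∀ i ∈ primeIndices n l, leviC r z u (tangentProj r z (coordVec i)) = 0}
      zero_mem' := ⟨map_zero _, fun i _ => leviC_zero_left _ _ _⟩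
      add_mem' := fun {a b} ha hb => ⟨by rw [map_add, ha.1, hb.1, add_zero], fun i hi => by
        rw [leviC_add_left, ha.2 i hi, hb.2 i hi, add_zero]⟩
      smul_mem' := fun c a ha => ⟨by rw [map_smul, ha.1, smul_zero], fun i hi => by
        rw [leviC_smul_left h.two, ha.2 i hi, mul_zero]⟩ }
  have hNK : N ≤ K := fun u hu => ⟨(hN' u hu).1, fun i _ =>
    (hN' u hu).2 _ (dC_tangentProj h.dC_ne_zero _)⟩
  let f : K →ₗ[ℂ] (doublePrimeIndices n l → ℂ) :=
    { toFun := fun u j => (u : Cn n) j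
      map_add' := fun a b => rfl
      map_smul' := fun c a => rfl }
  have hf : Function.Injective f := by
    rw [← LinearMap.ker_eq_bot, LinearMap.ker_eq_bot']
    rintro ⟨w, hw⟩ hfw
    apply Subtype.ext
    exact h.eq_zero hw.1 (fun j hj => congrFun hfw ⟨j, hj⟩) hw.2
  have hK : Module.finrank ℂ K ≤ l := by
    have := LinearMap.finrank_le_finrank_of_injective hf
    rw [Module.finrank_fintype_fun_eq_card, Fintype.card_coe] at this
    exact this.trans (card_doublePrimeIndices hl).le
  have hNK' : N = K := Submodule.eq_of_le_of_finrank_le hNK (hK.trans hN)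
  have huK : u ∈ K := ⟨hu, hp⟩
  rw [← hNK'] at huK
  exact (hN' u huK).2 v hv

theorem IsFramePoint.dC_nullFrame (h : IsFramePoint l r z) (x : Cn n) :
    dC r z (nullFrame l r z x) = 0 := dC_tangentProj h.dC_ne_zero _

theorem IsFramePoint.leviMap_inverse (h : IsFramePoint l r z) (x : Cn n) :
    leviMap l r z (Ring.inverse (leviMap l r z) x) = x := by
  have := Ring.mul_inverse_cancel _ h.isUnit
  calc _ = (leviMap l r z * Ring.inverse (leviMap l r z)) x := rfl
    _ = x := by rw [this]; rfl

theorem IsFramePoint.nullFrame_apply (hl : l < n) (h : IsFramePoint l r z) (x : Cn n) {j : Fin n}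
    (hj : j ∈ doublePrimeIndices n l) : nullFrame l r z x j = x j := by
  have h0 : j ≠ 0 := fun h0 => zero_notMem_doublePrimeIndices hl (h0 ▸ hj)
  have e := h.leviMap_inverse (coordProj (doublePrimeIndices n l) x)
  have e2 := congrArg (fun u : Cn n => u j) e
  simp only [leviMap_apply, if_neg (notMem_primeIndices_of_mem hj), coordProj_apply,
    if_pos hj] at e2
  rw [← e2]
  exact tangentProj_apply_ne_zero _ _ _ h0

theorem IsFramePoint.leviC_nullFrame_coordVec (h : IsFramePoint l r z) (x : Cn n) {i : Fin n}
    (hi : i ∈ primeIndices n l) :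
    leviC r z (nullFrame l r z x) (tangentProj r z (coordVec i)) = 0 := by
  have e := h.leviMap_inverse (coordProj (doublePrimeIndices n l) x)
  have e2 := congrArg (fun u : Cn n => u i) e
  simp only [leviMap_apply, if_pos hi, coordProj_apply, leviFunctional_apply h.two,
    if_neg (fun h => notMem_primeIndices_of_mem h hi)] at e2
  exact e2

theorem IsFramePoint.leviC_nullFrame (hl : l < n) (h : IsFramePoint l r z) (hz : r z = 0)
    (x : Cn n) {v : Cn n} (hv : dC r z v = 0) : leviC r z (nullFrame l r z x) v = 0 :=
  h.leviC_eq_zero hl hz (h.dC_nullFrame x) (fun _ hi => h.leviC_nullFrame_coordVec x hi) hv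

/-- The contraction of the two-form with a null vector vanishes on the complex tangent space, the
common kernel of `dr` and `dr ∘ J`, and is therefore a combination of the two. The coefficients come
from evaluating at `e₁` and `i e₁`. -/
theorem IsFramePoint.exists_leviTwoForm_eq (hl : l < n) (h : IsFramePoint l r z) (hz : r z = 0)
    (x : Cn n) : ∃ a b : ℝ, ∀ u, leviTwoForm (mulI n) r z (nullFrame l r z x) u =
      a * fderiv ℝ r z u + b * fderiv ℝ r z (mulI n u) := by
  set c := (dC r z (coordVec 0))⁻¹ with hc
  set X := nullFrame l r z x
  set t₁ := leviTwoForm (mulI n) r z X (coordVec 0)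
  set t₂ := leviTwoForm (mulI n) r z X (Complex.I • coordVec 0)
  refine ⟨c.re * t₁ + c.im * t₂, c.im * t₁ - c.re * t₂, fun u => ?_⟩
  have hu : u = tangentProj r z u + gradRatio r z u • coordVec 0 := by
    rw [tangentProj_apply]; abel
  have h1 : leviTwoForm (mulI n) r z X (tangentProj r z u) = 0 :=
    (leviC_eq_zero_iff.1 (h.leviC_nullFrame hl hz x (dC_tangentProj h.dC_ne_zero u))).1
  conv_lhs => rw [hu, leviTwoForm_add_right, h1, complex_smul_eq, leviTwoForm_add_right,
    leviTwoForm_smul_right, leviTwoForm_smul_right]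
  rw [gradRatio_apply, Complex.mul_re, Complex.mul_im, dC_re, dC_im, mulI_apply]
  ring

theorem IsLeviNormalized.dC_zero (h : IsLeviNormalized l r) (u : Cn n) : dC r 0 u = u 0 := by
  apply Complex.ext <;> simp [dC_re, dC_im, h.fderiv_zero]

theorem IsLeviNormalized.gradRatio_zero (h : IsLeviNormalized l r) (u : Cn n) :
    gradRatio r 0 u = u 0 := by
  simp [gradRatio_apply, h.dC_zero, coordVec_apply]

theorem IsLeviNormalized.leviMap_zero (h : IsLeviNormalized l r) : leviMap l r 0 = 1 := by
  ext u i
  rw [leviMap_apply]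
  split_ifs with hi
  · rw [leviFunctional_apply (h.smooth.self_of_nhds.of_le two_le_infty)]
    have h0 : i ≠ 0 := fun h0 => zero_notMem_primeIndices (l := l) (h0 ▸ hi)
    rw [tangentProj_eq_self (u := coordVec i) (by simp [h.dC_zero, coordVec_apply, h0.symm]),
      tangentProj_apply, h.gradRatio_zero, h.leviC_zero u i hi]
    rfl
  · rfl

theorem IsLeviNormalized.eventually_isFramePoint (h : IsLeviNormalized l r) :
    ∀ᶠ z in 𝓝 0, IsFramePoint l r z := by
  have h0 : dC r 0 (coordVec 0) ≠ 0 := by simp [h.dC_zero, coordVec_apply]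
  have h1 : ∀ᶠ z in 𝓝 0, dC r z (coordVec 0) ≠ 0 :=
    ((contDiffAt_dC h.smooth.self_of_nhds).clm_apply_const
      (coordVec 0)).continuousAt.eventually_ne h0
  have h2 : ∀ᶠ z in 𝓝 0, IsUnit (leviMap l r z) := by
    have hc := (contDiffAt_leviMap l h.smooth.self_of_nhds h0).continuousAt
    refine hc.eventually_mem (Units.isOpen.mem_nhds ?_)
    rw [h.leviMap_zero]
    exact isUnit_one
  filter_upwards [h.smooth, h1, h2, h.null] with z a b c d
  exact ⟨a, b, c, d⟩

/-- The bracket is complex tangent and Levi-orthogonal to every `P e_i`; testing with the fields `P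
e_i` and `i P e_i` gives both parts of the complex form. Its `ζ''` coordinates vanish because those
of the frame fields are constant. Hence `IsFramePoint.eq_zero` applies. -/
theorem bracket_nullFrame_eq_zero (hl : l < n) (h : ∀ᶠ w in 𝓝 z, IsFramePoint l r w)
    (hz : r z = 0) (x v : Cn n) :
    fderiv ℝ (fun w => nullFrame l r w v) z (nullFrame l r z x) =
      fderiv ℝ (fun w => nullFrame l r w x) z (nullFrame l r z v) := by
  have hz0 := h.self_of_nhds
  have hX : ∀ x, ContDiffAt ℝ ∞ (fun w => nullFrame l r w x) z := fun x =>
    (contDiffAt_nullFrame l hz0.smooth hz0.dC_ne_zero hz0.isUnit).clm_apply_const x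
  have hX1 : ∀ x, ContDiffAt ℝ 1 (fun w => nullFrame l r w x) z := fun x =>
    (hX x).of_le (by exact_mod_cast le_top)
  have hP : ∀ u, ContDiffAt ℝ 1 (fun w => tangentProj r w u) z := fun u =>
    ((contDiffAt_tangentProj hz0.smooth hz0.dC_ne_zero).clm_apply_const u).of_le
      (by exact_mod_cast le_top)
  have hP' : ∀ u, ContDiffAt ℝ 1 (fun w => Complex.I • tangentProj r w u) z := fun u =>
    (mulI n).contDiff.contDiffAt.comp z (hP u)
  have tan : ∀ {U : Cn n → Cn n}, (∀ᶠ w in 𝓝 z, dC r w (U w) = 0) →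
      ∀ᶠ w in 𝓝 z, fderiv ℝ r w (U w) = 0 ∧ fderiv ℝ r w (mulI n (U w)) = 0 := fun hU =>
    hU.mono fun w hw => dC_eq_zero_iff.1 hw
  have hY : ∀ {Y : Cn n → Cn n}, ContDiffAt ℝ 1 Y z → (∀ᶠ w in 𝓝 z, dC r w (Y w) = 0) → _ :=
    fun {Y} hY hYt => leviTwoForm_bracket_eq_zero (J := mulI n)
      (hz0.smooth.of_le three_le_infty) hz0.fderiv_ne_zero (hX1 x) (hX1 v) hY
      (tan (h.mono fun w hw => hw.dC_nullFrame x)) (tan (h.mono fun w hw => hw.dC_nullFrame v))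
      (tan hYt) (by
        filter_upwards [h, hYt] with w hw hwY hwr
        rw [hz] at hwr
        exact ⟨(leviC_eq_zero_iff.1 (hw.leviC_nullFrame hl hwr x hwY)).1,
          (leviC_eq_zero_iff.1 (hw.leviC_nullFrame hl hwr v hwY)).1,
          (leviC_eq_zero_iff.1 (hw.leviC_nullFrame hl hwr x (hw.dC_nullFrame v))).1⟩)
      (hz0.exists_leviTwoForm_eq hl hz x) (hz0.exists_leviTwoForm_eq hl hz v)
  rw [← sub_eq_zero]
  refine hz0.eq_zero ?_ (fun j hj => ?_) (fun i hi => ?_)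
  -- Tangency of the bracket does not involve `Y`, so the zero field serves.
  · have := hY (hP 0) (h.mono fun w hw => dC_tangentProj hw.dC_ne_zero 0)
    exact dC_eq_zero_iff.2 ⟨this.1, this.2.1⟩
  · have key : ∀ x u : Cn n, (fderiv ℝ (fun w => nullFrame l r w x) z u) j = 0 := fun x u => by
      let pj : Cn n →L[ℝ] ℂ := (EuclideanSpace.proj (𝕜 := ℂ) j).restrictScalars ℝ
      have e : HasFDerivAt (fun w => pj (nullFrame l r w x))
          (pj.comp (fderiv ℝ (fun w => nullFrame l r w x) z)) z :=
        pj.hasFDerivAt.comp z ((hX1 x).differentiableAt one_ne_zero).hasFDerivAt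
      have e2 : (fun w => pj (nullFrame l r w x)) =ᶠ[𝓝 z] fun _ => x j :=
        h.mono fun w hw => hw.nullFrame_apply hl x hj
      have e3 := e.fderiv
      rw [e2.fderiv_eq, fderiv_fun_const] at e3
      exact (congrArg (fun L : Cn n →L[ℝ] ℂ => L u) e3).symm
    rw [PiLp.sub_apply, key, key, sub_zero]
  · refine leviC_eq_zero_iff.2 ⟨?_, ?_⟩
    · exact (hY (hP (coordVec i)) (h.mono fun w hw => dC_tangentProj hw.dC_ne_zero _)).2.2
    · exact (hY (hP' (coordVec i)) (h.mono fun w hw => by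
        rw [map_smul, dC_tangentProj hw.dC_ne_zero, smul_zero])).2.2

end NormalizedFunction
end

noncomputable section

/-! ### From real to complex differentiability -/

section ComplexDifferentiability

variable {n : ℕ}

/-- A real-differentiable map whose derivative commutes with `i` is complex differentiable. -/
theorem HasFDerivAt.differentiableAt_complex {F : Type*} [NormedAddCommGroup F] [NormedSpace ℂ F]
    {f : Cn n → F} {f' : Cn n →L[ℝ] F} {x : Cn n} (h : HasFDerivAt f f' x)
    (hI : ∀ v, f' (Complex.I • v) = Complex.I • f' v) : DifferentiableAt ℂ f x := by
  let g : Cn n →L[ℂ] F :=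
    { toFun := f'
      map_add' := f'.map_add
      map_smul' := fun c v => by
        rw [complex_smul_eq, map_add, map_smul, map_smul, hI, RingHom.id_apply]
        conv_rhs => rw [← Complex.re_add_im c]
        rw [add_smul, mul_smul]
        rfl
      cont := f'.continuous }
  have hg : g.restrictScalars ℝ = f' := by ext v; rfl
  exact (hasFDerivAt_of_restrictScalars ℝ h hg).differentiableAt

theorem fderiv_restrictScalars_apply {z : Cn n} {X : Cn n → Cn n →L[ℂ] Cn n} (hX : ContDiffAt ℝ ∞ X z) :
    ContDiffAt ℝ ∞ (fun w => (X w).restrictScalars ℝ) z ∧ ∀ u v,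
      fderiv ℝ (fun w => (X w).restrictScalars ℝ) z u v = fderiv ℝ (fun w => X w v) z u := by
  have h : ContDiffAt ℝ ∞ (fun w => (X w).restrictScalars ℝ) z :=
    (ContinuousLinearMap.restrictScalarsL ℂ (Cn n) (Cn n) ℝ ℝ).contDiff.contDiffAt.comp z hX
  refine ⟨h, fun u v => ?_⟩
  have e : HasFDerivAt (fun w => X w v)
      ((ContinuousLinearMap.apply ℝ (Cn n) v).comp
        (fderiv ℝ (fun w => (X w).restrictScalars ℝ) z)) z :=
    (ContinuousLinearMap.apply ℝ (Cn n) v).hasFDerivAt.comp z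
      (h.differentiableAt (by simp)).hasFDerivAt
  rw [e.fderiv]
  rfl

end ComplexDifferentiability

/-! ### The holomorphic leaf and the complex tangent spaces along it -/

section AdaptedMap

variable {n : ℕ} [NeZero n] {l : ℕ} {r : Cn n → ℝ} {z : Cn n}

theorem nullFrame_eq_zero {x : Cn n} (hx : ∀ j ∈ doublePrimeIndices n l, x j = 0) :
    nullFrame l r z x = 0 := by
  have : coordProj (doublePrimeIndices n l) x = 0 := by
    ext j
    rw [coordProj_apply]
    split_ifs with h
    · exact hx j h
    · rfl
  simp [nullFrame, this]

/-- `φ` is a holomorphic parametrization of a leaf through `0` of the Levi foliation. -/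
structure IsLeviLeaf (l : ℕ) (r : Cn n → ℝ) (δ : ℝ) (φ : Cn n → Cn n) : Prop where
  pos : 0 < δ
  map_zero : φ 0 = 0
  framePoint : ∀ x ∈ Metric.ball (0 : Cn n) δ, ∀ᶠ w in 𝓝 (φ x), IsFramePoint l r w
  level : ∀ x ∈ Metric.ball (0 : Cn n) δ, r (φ x) = 0
  hasFDerivAt : ∀ x ∈ Metric.ball (0 : Cn n) δ, HasFDerivAt φ (nullFrame l r (φ x)) x
  eq_zero : ∀ x ∈ Metric.ball (0 : Cn n) δ, (∀ j ∈ doublePrimeIndices n l, x j = 0) → φ x = 0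

/-- Only commutation on the level set is available, which suffices because the flows stay there. The
real derivative found by integration is the restriction of a complex linear map, so the leaf is
holomorphic. -/
theorem IsLeviNormalized.exists_isLeviLeaf (hl : l < n) (h : IsLeviNormalized l r) :
    ∃ φ δ, IsLeviLeaf l r δ φ := by
  have hF := h.eventually_isFramePoint.eventually_nhds
  let XR : Cn n → Cn n →L[ℝ] Cn n := fun w => (nullFrame l r w).restrictScalars ℝ
  have hX : ∀ z, IsFramePoint l r z → ContDiffAt ℝ ∞ (nullFrame l r) z := fun z hz =>
    contDiffAt_nullFrame l hz.smooth hz.dC_ne_zero hz.isUnit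
  obtain ⟨φ, δ, hδ, h0, hφ⟩ := exists_integral_of_commuting_frame (X := XR) (p := 0) (r := r) hF
    ((fderiv_restrictScalars_apply (hX _ hF.self_of_nhds.self_of_nhds)).1.of_le two_le_infty)
    (hF.mono fun z hz => ⟨hz.self_of_nhds.smooth.differentiableAt (by simp), fun x =>
      (dC_eq_zero_iff.1 (hz.self_of_nhds.dC_nullFrame x)).1⟩)
    (hF.mono fun z hz hrz x v => by
      rw [h.map_zero] at hrz
      rw [(fderiv_restrictScalars_apply (hX _ hz.self_of_nhds)).2,
        (fderiv_restrictScalars_apply (hX _ hz.self_of_nhds)).2]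
      exact bracket_nullFrame_eq_zero hl hz hrz x v)
  refine ⟨φ, δ, hδ, h0, fun x hx => (hφ x hx).1, fun x hx => ?_, fun x hx => ?_, fun x hx hd => ?_⟩
  · rw [(hφ x hx).2.1, h.map_zero]
  · exact hasFDerivAt_of_restrictScalars ℝ (hφ x hx).2.2.1 rfl
  · exact (hφ x hx).2.2.2 fun z _ => nullFrame_eq_zero hd

/-- Bootstrapping: the derivative of `φ` is a smooth function of `φ`, so each order of smoothness
yields the next. -/
theorem IsLeviLeaf.contDiffOn {φ : Cn n → Cn n} {δ : ℝ} (h : IsLeviLeaf l r δ φ) :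
    ContDiffOn ℝ ∞ φ (Metric.ball 0 δ) := by
  have hd : ∀ x ∈ Metric.ball (0 : Cn n) δ, HasFDerivAt φ
      ((nullFrame l r (φ x)).restrictScalars ℝ) x := fun x hx =>
    (h.hasFDerivAt x hx).restrictScalars ℝ
  rw [contDiffOn_infty]
  intro k
  induction k with
  | zero =>
    exact contDiffOn_zero.2 fun x hx => (hd x hx).continuousAt.continuousWithinAt
  | succ k ih =>
    rw [Nat.cast_add, Nat.cast_one, contDiffOn_succ_iff_fderiv_of_isOpen Metric.isOpen_ball]
    refine ⟨fun x hx => (hd x hx).differentiableAt.differentiableWithinAt, by simp, ?_⟩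
    have : ContDiffOn ℝ k (fun x => (nullFrame l r (φ x)).restrictScalars ℝ)
        (Metric.ball 0 δ) := fun x hx => by
      have hz := (h.framePoint x hx).self_of_nhds
      have h1 := (fderiv_restrictScalars_apply
        (contDiffAt_nullFrame l hz.smooth hz.dC_ne_zero hz.isUnit)).1.of_le
          (m := k) (by exact_mod_cast le_top)
      exact ContDiffAt.comp_contDiffWithinAt x h1 (ih x hx)
    exact this.congr fun x hx => (hd x hx).fderiv

/-- Differentiate `dr(P u) = 0` and `dr(i P u) = 0`. Since `P u` varies only along `e₁`, with rate
the derivative of `gradRatio`, the remaining terms are Hessian values. -/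
theorem fderiv_gradRatio {u : Cn n} (hz : ∀ᶠ w in 𝓝 z, IsFramePoint l r w) (w : Cn n) :
    fderiv ℝ (fun z => gradRatio r z u) z w * dC r z (coordVec 0) =
      ⟨fderiv ℝ (fderiv ℝ r) z w (tangentProj r z u),
        -fderiv ℝ (fderiv ℝ r) z w (Complex.I • tangentProj r z u)⟩ := by
  have hz0 := hz.self_of_nhds
  have hg : DifferentiableAt ℝ (fun z => gradRatio r z u) z :=
    ((contDiffAt_gradRatio hz0.smooth hz0.dC_ne_zero).clm_apply_const u).differentiableAt (by simp)
  have hP : HasFDerivAt (fun z => tangentProj r z u)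
      (-(fderiv ℝ (fun z => gradRatio r z u) z).smulRight (coordVec 0 : Cn n)) z := by
    simp only [tangentProj_apply]
    exact (hg.hasFDerivAt.smul_const (coordVec 0 : Cn n)).const_sub u
  have hIP : HasFDerivAt (fun z => mulI n (tangentProj r z u)) _ z :=
    (mulI n).hasFDerivAt.comp z hP
  have e1 := fderiv_fderiv_apply hz0.two hP.differentiableAt w
  have e2 := fderiv_fderiv_apply hz0.two hIP.differentiableAt w
  have z1 : (fun z => fderiv ℝ r z (tangentProj r z u)) =ᶠ[𝓝 z] fun _ => 0 :=
    hz.mono fun w hw => (dC_eq_zero_iff.1 (dC_tangentProj hw.dC_ne_zero u)).1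
  have z2 : (fun z => fderiv ℝ r z (mulI n (tangentProj r z u))) =ᶠ[𝓝 z] fun _ => 0 :=
    hz.mono fun w hw => (dC_eq_zero_iff.1 (dC_tangentProj hw.dC_ne_zero u)).2
  rw [z1.fderiv_eq, fderiv_fun_const, hP.fderiv] at e1
  rw [z2.fderiv_eq, fderiv_fun_const, hIP.fderiv] at e2
  set G := fderiv ℝ (fun z => gradRatio r z u) z w with hG
  have c : dC r z (-(G • coordVec 0)) = -(G * dC r z (coordVec 0)) := by
    rw [map_neg, map_smul, smul_eq_mul]
  have c1 := congrArg Complex.re c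
  have c2 := congrArg Complex.im c
  rw [dC_re, Complex.neg_re] at c1
  rw [dC_im, Complex.neg_im] at c2
  replace e1 : 0 = fderiv ℝ (fderiv ℝ r) z w (tangentProj r z u) +
    fderiv ℝ r z (-(G • coordVec 0)) := e1
  replace e2 : 0 = fderiv ℝ (fderiv ℝ r) z w (Complex.I • tangentProj r z u) +
    fderiv ℝ r z (Complex.I • -(G • coordVec 0)) := e2
  apply Complex.ext
  · change _ = fderiv ℝ (fderiv ℝ r) z w (tangentProj r z u)
    linarith
  · change _ = -fderiv ℝ (fderiv ℝ r) z w (Complex.I • tangentProj r z u)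
    linarith

/-- Along a leaf, the complex tangent spaces of the level set vary holomorphically. -/
theorem IsLeviLeaf.differentiableAt_gradRatio (hl : l < n) {φ : Cn n → Cn n} {δ : ℝ}
    (h : IsLeviLeaf l r δ φ) {x : Cn n} (hx : x ∈ Metric.ball 0 δ) (u : Cn n) :
    DifferentiableAt ℂ (fun x => gradRatio r (φ x) u) x := by
  have hz := h.framePoint x hx
  have hz0 := hz.self_of_nhds
  have hg : DifferentiableAt ℝ (fun z => gradRatio r z u) (φ x) :=
    ((contDiffAt_gradRatio hz0.smooth hz0.dC_ne_zero).clm_apply_const u).differentiableAt (by simp)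
  have hc : HasFDerivAt (fun x => gradRatio r (φ x) u) _ x :=
    hg.hasFDerivAt.comp x ((h.hasFDerivAt x hx).restrictScalars ℝ)
  refine hc.differentiableAt_complex fun v => ?_
  change fderiv ℝ (fun z => gradRatio r z u) (φ x) (nullFrame l r (φ x) (Complex.I • v)) =
    Complex.I • fderiv ℝ (fun z => gradRatio r z u) (φ x) (nullFrame l r (φ x) v)
  -- After multiplication by `2∂r(e₁)`, the real and imaginary parts of the Cauchy-Riemann equation
  -- are the two real equations saying that the frame vector is Levi-orthogonal to `P u`.
  apply mul_right_cancel₀ hz0.dC_ne_zero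
  rw [smul_eq_mul, mul_assoc, fderiv_gradRatio hz, fderiv_gradRatio hz, map_smul]
  have hs := hz0.two.isSymmSndFDerivAt (by simp)
  have hN := leviC_eq_zero_iff.1 (hz0.leviC_nullFrame hl (h.level x hx) v
    (dC_tangentProj hz0.dC_ne_zero u))
  set X := nullFrame l r (φ x) v
  set Pu := tangentProj r (φ x) u
  simp only [leviTwoForm, mulI_apply, I_smul_I_smul, map_neg] at hN
  rw [hs.eq Pu (Complex.I • X), hs.eq (Complex.I • Pu) (Complex.I • X)] at hN
  apply Complex.ext
  · simp only [Complex.mul_re, Complex.I_re, Complex.I_im]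
    linarith [hN.1]
  · simp only [Complex.mul_im, Complex.I_re, Complex.I_im]
    linarith [hN.2]

end AdaptedMap
end

noncomputable section

/-! ### The pluriharmonic quadratic part -/

section HolQuad

variable {n : ℕ} {r : Cn n → ℝ}

/-- The quadratic form `∑ ∂²r/∂z_j∂z_k(0) v_j v_k`, in terms of the real Hessian. -/
def holQuad (r : Cn n → ℝ) (v : Cn n) : ℂ :=
  ⟨(fderiv ℝ (fderiv ℝ r) 0 v v -
      fderiv ℝ (fderiv ℝ r) 0 (Complex.I • v) (Complex.I • v)) / 4,
    -fderiv ℝ (fderiv ℝ r) 0 v (Complex.I • v) / 2⟩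

theorem contDiff_holQuad (r : Cn n → ℝ) : ContDiff ℝ ∞ (holQuad r) := by
  let b := fderiv ℝ (fderiv ℝ r) 0
  have hI : ContDiff ℝ ∞ fun v : Cn n => mulI n v := (mulI n).contDiff
  have hb : ∀ {U V : Cn n → Cn n}, ContDiff ℝ ∞ U → ContDiff ℝ ∞ V →
      ContDiff ℝ ∞ fun v => b (U v) (V v) := fun hU hV =>
    (b.contDiff.comp hU).clm_apply hV
  have e : holQuad r = fun v => Complex.equivRealProdCLM.symm
      ((b v v - b (mulI n v) (mulI n v)) / 4, -b v (mulI n v) / 2) := rfl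
  rw [e]
  exact Complex.equivRealProdCLM.symm.contDiff.comp
    ((((hb contDiff_id contDiff_id).sub (hb hI hI)).div_const 4).prodMk
      ((hb contDiff_id hI).neg.div_const 2))

theorem holQuad_smul_real (r : Cn n → ℝ) (t : ℝ) (v : Cn n) :
    holQuad r (t • v) = (t ^ 2 : ℝ) • holQuad r v := by
  apply Complex.ext
  · simp only [holQuad, smul_comm Complex.I t, map_smul, smul_apply, smul_eq_mul, Complex.real_smul,
      Complex.mul_re, Complex.ofReal_re, Complex.ofReal_im]
    ring
  · simp only [holQuad, smul_comm Complex.I t, map_smul, smul_apply, smul_eq_mul, Complex.real_smul,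
      Complex.mul_im, Complex.ofReal_re, Complex.ofReal_im]
    ring

/-- Expanding along real lines `v + t w` identifies the differential, and symmetry of the Hessian
makes it commute with `i`. -/
theorem differentiable_holQuad (hr : ContDiffAt ℝ 2 r 0) : Differentiable ℂ (holQuad r) := by
  intro v
  have hs := hr.isSymmSndFDerivAt (by simp)
  let b := fderiv ℝ (fderiv ℝ r) 0
  have hd : HasFDerivAt (holQuad r) (fderiv ℝ (holQuad r) v) v :=
    ((contDiff_holQuad r).differentiable (by simp) v).hasFDerivAt
  have key : ∀ w, fderiv ℝ (holQuad r) v w =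
      ⟨(b v w - b (Complex.I • v) (Complex.I • w)) / 2,
        -(b w (Complex.I • v) + b v (Complex.I • w)) / 2⟩ := by
    intro w
    have hl : HasDerivAt (fun t : ℝ => v + t • w) w 0 := by
      simpa using ((hasDerivAt_id (0 : ℝ)).smul_const w).const_add v
    have h1 : HasDerivAt (fun t : ℝ => holQuad r (v + t • w)) (fderiv ℝ (holQuad r) v w) 0 := by
      have hd' : HasFDerivAt (holQuad r) (fderiv ℝ (holQuad r) v) (v + (0 : ℝ) • w) := by
        simpa using hd
      exact hd'.comp_hasDerivAt 0 hl
    set c : ℂ := ⟨(b v w - b (Complex.I • v) (Complex.I • w)) / 2,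
        -(b w (Complex.I • v) + b v (Complex.I • w)) / 2⟩ with hc
    have h2 : HasDerivAt (fun t : ℝ => holQuad r v + t • c + (t ^ 2) • holQuad r w) c 0 := by
      have a1 : HasDerivAt (fun t : ℝ => t • c) c 0 := by
        simpa using (hasDerivAt_id (0 : ℝ)).smul_const c
      have a2 : HasDerivAt (fun t : ℝ => (t ^ 2) • holQuad r w) 0 0 := by
        simpa using (hasDerivAt_pow 2 (0 : ℝ)).smul_const (holQuad r w)
      exact ((a1.const_add (holQuad r v)).add a2).congr_deriv (add_zero c)
    have e : (fun t : ℝ => holQuad r (v + t • w)) =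
        fun t : ℝ => holQuad r v + t • c + (t ^ 2) • holQuad r w := by
      funext t
      apply Complex.ext
      · simp only [holQuad, smul_add, smul_comm Complex.I t, map_add, add_apply, map_smul,
          smul_apply, smul_eq_mul, Complex.add_re, Complex.real_smul, Complex.mul_re,
          Complex.ofReal_re, Complex.ofReal_im, hc, b]
        rw [hs.eq w v, hs.eq (Complex.I • w) (Complex.I • v)]
        ring
      · simp only [holQuad, smul_add, smul_comm Complex.I t, map_add, add_apply, map_smul,
          smul_apply, smul_eq_mul, Complex.add_im, Complex.real_smul, Complex.mul_im,
          Complex.ofReal_re, Complex.ofReal_im, hc, b]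
        ring
    rw [e] at h1
    exact h1.unique h2
  refine hd.differentiableAt_complex fun w => ?_
  rw [key, key, I_smul_I_smul, map_neg, map_neg]
  apply Complex.ext
  · simp only [smul_eq_mul, Complex.mul_re, Complex.I_re, Complex.I_im]
    rw [hs.eq w (Complex.I • v)]
    ring
  · simp only [smul_eq_mul, Complex.mul_im, Complex.I_re, Complex.I_im]
    rw [hs.eq (Complex.I • w) (Complex.I • v)]
    ring

theorem hasFDerivAt_holQuad_zero (hr : ContDiffAt ℝ 2 r 0) :
    HasFDerivAt (holQuad r) (0 : Cn n →L[ℂ] ℂ) 0 := by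
  have hd := (differentiable_holQuad hr 0).hasFDerivAt
  have : fderiv ℂ (holQuad r) 0 = 0 := by
    ext v
    have h1 : HasDerivAt (fun t : ℝ => holQuad r (t • v)) (fderiv ℂ (holQuad r) 0 v) 0 := by
      have hl : HasDerivAt (fun t : ℝ => t • v) v 0 := by
        simpa using (hasDerivAt_id (0 : ℝ)).smul_const v
      have hd' : HasFDerivAt (holQuad r) ((fderiv ℂ (holQuad r) 0).restrictScalars ℝ)
          ((0 : ℝ) • v) := by
        rw [zero_smul]; exact hd.restrictScalars ℝ
      exact hd'.comp_hasDerivAt 0 hl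
    have h2 : HasDerivAt (fun t : ℝ => holQuad r (t • v)) 0 0 := by
      simp only [holQuad_smul_real]
      simpa using (hasDerivAt_pow 2 (0 : ℝ)).smul_const (holQuad r v)
    exact h1.unique h2
  rwa [this] at hd

end HolQuad

/-! ### The adapted holomorphic coordinates -/

section AdaptedParam

variable {n : ℕ} [NeZero n] {l : ℕ} {r : Cn n → ℝ}

/-- The inverse of a holomorphic coordinate system which flattens the leaf `φ`, straightens the
complex tangent spaces along it and removes the pluriharmonic quadratic terms. -/
def adaptedMap (l : ℕ) (r : Cn n → ℝ) (φ : Cn n → Cn n) (ζ : Cn n) : Cn n :=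
  φ ζ + coordProj (primeIndices n l) ζ +
    (ζ 0 - (∑ j ∈ primeIndices n l, ζ j * gradRatio r (φ ζ) (coordVec j)) -
      holQuad r (coordProj (primeIndices n l) ζ)) • coordVec 0

theorem contDiffOn_adaptedMap {φ : Cn n → Cn n} {δ : ℝ} (h : IsLeviLeaf l r δ φ) :
    ContDiffOn ℝ ∞ (adaptedMap l r φ) (Metric.ball 0 δ) := by
  have hp : ∀ j : Fin n, ContDiff ℝ ∞ fun ζ : Cn n => ζ j := fun j =>
    ((EuclideanSpace.proj (𝕜 := ℂ) j).restrictScalars ℝ).contDiff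
  have hπ : ContDiff ℝ ∞ fun ζ : Cn n => coordProj (primeIndices n l) ζ :=
    ((coordProj (primeIndices n l)).restrictScalars ℝ).contDiff
  have hg : ∀ j : Fin n, ContDiffOn ℝ ∞ (fun ζ => gradRatio r (φ ζ) (coordVec j))
      (Metric.ball 0 δ) := fun j x hx => by
    have hz := (h.framePoint x hx).self_of_nhds
    exact ContDiffAt.comp_contDiffWithinAt x
      ((contDiffAt_gradRatio hz.smooth hz.dC_ne_zero).clm_apply_const (coordVec j))
      (h.contDiffOn x hx)
  refine (h.contDiffOn.add hπ.contDiffOn).add (ContDiffOn.smul (((hp 0).contDiffOn.sub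
    (ContDiffOn.sum fun j _ => (hp j).contDiffOn.mul (hg j))).sub
    ((contDiff_holQuad r).comp hπ).contDiffOn) contDiffOn_const)

theorem differentiableAt_adaptedMap (hl : l < n) (hr : ContDiffAt ℝ 2 r 0) {φ : Cn n → Cn n} {δ : ℝ}
    (h : IsLeviLeaf l r δ φ) {x : Cn n} (hx : x ∈ Metric.ball 0 δ) :
    DifferentiableAt ℂ (adaptedMap l r φ) x := by
  have hp : ∀ j : Fin n, DifferentiableAt ℂ (fun ζ : Cn n => ζ j) x := fun j =>
    (EuclideanSpace.proj (𝕜 := ℂ) j).differentiableAt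
  have hπ : DifferentiableAt ℂ (fun ζ : Cn n => coordProj (primeIndices n l) ζ) x :=
    (coordProj (primeIndices n l)).differentiableAt
  exact ((h.hasFDerivAt x hx).differentiableAt.add hπ).add (DifferentiableAt.smul
    (((hp 0).sub (DifferentiableAt.fun_sum fun j _ =>
      (hp j).mul (h.differentiableAt_gradRatio hl hx (coordVec j)))).sub
      ((differentiable_holQuad hr _).comp x hπ)) (differentiableAt_const _))

/-- At points with `ζ' = 0` the derivatives of the coefficients `gradRatio` are multiplied by `ζ_j =
0`, and the quadratic term has zero differential. On `ζ'` directions what remains is the tangential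
projection at `φ x`. -/
theorem hasFDerivAt_adaptedMap (hl : l < n) (hr : ContDiffAt ℝ 2 r 0) {φ : Cn n → Cn n} {δ : ℝ}
    (h : IsLeviLeaf l r δ φ) {x : Cn n} (hx : x ∈ Metric.ball 0 δ)
    (hx0 : ∀ j ∈ primeIndices n l, x j = 0) :
    HasFDerivAt (adaptedMap l r φ) (nullFrame l r (φ x) + coordProj (primeIndices n l) +
      (EuclideanSpace.proj (𝕜 := ℂ) 0 - ∑ j ∈ primeIndices n l,
        gradRatio r (φ x) (coordVec j) • EuclideanSpace.proj (𝕜 := ℂ) j).smulRight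
          (coordVec 0 : Cn n)) x := by
  have hp : ∀ j : Fin n, HasFDerivAt (fun ζ : Cn n => ζ j) (EuclideanSpace.proj (𝕜 := ℂ) j) x :=
    fun j => (EuclideanSpace.proj (𝕜 := ℂ) j).hasFDerivAt
  have hπ : HasFDerivAt (fun ζ : Cn n => coordProj (primeIndices n l) ζ)
      (coordProj (primeIndices n l)) x := (coordProj (primeIndices n l)).hasFDerivAt
  have hs : HasFDerivAt (fun ζ => ∑ j ∈ primeIndices n l, ζ j * gradRatio r (φ ζ) (coordVec j))
      (∑ j ∈ primeIndices n l, gradRatio r (φ x) (coordVec j) • EuclideanSpace.proj (𝕜 := ℂ) j)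
      x := by
    refine HasFDerivAt.fun_sum fun j hj => ?_
    have := (hp j).mul (h.differentiableAt_gradRatio hl hx (coordVec j)).hasFDerivAt
    refine this.congr_fderiv ?_
    ext v
    simp [hx0 j hj]
  have hπ0 : coordProj (primeIndices n l) x = 0 := by
    ext j
    rw [coordProj_apply]
    split_ifs with hj
    · exact hx0 j hj
    · rfl
  have hq : HasFDerivAt (fun ζ => holQuad r (coordProj (primeIndices n l) ζ))
      (0 : Cn n →L[ℂ] ℂ) x := by
    have h0 := hasFDerivAt_holQuad_zero hr
    rw [← hπ0] at h0
    have := h0.comp x hπ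
    rwa [ContinuousLinearMap.zero_comp] at this
  have := ((h.hasFDerivAt x hx).add hπ).add
    ((((hp 0).sub hs).sub hq).smul_const (coordVec 0 : Cn n))
  rw [sub_zero] at this
  exact this

end AdaptedParam
end

noncomputable section

section CoordProj

variable {n : ℕ}

theorem coordProj_eq_zero {s : Finset (Fin n)} {x : Cn n} (h : ∀ j ∈ s, x j = 0) :
    coordProj s x = 0 := by
  ext j
  rw [coordProj_apply]
  split_ifs with hj
  · exact h j hj
  · rfl

theorem coordProj_eq_self {s : Finset (Fin n)} {x : Cn n} (h : ∀ j ∉ s, x j = 0) :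
    coordProj s x = x := by
  ext j
  rw [coordProj_apply]
  split_ifs with hj
  · rfl
  · exact (h j hj).symm

theorem sum_smul_coordVec_of_eq_zero {s : Finset (Fin n)} {x : Cn n} (h : ∀ j ∉ s, x j = 0) :
    ∑ j ∈ s, x j • (coordVec j : Cn n) = x := by
  conv_rhs => rw [← sum_smul_coordVec x]
  exact Finset.sum_subset (Finset.subset_univ s) fun j _ hj => by rw [h j hj, zero_smul]

end CoordProj

/-! ### The jet of the defining function along the flattened leaf -/

section NormalJet

variable {n : ℕ} [NeZero n] {l : ℕ} {r : Cn n → ℝ}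

/-- A smooth function whose 2-jets along `{ζ₁ = 0, ζ' = 0}` are in normal form. -/
structure HasNormalJet (l : ℕ) (lam : ℝ) (R : Cn n → ℝ) : Prop where
  smooth : ∀ᶠ ζ in 𝓝 0, ContDiffAt ℝ ∞ R ζ
  leaf : ∀ᶠ x in 𝓝 0, (∀ j ∉ doublePrimeIndices n l, x j = 0) →
    R x = 0 ∧ ∀ v : Cn n, (∀ j ∉ primeIndices n l, v j = 0) → fderiv ℝ R x v = 0
  fderiv_zero : ∀ u, fderiv ℝ R 0 u = (u 0).re
  hess_zero : ∀ v : Cn n, (∀ j ∉ primeIndices n l, v j = 0) →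
    fderiv ℝ (fderiv ℝ R) 0 v v = 2 * lam * ∑ j ∈ primeIndices n l, ‖v j‖ ^ 2

theorem IsLeviNormalized.nullFrame_zero (hl : l < n) (h : IsLeviNormalized l r) (v : Cn n) :
    nullFrame l r 0 v = coordProj (doublePrimeIndices n l) v := by
  have e : (Ring.inverse (leviMap l r 0)) = 1 := by rw [h.leviMap_zero, Ring.inverse_one]
  simp only [nullFrame, e, ContinuousLinearMap.comp_apply, one_apply_eq_self]
  apply tangentProj_eq_self
  rw [h.dC_zero, coordProj_apply, if_neg (zero_notMem_doublePrimeIndices hl)]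

/-- Subtracting twice the real part of the holomorphic quadratic form leaves the average of the
Hessian over `v` and `i v`, which is half of `leviC`. As `leviC` is normalized to `∑ |v_j|²`, the
coefficient is `1/2 = 2 · (1/4)`. -/
theorem IsLeviNormalized.hess_eq (h : IsLeviNormalized l r) {v : Cn n}
    (hv : ∀ j ∉ primeIndices n l, v j = 0) :
    fderiv ℝ (fderiv ℝ r) 0 v v - 2 * (holQuad r v).re =
      2 * (1 / 4) * ∑ j ∈ primeIndices n l, ‖v j‖ ^ 2 := by
  have hr : ContDiffAt ℝ 2 r 0 := h.smooth.self_of_nhds.of_le two_le_infty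
  have hs := hr.isSymmSndFDerivAt (by simp)
  have hv0 : v 0 = 0 := hv 0 zero_notMem_primeIndices
  have key : leviC r 0 v v = ∑ j ∈ primeIndices n l, ((‖v j‖ ^ 2 : ℝ) : ℂ) := by
    have e : ∀ s : Finset (Fin n), s ⊆ primeIndices n l →
        leviC r 0 v (∑ j ∈ s, v j • coordVec j) = ∑ j ∈ s, ((‖v j‖ ^ 2 : ℝ) : ℂ) := by
      intro s
      induction s using Finset.induction_on with
      | empty => intro _; simp [leviC_eq_zero_iff, leviTwoForm]
      | insert a s ha ih =>
        intro hsub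
        rw [Finset.sum_insert ha, Finset.sum_insert ha, leviC_add_right, leviC_smul_right,
          ih ((Finset.subset_insert a s).trans hsub)]
        have := h.leviC_zero v a (hsub (Finset.mem_insert_self a s))
        rw [hv0, zero_smul, sub_zero] at this
        rw [this, Complex.conj_mul']
        push_cast
        rfl
    have := e _ subset_rfl
    rwa [sum_smul_coordVec_of_eq_zero hv] at this
  have key2 := congrArg Complex.re key
  rw [← Complex.ofReal_sum, Complex.ofReal_re] at key2
  rw [← key2]
  simp only [leviC, leviTwoForm, mulI_apply, I_smul_I_smul, map_neg, holQuad]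
  ring

/-- Each term of `adaptedMap` has its purpose: `φ` puts the leaf into the zero set, the linear
correction by `gradRatio` makes the `ζ'` directions complex tangent along the leaf, and `holQuad`
removes the non-Hermitian part of the Hessian at `0`. -/
theorem IsLeviNormalized.exists_adaptedMap (hl : l < n) (h : IsLeviNormalized l r) :
    ∃ (Ψ : Cn n → Cn n) (δ : ℝ), 0 < δ ∧ Ψ 0 = 0 ∧ ContDiffOn ℝ ∞ Ψ (Metric.ball 0 δ) ∧
      DifferentiableOn ℂ Ψ (Metric.ball 0 δ) ∧
      HasFDerivAt Ψ (ContinuousLinearMap.id ℂ (Cn n)) 0 ∧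
      HasNormalJet l (1 / 4) (fun ζ => r (Ψ ζ)) := by
  obtain ⟨φ, δ, hφ⟩ := h.exists_isLeviLeaf hl
  have hr : ContDiffAt ℝ 2 r 0 := h.smooth.self_of_nhds.of_le two_le_infty
  set Ψ := adaptedMap l r φ with hΨ
  have hball := Metric.ball_mem_nhds (0 : Cn n) hφ.pos
  have h0b : (0 : Cn n) ∈ Metric.ball (0 : Cn n) δ := Metric.mem_ball_self hφ.pos
  have hΨs := contDiffOn_adaptedMap hφ
  have hleaf : ∀ x : Cn n, (∀ j ∉ doublePrimeIndices n l, x j = 0) → Ψ x = φ x := by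
    intro x hx
    have h1 : ∀ j ∈ primeIndices n l, x j = 0 := fun j hj =>
      hx j fun h' => notMem_primeIndices_of_mem h' hj
    have h2 : holQuad r (0 : Cn n) = 0 := by simpa using holQuad_smul_real r 0 0
    rw [hΨ, adaptedMap, coordProj_eq_zero h1, h2, hx 0 (zero_notMem_doublePrimeIndices hl),
      Finset.sum_eq_zero fun j hj => by rw [h1 j hj, zero_mul]]
    simp
  have hΨ0 : Ψ 0 = 0 := by rw [hleaf 0 fun _ _ => rfl, hφ.map_zero]
  have hdΨ : ∀ x ∈ Metric.ball (0 : Cn n) δ, (∀ j ∉ doublePrimeIndices n l, x j = 0) →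
      HasFDerivAt Ψ _ x := fun x hx hx0 => hasFDerivAt_adaptedMap hl hr hφ hx fun j hj =>
        hx0 j fun h' => notMem_primeIndices_of_mem h' hj
  have hid : HasFDerivAt Ψ (ContinuousLinearMap.id ℂ (Cn n)) 0 := by
    refine (hdΨ 0 h0b fun _ _ => rfl).congr_fderiv ?_
    ext v i
    simp only [add_apply, hφ.map_zero, h.nullFrame_zero hl, h.gradRatio_zero,
      ContinuousLinearMap.smulRight_apply, sub_apply, sum_apply, smul_apply, PiLp.add_apply,
      PiLp.smul_apply, coordProj_apply, ContinuousLinearMap.id_apply, coordVec_apply]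
    have hs : ∑ j ∈ primeIndices n l, (if (0 : Fin n) = j then (1 : ℂ) else 0) •
        (EuclideanSpace.proj (𝕜 := ℂ) j) v = 0 := Finset.sum_eq_zero fun j hj => by
      rw [if_neg fun h0 => zero_notMem_primeIndices (h0 ▸ hj), zero_smul]
    rw [hs, sub_zero]
    by_cases h0 : i = 0
    · subst h0
      simp [zero_notMem_primeIndices, zero_notMem_doublePrimeIndices hl]
    · by_cases hi : i ∈ primeIndices n l
      · have hi' : i ∉ doublePrimeIndices n l := fun h' => notMem_primeIndices_of_mem h' hi
        simp [hi, h0, hi']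
      · simp [hi, h0, mem_doublePrimeIndices_of_notMem h0 hi]
  have hΨc : ContinuousAt Ψ 0 := hid.continuousAt
  have hsm : ∀ᶠ ζ in 𝓝 0, ContDiffAt ℝ ∞ r (Ψ ζ) := by
    have := h.smooth
    rw [← hΨ0] at this
    exact hΨc.eventually this
  refine ⟨Ψ, δ, hφ.pos, hΨ0, hΨs, fun x hx =>
    (differentiableAt_adaptedMap hl hr hφ hx).differentiableWithinAt, hid, ?_, ?_, ?_, ?_⟩
  · filter_upwards [hsm, hball] with ζ hζ hb
    exact hζ.comp ζ (hΨs.contDiffAt (Metric.isOpen_ball.mem_nhds hb))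
  · filter_upwards [hsm, hball] with x hx hb hx0
    refine ⟨by rw [hleaf x hx0, hφ.level x hb], fun v hv => ?_⟩
    have hc : HasFDerivAt (fun ζ => r (Ψ ζ)) _ x :=
      (hx.differentiableAt (by simp)).hasFDerivAt.comp x
        ((hdΨ x hb hx0).restrictScalars ℝ)
    rw [hc.fderiv]
    have e : (nullFrame l r (φ x) + coordProj (primeIndices n l) +
      (EuclideanSpace.proj (𝕜 := ℂ) 0 - ∑ j ∈ primeIndices n l,
        gradRatio r (φ x) (coordVec j) • EuclideanSpace.proj (𝕜 := ℂ) j).smulRight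
          (coordVec 0 : Cn n)) v = tangentProj r (φ x) v := by
      have h1 := nullFrame_eq_zero (l := l) (r := r) (z := φ x) (x := v) fun j hj =>
        hv j (notMem_primeIndices_of_mem hj)
      have hg : gradRatio r (φ x) v =
          ∑ j ∈ primeIndices n l, v j * gradRatio r (φ x) (coordVec j) := by
        conv_lhs => rw [← sum_smul_coordVec_of_eq_zero hv]
        rw [map_sum]
        simp only [map_smul, smul_eq_mul]
      have hL : (EuclideanSpace.proj (𝕜 := ℂ) 0 - ∑ j ∈ primeIndices n l,
          gradRatio r (φ x) (coordVec j) • EuclideanSpace.proj (𝕜 := ℂ) j : Cn n →L[ℂ] ℂ) v =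
          -gradRatio r (φ x) v := by
        rw [hg, sub_apply, sum_apply]
        have : (EuclideanSpace.proj (𝕜 := ℂ) 0 : Cn n →L[ℂ] ℂ) v = 0 := hv 0 zero_notMem_primeIndices
        rw [this, zero_sub]
        congr 1
        exact Finset.sum_congr rfl fun j _ => mul_comm _ _
      rw [tangentProj_apply, add_apply, add_apply, ContinuousLinearMap.smulRight_apply, h1, hL,
        coordProj_eq_self hv, zero_add, neg_smul, sub_eq_add_neg]
    refine (congrArg (fderiv ℝ r (Ψ x)) e).trans ?_
    rw [hleaf x hx0]
    exact (dC_eq_zero_iff.1 (dC_tangentProj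
      (hφ.framePoint x hb).self_of_nhds.dC_ne_zero v)).1
  · intro u
    have hc : HasFDerivAt (fun ζ => r (Ψ ζ)) _ 0 :=
      (hsm.self_of_nhds.differentiableAt (by simp)).hasFDerivAt.comp (0 : Cn n)
        (hid.restrictScalars ℝ)
    rw [hc.fderiv, hΨ0]
    exact h.fderiv_zero u
  · intro v hv
    rw [← h.hess_eq hv]
    set R : Cn n → ℝ := fun ζ => r (Ψ ζ) with hR
    have hRs : ∀ᶠ ζ in 𝓝 0, ContDiffAt ℝ ∞ R ζ := by
      filter_upwards [hsm, hball] with ζ hζ hb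
      exact hζ.comp ζ (hΨs.contDiffAt (Metric.isOpen_ball.mem_nhds hb))
    have hline : ∀ t : ℝ, HasDerivAt (fun t : ℝ => t • v) v t := fun t => by
      simpa using (hasDerivAt_id t).smul_const v
    have hline0 : Filter.Tendsto (fun t : ℝ => t • v) (𝓝 0) (𝓝 0) := by
      have := (hline 0).continuousAt.tendsto
      rwa [zero_smul] at this
    set q := holQuad r v with hq
    -- On the `ζ'` space `φ` is zero and the linear correction vanishes, so the image of the line `t
    -- v` is the parabola `c`. Its acceleration `-2 q e₁` contributes `-2 Re q` to the second
    -- derivative.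
    set c : ℝ → Cn n := fun t => t • v - (t ^ 2) • q • coordVec 0 with hc
    set c' : ℝ → Cn n := fun t => v - (2 * t) • q • coordVec 0 with hc'
    have hcd : ∀ t, HasDerivAt c (c' t) t := fun t => by
      have h2 : HasDerivAt (fun t : ℝ => t ^ 2) (2 * t) t := by simpa using hasDerivAt_pow 2 t
      exact (hline t).sub (h2.smul_const (q • coordVec 0))
    have hc0 : c 0 = 0 := by simp [hc]
    have hcc : Filter.Tendsto c (𝓝 0) (𝓝 0) := by
      have := (hcd 0).continuousAt.tendsto
      rwa [hc0] at this
    have hRc : ∀ᶠ t in 𝓝 (0 : ℝ), R (t • v) = r (c t) := by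
      filter_upwards [hline0.eventually hball] with t ht
      have hd : ∀ j ∈ doublePrimeIndices n l, (t • v) j = 0 := fun j hj => by
        rw [PiLp.smul_apply, hv j (notMem_primeIndices_of_mem hj), smul_zero]
      have hp : ∀ j ∉ primeIndices n l, (t • v) j = 0 := fun j hj => by
        rw [PiLp.smul_apply, hv j hj, smul_zero]
      rw [hR, hc]
      simp only [hΨ, adaptedMap]
      rw [hφ.eq_zero _ ht hd, coordProj_eq_self hp, hp 0 zero_notMem_primeIndices,
        holQuad_smul_real, Finset.sum_eq_zero fun j hj => by
          rw [h.gradRatio_zero, coordVec_apply,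
            if_neg fun h0 => zero_notMem_primeIndices (h0 ▸ hj), mul_zero]]
      simp only [sub_zero, zero_sub, zero_add, neg_smul, smul_assoc, ← sub_eq_add_neg, hq]
    clear_value R
    have e1 : ∀ᶠ t in 𝓝 (0 : ℝ), fderiv ℝ R (t • v) v = fderiv ℝ r (c t) (c' t) := by
      filter_upwards [hRc.eventually_nhds, hline0.eventually hRs, hcc.eventually h.smooth]
        with t ht h1 h2
      have a1 : HasDerivAt (fun t : ℝ => R (t • v)) (fderiv ℝ R (t • v) v) t :=
        (h1.differentiableAt (by simp)).hasFDerivAt.comp_hasDerivAt t (hline t)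
      have a2 : HasDerivAt (fun t : ℝ => r (c t)) (fderiv ℝ r (c t) (c' t)) t :=
        (h2.differentiableAt (by simp)).hasFDerivAt.comp_hasDerivAt t (hcd t)
      exact a1.unique (a2.congr_of_eventuallyEq ht)
    have d1 : HasDerivAt (fun t : ℝ => fderiv ℝ R (t • v) v)
        (fderiv ℝ (fderiv ℝ R) 0 v v) 0 := by
      have hd : HasFDerivAt (fderiv ℝ R) (fderiv ℝ (fderiv ℝ R) 0) ((0 : ℝ) • v) := by
        rw [zero_smul]
        exact ((hRs.self_of_nhds.fderiv_right (m := 1)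
          two_le_infty).differentiableAt one_ne_zero).hasFDerivAt
      exact (ContinuousLinearMap.apply ℝ ℝ v).hasFDerivAt.comp_hasDerivAt 0
        (hd.comp_hasDerivAt 0 (hline 0))
    have d2 : HasDerivAt (fun t : ℝ => fderiv ℝ r (c t) (c' t))
        (fderiv ℝ (fderiv ℝ r) 0 v v - 2 * q.re) 0 := by
      have hd : HasFDerivAt (fderiv ℝ r) (fderiv ℝ (fderiv ℝ r) 0) (c 0) := by
        rw [hc0]
        exact ((hr.fderiv_right (m := 1) (by norm_num)).differentiableAt one_ne_zero).hasFDerivAt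
      have h1 := hd.comp_hasDerivAt 0 (hcd 0)
      have h2 : HasDerivAt c' (-((2 : ℝ) • q • coordVec 0)) 0 := by
        have : HasDerivAt (fun t : ℝ => 2 * t) 2 0 := by
          simpa using (hasDerivAt_id (0 : ℝ)).const_mul 2
        exact (this.smul_const (q • (coordVec 0 : Cn n))).const_sub v
      refine (h1.clm_apply h2).congr_deriv ?_
      have hc'0 : c' 0 = v := by simp [hc']
      simp only [Function.comp_apply, hc'0, hc0, h.fderiv_zero, PiLp.neg_apply, PiLp.smul_apply,
        coordVec_apply, if_true, smul_eq_mul, mul_one, Complex.neg_re, Complex.real_smul,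
        Complex.mul_re, Complex.re_ofNat, Complex.im_ofNat, Complex.ofReal_ofNat]
      ring
    exact d1.unique (d2.congr_of_eventuallyEq e1)

/-- The chart must fill the unit ball, which costs a dilation. The factor `δ⁻¹` preserves the linear
part `Re ζ₁`, while the quadratic coefficient is multiplied by `δ` and stays positive. -/
theorem HasNormalJet.dilate {lam : ℝ} {R : Cn n → ℝ} (h : HasNormalJet l lam R) {δ : ℝ}
    (hδ : 0 < δ) : HasNormalJet l (δ * lam) (fun ζ => δ⁻¹ * R (δ • ζ)) := by
  let D : Cn n →L[ℝ] Cn n := δ • ContinuousLinearMap.id ℝ (Cn n)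
  have hD : Filter.Tendsto D (𝓝 0) (𝓝 0) := by
    have := D.continuous.tendsto 0
    rwa [map_zero] at this
  have hder : ∀ᶠ ζ in 𝓝 0, fderiv ℝ (fun ζ => δ⁻¹ * R (δ • ζ)) ζ = fderiv ℝ R (D ζ) := by
    filter_upwards [hD.eventually h.smooth] with ζ hζ
    have : HasFDerivAt (fun ζ => δ⁻¹ * R (δ • ζ)) (δ⁻¹ • (fderiv ℝ R (D ζ)).comp D) ζ :=
      (((hζ.differentiableAt (by simp)).hasFDerivAt.comp ζ D.hasFDerivAt)).const_mul _
    rw [this.fderiv]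
    ext v
    simp [D, hδ.ne']
  refine ⟨?_, ?_, ?_, ?_⟩
  · filter_upwards [hD.eventually h.smooth] with ζ hζ
    exact contDiffAt_const.mul (hζ.comp ζ D.contDiff.contDiffAt)
  · filter_upwards [hD.eventually h.leaf, hder] with x hx hd hx0
    obtain ⟨h1, h2⟩ := hx fun j hj => by simp [D, hx0 j hj]
    refine ⟨?_, fun v hv => ?_⟩
    · change δ⁻¹ * R (D x) = 0
      rw [h1, mul_zero]
    · rw [hd, h2 v hv]
  · intro u
    rw [hder.self_of_nhds, map_zero, h.fderiv_zero]
  · intro v hv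
    have e : fderiv ℝ (fun ζ => δ⁻¹ * R (δ • ζ)) =ᶠ[𝓝 0] fun ζ => fderiv ℝ R (D ζ) := hder
    have hd : HasFDerivAt (fderiv ℝ R) (fderiv ℝ (fderiv ℝ R) 0) (D 0) := by
      rw [map_zero]
      exact ((h.smooth.self_of_nhds.fderiv_right (m := 1)
        two_le_infty).differentiableAt one_ne_zero).hasFDerivAt
    have hc : HasFDerivAt (fun ζ => fderiv ℝ R (D ζ)) _ 0 := hd.comp (0 : Cn n) D.hasFDerivAt
    rw [e.fderiv_eq, hc.fderiv]
    change fderiv ℝ (fderiv ℝ R) 0 (δ • v) v = _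
    rw [map_smul, smul_apply, h.hess_zero v hv, smul_eq_mul]
    ring

end NormalJet
end

noncomputable section

/-! ### Smooth local inverses -/

section LocalInverse

variable {E : Type*} [NormedAddCommGroup E] [NormedSpace ℝ E] [CompleteSpace E]

/-- Restricting to the open set where the derivative is invertible makes the inverse smooth on the
whole target, not only at the image of `a`. -/
theorem exists_openPartialHomeomorph_of_contDiffAt {G : E → E} {a : E}
    (hG : ∀ᶠ x in 𝓝 a, ContDiffAt ℝ ∞ G x) {f' : E ≃L[ℝ] E}
    (hf' : HasFDerivAt G (f' : E →L[ℝ] E) a) :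
    ∃ e : OpenPartialHomeomorph E E, (e : E → E) = G ∧ a ∈ e.source ∧
      (∀ x ∈ e.source, ∃ A : E ≃L[ℝ] E, HasFDerivAt G (A : E →L[ℝ] E) x) ∧
      ∀ y ∈ e.target, ContDiffAt ℝ ∞ e.symm y := by
  have hGa := hG.self_of_nhds
  let e₀ := hGa.toOpenPartialHomeomorph G hf' (by simp)
  have hcd : ContinuousAt (fderiv ℝ G) a :=
    (hGa.fderiv_right (m := 0) (by exact_mod_cast le_top)).continuousAt
  have hunit : ∀ᶠ x in 𝓝 a, fderiv ℝ G x ∈ Set.range ((↑) : (E ≃L[ℝ] E) → E →L[ℝ] E) :=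
    hcd.eventually (by rw [hf'.fderiv]; exact ContinuousLinearEquiv.nhds f')
  obtain ⟨W, hW, hWo, haW⟩ := eventually_nhds_iff.1 (hG.and hunit)
  refine ⟨e₀.restrOpen W hWo, rfl, ⟨hGa.mem_toOpenPartialHomeomorph_source hf' (by simp), haW⟩,
    ?_, ?_⟩
  · rintro x ⟨-, hx⟩
    obtain ⟨h1, A, hA⟩ := hW x hx
    exact ⟨A, by rw [hA]; exact (h1.differentiableAt (by simp)).hasFDerivAt⟩
  · intro y hy
    have hx : (e₀.restrOpen W hWo).symm y ∈ (e₀.restrOpen W hWo).source :=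
      (e₀.restrOpen W hWo).map_target hy
    obtain ⟨h1, A, hA⟩ := hW _ hx.2
    exact (e₀.restrOpen W hWo).contDiffAt_symm hy (f₀' := A)
      (by rw [hA]; exact (h1.differentiableAt (by simp)).hasFDerivAt) h1

end LocalInverse

/-! ### From the jet to a graph defining function in normal form -/

section Graph

variable {n : ℕ}

theorem norm_coordProj (s : Finset (Fin n)) (ζ : Cn n) : ‖coordProj s ζ‖ = partNorm s ζ := by
  rw [EuclideanSpace.norm_eq, partNorm]
  congr 1
  rw [← Finset.sum_subset (Finset.subset_univ s)]
  · exact Finset.sum_congr rfl fun j hj => by rw [coordProj_apply, if_pos hj]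
  · intro j _ hj
    rw [coordProj_apply, if_neg hj, norm_zero]; norm_num

theorem partNorm_nonneg (s : Finset (Fin n)) (ζ : Cn n) : 0 ≤ partNorm s ζ := Real.sqrt_nonneg _

theorem partNorm_le_norm (s : Finset (Fin n)) (ζ : Cn n) : partNorm s ζ ≤ ‖ζ‖ := by
  rw [EuclideanSpace.norm_eq, partNorm]
  exact Real.sqrt_le_sqrt
    (Finset.sum_le_sum_of_subset_of_nonneg (Finset.subset_univ s) fun _ _ _ => by positivity)

theorem partNorm_sq (s : Finset (Fin n)) (ζ : Cn n) : partNorm s ζ ^ 2 = ∑ j ∈ s, ‖ζ j‖ ^ 2 :=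
  Real.sq_sqrt (Finset.sum_nonneg fun _ _ => by positivity)

theorem norm_coordVec (j : Fin n) : ‖(coordVec j : Cn n)‖ = 1 := by simp [coordVec]

theorem norm_apply_le_norm (ζ : Cn n) (j : Fin n) : ‖ζ j‖ ≤ ‖ζ‖ := PiLp.norm_apply_le ζ j

variable [NeZero n] {l : ℕ} {lam : ℝ} {R : Cn n → ℝ}

theorem coordProj_add_coordProj_add (hl : l < n) (ζ : Cn n) :
    coordProj (primeIndices n l) ζ + coordProj (doublePrimeIndices n l) ζ + ζ 0 • coordVec 0 =
      ζ := by
  ext i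
  simp only [PiLp.add_apply, coordProj_apply, PiLp.smul_apply, coordVec_apply]
  by_cases h0 : i = 0
  · subst h0
    simp [zero_notMem_primeIndices, zero_notMem_doublePrimeIndices hl]
  · by_cases hi : i ∈ primeIndices n l
    · have hi' : i ∉ doublePrimeIndices n l := fun h' => notMem_primeIndices_of_mem h' hi
      simp [hi, h0, hi']
    · simp [hi, h0, mem_doublePrimeIndices_of_notMem h0 hi]

theorem HasNormalJet.map_zero (h : HasNormalJet l lam R) : R 0 = 0 :=
  (h.leaf.self_of_nhds fun _ _ => rfl).1

/-- The real part of the first coordinate. -/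
def reCoordZero (n : ℕ) [NeZero n] : Cn n →L[ℝ] ℝ :=
  Complex.reCLM.comp ((EuclideanSpace.proj (𝕜 := ℂ) (0 : Fin n)).restrictScalars ℝ)

theorem reCoordZero_apply (ζ : Cn n) : reCoordZero n ζ = (ζ 0).re := rfl

theorem HasNormalJet.fderiv_zero_eq (h : HasNormalJet l lam R) :
    fderiv ℝ R 0 = reCoordZero n := by
  ext u; rw [h.fderiv_zero, reCoordZero_apply]

theorem DifferentiableAt.exists_norm_sub_le {E F : Type*} [NormedAddCommGroup E]
    [NormedSpace ℝ E] [NormedAddCommGroup F] [NormedSpace ℝ F] {f : E → F}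
    (hf : DifferentiableAt ℝ f 0) :
    ∃ C : ℝ, 0 ≤ C ∧ ∀ᶠ z in 𝓝 0, ‖f z - f 0‖ ≤ C * ‖z‖ := by
  obtain ⟨C, hC, hb⟩ := hf.hasFDerivAt.isBigO_sub.exists_nonneg
  refine ⟨C, hC, hb.bound.mono fun z hz => ?_⟩
  rwa [sub_zero] at hz

theorem HasNormalJet.exists_norm_fderiv_sub_le (h : HasNormalJet l lam R) :
    ∃ C : ℝ, 0 ≤ C ∧ ∀ᶠ z in 𝓝 0, ‖fderiv ℝ R z - reCoordZero n‖ ≤ C * ‖z‖ := by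
  rw [← h.fderiv_zero_eq]
  exact ((h.smooth.self_of_nhds.fderiv_right (m := 1)
    (one_add_one_eq_two.le.trans two_le_infty)).differentiableAt (by simp)).exists_norm_sub_le

theorem HasNormalJet.exists_norm_fderiv_fderiv_sub_le (h : HasNormalJet l lam R) :
    ∃ C : ℝ, 0 ≤ C ∧ ∀ᶠ z in 𝓝 0,
      ‖fderiv ℝ (fderiv ℝ R) z - fderiv ℝ (fderiv ℝ R) 0‖ ≤ C * ‖z‖ := by
  have h2 : ContDiffAt ℝ 1 (fderiv ℝ (fderiv ℝ R)) 0 :=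
    (h.smooth.self_of_nhds.fderiv_right (m := 2) (two_add_one_eq_three.le.trans
      three_le_infty)).fderiv_right (m := 1) one_add_one_eq_two.le
  exact (h2.differentiableAt (by simp)).exists_norm_sub_le

/-- The second order expansion of a function in normal form, on `{ζ₁ = 0}`. -/
theorem HasNormalJet.exists_abs_sub_le (h : HasNormalJet l lam R) :
    ∃ C : ℝ, 0 ≤ C ∧ ∀ᶠ ζ in 𝓝 (0 : Cn n),
      |R (coordProj (primeIndices n l) ζ + coordProj (doublePrimeIndices n l) ζ) -
          lam * partNorm (primeIndices n l) ζ ^ 2| ≤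
        C * (partNorm (doublePrimeIndices n l) ζ + partNorm (primeIndices n l) ζ) *
          partNorm (primeIndices n l) ζ ^ 2 := by
  obtain ⟨C, hC, hb⟩ := h.exists_norm_fderiv_fderiv_sub_le
  refine ⟨C, hC, ?_⟩
  obtain ⟨ε, hε, hball⟩ := Metric.eventually_nhds_iff_ball.1 (hb.and (h.smooth.and h.leaf))
  have hε2 : 0 < ε / 2 := by positivity
  filter_upwards [Metric.ball_mem_nhds (0 : Cn n) hε2] with ζ hζ
  set v := coordProj (primeIndices n l) ζ with hv
  set x := coordProj (doublePrimeIndices n l) ζ with hx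
  have hvn : ‖v‖ = partNorm (primeIndices n l) ζ := norm_coordProj _ _
  have hxn : ‖x‖ = partNorm (doublePrimeIndices n l) ζ := norm_coordProj _ _
  rw [mem_ball_zero_iff] at hζ
  have hvl : ‖v‖ < ε / 2 := by rw [hvn]; exact (partNorm_le_norm _ _).trans_lt hζ
  have hxl : ‖x‖ < ε / 2 := by rw [hxn]; exact (partNorm_le_norm _ _).trans_lt hζ
  have hseg : ∀ t ∈ Set.Icc (0 : ℝ) 1, ‖x + t • v‖ ≤ ‖x‖ + ‖v‖ := by
    intro t ht
    refine (norm_add_le _ _).trans ?_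
    rw [norm_smul, Real.norm_of_nonneg ht.1]
    nlinarith [ht.2, norm_nonneg v]
  have hmem : ∀ t ∈ Set.Icc (0 : ℝ) 1, x + t • v ∈ Metric.ball (0 : Cn n) ε := by
    intro t ht
    rw [mem_ball_zero_iff]
    linarith [hseg t ht]
  have hvs : ∀ j ∉ primeIndices n l, v j = 0 := fun j hj => by rw [hv, coordProj_apply, if_neg hj]
  have hxs : ∀ j ∉ doublePrimeIndices n l, x j = 0 := fun j hj => by
    rw [hx, coordProj_apply, if_neg hj]
  have hxb : x ∈ Metric.ball (0 : Cn n) ε := by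
    rw [mem_ball_zero_iff]; linarith
  obtain ⟨hRx, hDx⟩ := (hball x hxb).2.2 hxs
  have hQ : ∑ j ∈ primeIndices n l, ‖v j‖ ^ 2 = partNorm (primeIndices n l) ζ ^ 2 := by
    rw [partNorm_sq]
    exact Finset.sum_congr rfl fun j hj => by rw [hv, coordProj_apply, if_pos hj]
  -- Taylor expansion at the leaf point `x` in the `ζ'` direction `v`: the value and first
  -- derivative vanish there, and the Hessian on the segment differs from that at `0` by `O(‖x‖ +
  -- ‖v‖)`.
  have hT := abs_taylor_two_le (f := R) (a := x) (v := v) (B := fderiv ℝ (fderiv ℝ R) 0 v v)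
    (ε := C * (‖x‖ + ‖v‖) * ‖v‖ ^ 2)
    (fun t ht => (hball _ (hmem t ht)).2.1.of_le two_le_infty) (fun t ht => by
      have h1 := (hball _ (hmem t ht)).1
      calc |fderiv ℝ (fderiv ℝ R) (x + t • v) v v - fderiv ℝ (fderiv ℝ R) 0 v v|
          = ‖(fderiv ℝ (fderiv ℝ R) (x + t • v) - fderiv ℝ (fderiv ℝ R) 0) v v‖ := rfl
        _ ≤ ‖fderiv ℝ (fderiv ℝ R) (x + t • v) - fderiv ℝ (fderiv ℝ R) 0‖ * ‖v‖ * ‖v‖ :=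
          ContinuousLinearMap.le_opNorm₂ _ _ _
        _ ≤ (C * (‖x‖ + ‖v‖)) * ‖v‖ * ‖v‖ := by
          gcongr
          exact h1.trans (by gcongr; exact hseg t ht)
        _ = C * (‖x‖ + ‖v‖) * ‖v‖ ^ 2 := by ring)
  have e1 : v + x = x + v := add_comm _ _
  rw [hRx, hDx v hvs, h.hess_zero v hvs, hQ, hvn, hxn] at hT
  rw [e1]
  convert hT using 2
  ring

/-- The error term of the normal form. -/
theorem levi_error_le {C K lam P D y N F Rb : ℝ} (hC : 0 ≤ C) (hK : 0 ≤ K) (hlam : 0 ≤ lam)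
    (hP : 0 ≤ P) (hD : 0 ≤ D) (hy : 0 ≤ y) (hPN : P ≤ N) (hDN : D ≤ N) (hyN : y ≤ N)
    (hN : N ≤ 1) (hRb : |Rb - lam * P ^ 2| ≤ K * (D + P) * P ^ 2)
    (hF : |F - Rb| ≤ C * (P + D + y + |F|) * (y + |F|))
    (hsmall : C * (P + D + y + |F|) ≤ 1 / 2) :
    |F - lam * P ^ 2| ≤ (K + C * (4 + 2 * (lam + 2 * K)) * (2 + 2 * (lam + 2 * K))) *
      (P ^ 2 * D + P ^ 3 + y * N) := by
  set M := lam + 2 * K with hM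
  have hM0 : 0 ≤ M := by positivity
  have hN0 : 0 ≤ N := hP.trans hPN
  have hRb' : |Rb| ≤ M * P ^ 2 := by
    have h1 : |Rb| ≤ |Rb - lam * P ^ 2| + lam * P ^ 2 := by
      have := abs_sub_abs_le_abs_sub Rb (lam * P ^ 2)
      rw [abs_of_nonneg (by positivity : 0 ≤ lam * P ^ 2)] at this
      linarith
    have h2 : K * (D + P) * P ^ 2 ≤ K * 2 * P ^ 2 := by gcongr; linarith
    nlinarith
  -- `P`, `D`, `y` and `N` stand for `|ζ'|`, `|ζ''|`, `|Im ζ₁|` and `|ζ|`, and `F` for `ρ - Re ζ₁`.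
  -- The smallness hypothesis lets the left side absorb `|F|/2`.
  have hFle : |F| ≤ 2 * M * P ^ 2 + y := by
    have h1 : |F| ≤ |F - Rb| + |Rb| := by
      have := abs_sub_abs_le_abs_sub F Rb
      linarith
    have h2 : C * (P + D + y + |F|) * (y + |F|) ≤ 1 / 2 * (y + |F|) := by gcongr
    linarith
  have hP2 : P ^ 2 ≤ P := by nlinarith
  have hS : P + D + y + |F| ≤ P + D + 2 * y + 2 * M * P := by
    have : 2 * M * P ^ 2 ≤ 2 * M * P := by gcongr
    linarith
  have hE : |F - Rb| ≤ C * (P + D + 2 * y + 2 * M * P) * (2 * y + 2 * M * P ^ 2) := by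
    refine hF.trans ?_
    gcongr ?_ * ?_
    · gcongr
    · linarith
  have hpos : 0 ≤ P ^ 2 * D + P ^ 3 + y * N := by positivity
  have hprod : (P + D + 2 * y + 2 * M * P) * (2 * y + 2 * M * P ^ 2) ≤
      (4 + 2 * M) * (2 + 2 * M) * (P ^ 2 * D + P ^ 3 + y * N) := by
    have h1 : (P + D + 2 * y + 2 * M * P) * y ≤ (4 + 2 * M) * (y * N) := by
      have : P + D + 2 * y + 2 * M * P ≤ (4 + 2 * M) * N := by nlinarith
      nlinarith
    have h2 : (P + D + 2 * y + 2 * M * P) * P ^ 2 ≤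
        (4 + 2 * M) * (P ^ 2 * D + P ^ 3 + y * N) := by
      have : y * P ^ 2 ≤ y * N := by gcongr; linarith
      have a1 : 0 ≤ P ^ 2 * D := by positivity
      have a2 : 0 ≤ P ^ 3 := by positivity
      have a3 : 0 ≤ y * N := by positivity
      nlinarith [mul_nonneg hM0 a1, mul_nonneg hM0 a3]
    have a1 : 0 ≤ P ^ 2 * D := by positivity
    have a2 : 0 ≤ P ^ 3 := by positivity
    have h3 : (4 + 2 * M) * (y * N) ≤ (4 + 2 * M) * (P ^ 2 * D + P ^ 3 + y * N) := by
      gcongr; linarith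
    have h4 := mul_le_mul_of_nonneg_left h2 hM0
    linarith
  have hfin : |F - lam * P ^ 2| ≤ |F - Rb| + |Rb - lam * P ^ 2| := abs_sub_le _ _ _
  have hK2 : K * (D + P) * P ^ 2 ≤ K * (P ^ 2 * D + P ^ 3 + y * N) := by
    have : 0 ≤ K * (y * N) := by positivity
    linarith
  have hC2 := mul_le_mul_of_nonneg_left hprod hC
  linarith

/-- A function in normal form has, near `0`, the same sign as a defining function which is a
graph over `{Re ζ₁ = 0}` and has the Levi normal form. -/
theorem HasNormalJet.exists_hasLeviNormalForm (hl : l < n) (hlam : 0 < lam)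
    (h : HasNormalJet l lam R) :
    ∃ (ε : ℝ) (ρ : Cn n → ℝ), 0 < ε ∧ ε ≤ 1 ∧ ContDiffOn ℝ ∞ ρ (Metric.ball 0 ε) ∧
      (∀ ζ ∈ Metric.ball 0 ε, (R ζ < 0 ↔ ρ ζ < 0) ∧ (R ζ = 0 ↔ ρ ζ = 0) ∧ fderiv ℝ ρ ζ ≠ 0) ∧
      HasLeviNormalForm l ρ := by
  set e₀ : Cn n := coordVec 0 with he₀
  have he₀1 : ‖e₀‖ = 1 := norm_coordVec 0
  have he₀0 : reCoordZero n e₀ = 1 := by simp [reCoordZero_apply, he₀, coordVec_apply]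
  -- `G` replaces the coordinate `Re ζ₁` by `R`. It is tangent to the identity because `dR(0) = Re
  -- ζ₁`.
  set G : Cn n → Cn n := fun ζ => ζ + (R ζ - reCoordZero n ζ) • e₀ with hG
  have hGs : ∀ᶠ ζ in 𝓝 0, ContDiffAt ℝ ∞ G ζ := by
    filter_upwards [h.smooth] with ζ hζ
    exact contDiffAt_id.add ((hζ.sub (reCoordZero n).contDiff.contDiffAt).smul contDiffAt_const)
  have hGd : HasFDerivAt G (ContinuousLinearEquiv.refl ℝ (Cn n) : Cn n →L[ℝ] Cn n) 0 := by
    have h1 := (h.smooth.self_of_nhds.differentiableAt (by simp)).hasFDerivAt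
    rw [h.fderiv_zero_eq] at h1
    refine ((hasFDerivAt_id (𝕜 := ℝ) (0 : Cn n)).add
      ((h1.sub (reCoordZero n).hasFDerivAt).smul_const e₀)).congr_fderiv ?_
    ext1 v
    simp
  obtain ⟨e, heG, he0, -, hes⟩ := exists_openPartialHomeomorph_of_contDiffAt hGs hGd
  have hG0 : G 0 = 0 := by simp [hG, h.map_zero]
  have h0t : (0 : Cn n) ∈ e.target := by
    have := e.map_source he0
    rwa [heG, hG0] at this
  have hH0 : e.symm 0 = 0 := by
    have := e.left_inv he0
    rwa [heG, hG0] at this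
  set s : Cn n → Cn n := fun ζ => ζ - reCoordZero n ζ • e₀ with hs
  have hss : ContDiff ℝ ∞ s :=
    contDiff_id.sub ((reCoordZero n).contDiff.smul contDiff_const)
  have hs0 : s 0 = 0 := by simp [hs]
  -- The map `s` erases `Re ζ₁`, so `e.symm (s ζ)` is the point of `{R = 0}` on the real line
  -- through `ζ` in direction `e₀`, and `ρ ζ` is the signed displacement from it. Thus `ρ - Re ζ₁`
  -- does not depend on `Re ζ₁`.
  set ρ : Cn n → ℝ := fun ζ => reCoordZero n ζ - reCoordZero n (e.symm (s ζ)) with hρ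
  have hst : ∀ᶠ ζ in 𝓝 0, s ζ ∈ e.target :=
    hss.continuous.continuousAt.eventually (by rw [hs0]; exact e.open_target.mem_nhds h0t)
  have hρs : ∀ ζ, s ζ ∈ e.target → ContDiffAt ℝ ∞ ρ ζ := fun ζ hζ =>
    (reCoordZero n).contDiff.contDiffAt.sub ((reCoordZero n).contDiff.contDiffAt.comp ζ
      ((hes _ hζ).comp ζ hss.contDiffAt))
  have hsre : ∀ ζ, reCoordZero n (s ζ) = 0 := fun ζ => by
    simp [hs, he₀0]
  have hGre : ∀ ζ, reCoordZero n (G ζ) = R ζ := fun ζ => by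
    simp [hG, he₀0]
  have hgraph : ∀ ζ, s ζ ∈ e.target → e.symm (s ζ) = ζ - ρ ζ • e₀ ∧ R (ζ - ρ ζ • e₀) = 0 := by
    intro ζ hζ
    have h1 : G (e.symm (s ζ)) = s ζ := by rw [← heG]; exact e.right_inv hζ
    have h2 : R (e.symm (s ζ)) = 0 := by rw [← hGre, h1, hsre]
    have h3 : e.symm (s ζ) = ζ - ρ ζ • e₀ := by
      have h4 : e.symm (s ζ) + (R (e.symm (s ζ)) - reCoordZero n (e.symm (s ζ))) • e₀ = s ζ := h1
      rw [h2, zero_sub, neg_smul, ← sub_eq_add_neg, sub_eq_iff_eq_add] at h4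
      rw [hρ, sub_smul, ← sub_add, ← h4]
    exact ⟨h3, h3 ▸ h2⟩
  have hρ0 : ρ 0 = 0 := by simp [hρ, hs0, hH0]
  have hρc : ContinuousAt ρ 0 := (hρs 0 (by rwa [hs0])).continuousAt
  have hρd : ∀ ζ, s ζ ∈ e.target → fderiv ℝ ρ ζ ≠ 0 := by
    intro ζ hζ h0
    have hline : HasDerivAt (fun t : ℝ => ζ + t • e₀) e₀ 0 := by
      simpa using ((hasDerivAt_id (0 : ℝ)).smul_const e₀).const_add ζ
    have h1 : HasDerivAt (fun t : ℝ => ρ (ζ + t • e₀)) (fderiv ℝ ρ ζ e₀) 0 :=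
      HasFDerivAt.comp_hasDerivAt (l := ρ) (0 : ℝ) (by
        rw [zero_smul, add_zero]
        exact ((hρs ζ hζ).differentiableAt (by simp)).hasFDerivAt) hline
    have h2 : (fun t : ℝ => ρ (ζ + t • e₀)) = fun t => ρ ζ + t := by
      funext t
      have : s (ζ + t • e₀) = s ζ := by
        simp only [hs, map_add, map_smul, he₀0, add_smul, smul_eq_mul, mul_one]
        abel
      simp only [hρ, this, map_add, map_smul, he₀0, smul_eq_mul, mul_one]
      ring
    rw [h2, h0] at h1
    have h3 := h1.unique ((hasDerivAt_id (0 : ℝ)).const_add (ρ ζ))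
    simp at h3
  clear_value ρ
  obtain ⟨C, hC, hCb⟩ := h.exists_norm_fderiv_sub_le
  obtain ⟨K, hK, hKb⟩ := h.exists_abs_sub_le
  obtain ⟨η, hη, hball⟩ := Metric.eventually_nhds_iff_ball.1 (hCb.and h.smooth)
  -- Mean value inequality for `R - Re ζ₁`, whose gradient is `O(‖z‖)`. It serves twice: with `c = 1
  -- / 2` to compare signs, and with small `c` for the error term.
  have hMV : ∀ (c : ℝ) (a b : Cn n), a ∈ Metric.ball (0 : Cn n) η → b ∈ Metric.ball (0 : Cn n) η →
      C * max ‖a‖ ‖b‖ ≤ c → |R b - R a - reCoordZero n (b - a)| ≤ c * ‖b - a‖ := by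
    intro c a b ha hb hc
    have hsub : segment ℝ a b ⊆ Metric.ball 0 η := (convex_ball _ _).segment_subset ha hb
    refine Convex.norm_image_sub_le_of_norm_fderiv_le' (s := segment ℝ a b) (𝕜 := ℝ)
      (fun x hx => (hball x (hsub hx)).2.differentiableAt (by simp)) (fun x hx => ?_)
      (convex_segment a b) (left_mem_segment ℝ a b) (right_mem_segment ℝ a b)
    refine ((hball x (hsub hx)).1.trans ?_).trans hc
    gcongr
    have hcx : ConvexOn ℝ Set.univ (norm : Cn n → ℝ) := convexOn_univ_norm
    exact hcx.le_max_of_mem_segment (Set.mem_univ a) (Set.mem_univ b) hx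
  have hac : ContinuousAt (fun ζ => ζ - ρ ζ • e₀) 0 := by fun_prop
  have hac0 : (fun ζ => ζ - ρ ζ • e₀) 0 = 0 := by simp [hρ0]
  have hsmallball : ∀ᶠ z in 𝓝 (0 : Cn n), z ∈ Metric.ball 0 η ∧ C * ‖z‖ < 1 / 2 := by
    have h1 : ∀ᶠ z in 𝓝 (0 : Cn n), C * ‖z‖ < 1 / 2 :=
      ContinuousAt.eventually_lt (by fun_prop) continuousAt_const (by simp)
    filter_upwards [Metric.ball_mem_nhds (0 : Cn n) hη, h1] with z hz hz' using ⟨hz, hz'⟩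
  have hgood := hst.and (hsmallball.and (hac.eventually (by rw [hac0]; exact hsmallball)))
  obtain ⟨ε, hε, hεb⟩ := Metric.eventually_nhds_iff_ball.1 hgood
  refine ⟨min ε 1, ρ, by positivity, min_le_right _ _, fun ζ hζ => (hρs ζ
    (hεb ζ (Metric.ball_subset_ball (min_le_left _ _) hζ)).1).contDiffWithinAt, fun ζ hζ => ?_,
    fun _ => lam, fun _ _ => hlam, ?_⟩
  · obtain ⟨h1, ⟨h2, h3⟩, h4, h5⟩ := hεb ζ (Metric.ball_subset_ball (min_le_left _ _) hζ)
    -- As `R` vanishes at the graph point, `|R ζ - ρ ζ| ≤ |ρ ζ| / 2`, so the two functions have the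
    -- same sign and zeros.
    have hd := hMV (1 / 2) _ ζ h4 h2 (by
      rcases max_choice ‖ζ - ρ ζ • e₀‖ ‖ζ‖ with hm | hm <;> rw [hm] <;> linarith)
    rw [(hgraph ζ h1).2, sub_sub_cancel, map_smul, he₀0, norm_smul, he₀1, Real.norm_eq_abs,
      smul_eq_mul, mul_one, sub_zero, mul_one] at hd
    refine ⟨?_, ?_, hρd ζ h1⟩
    · rcases abs_cases (ρ ζ) with ⟨ha, -⟩ | ⟨ha, -⟩ <;> rw [ha] at hd <;>
        constructor <;> intro _ <;> linarith [abs_le.1 hd]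
    · constructor <;> intro h0
      · rw [h0, zero_sub, abs_neg] at hd
        exact abs_nonpos_iff.1 (by linarith)
      · rw [h0] at hd
        simpa using hd
  · refine Asymptotics.IsBigO.of_bound
      (K + C * (4 + 2 * (lam + 2 * K)) * (2 + 2 * (lam + 2 * K))) ?_
    have hFc : ContinuousAt (fun ζ : Cn n => C * (partNorm (primeIndices n l) ζ +
        partNorm (doublePrimeIndices n l) ζ + |(ζ 0).im| + |ρ ζ - reCoordZero n ζ|)) 0 := by
      have := hρc
      have h1 : Continuous (partNorm (primeIndices n l) : Cn n → ℝ) := by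
        unfold partNorm; fun_prop
      have h2 : Continuous (partNorm (doublePrimeIndices n l) : Cn n → ℝ) := by
        unfold partNorm; fun_prop
      have h3 : Continuous fun ζ : Cn n => |(ζ 0).im| :=
        (Complex.continuous_im.comp (EuclideanSpace.proj (𝕜 := ℂ) (0 : Fin n)).continuous).abs
      fun_prop
    have hFs : ∀ᶠ ζ in 𝓝 (0 : Cn n), C * (partNorm (primeIndices n l) ζ +
        partNorm (doublePrimeIndices n l) ζ + |(ζ 0).im| + |ρ ζ - reCoordZero n ζ|) < 1 / 2 :=
      hFc.eventually_lt continuousAt_const (by simp [partNorm, hρ0])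
    have hbc : ContinuousAt (fun ζ : Cn n => coordProj (primeIndices n l) ζ +
        coordProj (doublePrimeIndices n l) ζ) 0 := by fun_prop
    have hbs : ∀ᶠ ζ in 𝓝 (0 : Cn n), coordProj (primeIndices n l) ζ +
        coordProj (doublePrimeIndices n l) ζ ∈ Metric.ball (0 : Cn n) η :=
      hbc.eventually (by
        beta_reduce
        rw [_root_.map_zero, _root_.map_zero, add_zero]
        exact Metric.ball_mem_nhds (0 : Cn n) hη)
    filter_upwards [hgood, hKb, hFs, hbs, Metric.ball_mem_nhds (0 : Cn n) one_pos] with ζ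
      ⟨h1, ⟨h2, h3⟩, h4, h5⟩ h6 h7 h8 h9
    set P := partNorm (primeIndices n l) ζ with hPdef
    set D := partNorm (doublePrimeIndices n l) ζ with hDdef
    set b := coordProj (primeIndices n l) ζ + coordProj (doublePrimeIndices n l) ζ with hb
    have hre : reCoordZero n ζ = (ζ 0).re := rfl
    rw [hre] at h7
    have hbn : ‖b‖ ≤ P + D := by
      refine (norm_add_le _ _).trans ?_
      rw [norm_coordProj, norm_coordProj]
    have hab : ζ - ρ ζ • e₀ - b = (ζ 0 - (ρ ζ : ℂ)) • e₀ := by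
      have h10 : b + ζ 0 • e₀ = ζ := coordProj_add_coordProj_add hl ζ
      rw [sub_smul, Complex.coe_smul]
      nth_rewrite 1 [← h10]
      abel
    have habn : ‖ζ - ρ ζ • e₀ - b‖ ≤ |(ζ 0).im| + |ρ ζ - (ζ 0).re| := by
      rw [hab, norm_smul, he₀1, mul_one]
      refine (Complex.norm_le_abs_re_add_abs_im _).trans ?_
      rw [Complex.sub_re, Complex.sub_im, Complex.ofReal_re, Complex.ofReal_im, sub_zero,
        abs_sub_comm, add_comm]
    have hre2 : reCoordZero n (ζ - ρ ζ • e₀ - b) = -(ρ ζ - (ζ 0).re) := by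
      rw [hab, reCoordZero_apply]
      simp [he₀, coordVec_apply]
    have han : ‖ζ - ρ ζ • e₀‖ ≤ P + D + |(ζ 0).im| + |ρ ζ - (ζ 0).re| := by
      have := norm_le_norm_add_norm_sub' (ζ - ρ ζ • e₀) b
      linarith
    -- Compare the graph point, where `R = 0`, with `b = ζ' + ζ''`, where the expansion of `R` is
    -- known. They differ by `(ζ₁ - ρ) e₀`, of size at most `|Im ζ₁| + |F|`.
    have hd := hMV (C * (P + D + |(ζ 0).im| + |ρ ζ - (ζ 0).re|)) b _ h8 h4 (by
      gcongr
      exact max_le (hbn.trans (by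
        have := abs_nonneg (ζ 0).im
        have := abs_nonneg (ρ ζ - (ζ 0).re)
        linarith)) han)
    rw [(hgraph ζ h1).2, hre2] at hd
    have hζ1 : ‖ζ‖ ≤ 1 := (mem_ball_zero_iff.1 h9).le
    have := levi_error_le (F := ρ ζ - (ζ 0).re) (Rb := R b) (lam := lam) hC hK hlam.le
      (partNorm_nonneg (primeIndices n l) ζ) (partNorm_nonneg (doublePrimeIndices n l) ζ)
      (abs_nonneg (ζ 0).im) (partNorm_le_norm _ _) (partNorm_le_norm _ _)
      ((Complex.abs_im_le_norm _).trans (norm_apply_le_norm ζ 0)) hζ1 h6 (by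
        calc |ρ ζ - (ζ 0).re - R b| = |0 - R b - -(ρ ζ - (ζ 0).re)| := by congr 1; ring
          _ ≤ _ := hd.trans (mul_le_mul_of_nonneg_left habn (by
            have := partNorm_nonneg (primeIndices n l) ζ
            have := partNorm_nonneg (doublePrimeIndices n l) ζ
            positivity))) h7.le
    rw [← Finset.mul_sum, ← partNorm_sq, Real.norm_eq_abs, Real.norm_of_nonneg, ← sub_sub]
    · exact this
    · have := partNorm_nonneg (primeIndices n l) ζ
      have := partNorm_nonneg (doublePrimeIndices n l) ζ
      positivity

end Graph
end

noncomputable section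

/-! ### The biholomorphic chart onto the unit ball -/

section Chart

variable {n : ℕ}

/-- A holomorphic map tangent to the identity is, after a dilation, the inverse of a chart onto the
unit ball. -/
theorem exists_chart_of_hasFDerivAt_id {Ψ : Cn n → Cn n} {δ : ℝ} (hδ : 0 < δ) (h0 : Ψ 0 = 0)
    (hs : ContDiffOn ℝ ∞ Ψ (Metric.ball 0 δ)) (hh : DifferentiableOn ℂ Ψ (Metric.ball 0 δ))
    (hd : HasFDerivAt Ψ (ContinuousLinearMap.id ℂ (Cn n)) 0) (p : Cn n) (Λ : Cn n ≃L[ℂ] Cn n)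
    {V : Set (Cn n)} (hV : V ∈ 𝓝 p) :
    ∃ (Φ : OpenPartialHomeomorph (Cn n) (Cn n)) (η : ℝ), 0 < η ∧ IsBiholomorphism Φ ∧
      p ∈ Φ.source ∧ Φ.source ⊆ V ∧ Φ.target = Metric.ball 0 1 ∧ Φ p = 0 ∧
      ∀ ζ, Φ.symm ζ = p + Λ (Ψ (η • ζ)) := by
  have hsm : ∀ᶠ ζ in 𝓝 (0 : Cn n), ContDiffAt ℝ ∞ Ψ ζ := by
    filter_upwards [Metric.ball_mem_nhds (0 : Cn n) hδ] with ζ hζ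
    exact hs.contDiffAt (Metric.isOpen_ball.mem_nhds hζ)
  have hd' : HasFDerivAt Ψ (ContinuousLinearEquiv.refl ℝ (Cn n) : Cn n →L[ℝ] Cn n) 0 :=
    hd.restrictScalars ℝ
  obtain ⟨e, heΨ, he0, hed, -⟩ := exists_openPartialHomeomorph_of_contDiffAt hsm hd'
  have hc : ContinuousAt (fun ζ => p + Λ (Ψ ζ)) 0 := by
    have := hd'.continuousAt
    fun_prop
  have hcV : ∀ᶠ ζ in 𝓝 (0 : Cn n), p + Λ (Ψ ζ) ∈ V :=
    hc.eventually (by simpa [h0] using hV)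
  have hδm : ∀ᶠ ζ in 𝓝 (0 : Cn n), ζ ∈ Metric.ball 0 δ := Metric.ball_mem_nhds 0 hδ
  have hes : ∀ᶠ ζ in 𝓝 (0 : Cn n), ζ ∈ e.source := e.open_source.mem_nhds he0
  obtain ⟨η, hη, hball⟩ := Metric.eventually_nhds_iff_ball.1
    (((hes).and hδm).and hcV)
  let D : Cn n ≃ₜ Cn n := Homeomorph.smulOfNeZero η hη.ne'
  let A : Cn n ≃ₜ Cn n := Λ.toHomeomorph.trans (Homeomorph.addLeft p)
  let e₁ := e.restrOpen (Metric.ball 0 η) Metric.isOpen_ball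
  let S := (D.toOpenPartialHomeomorph.trans e₁).trans A.toOpenPartialHomeomorph
  have hball1 : ∀ ζ : Cn n, η • ζ ∈ Metric.ball (0 : Cn n) η ↔ ζ ∈ Metric.ball (0 : Cn n) 1 := by
    intro ζ
    rw [mem_ball_zero_iff, mem_ball_zero_iff, norm_smul, Real.norm_of_nonneg hη.le]
    exact ⟨fun h => by nlinarith, fun h => by nlinarith⟩
  have hSs : S.source = Metric.ball 0 1 := by
    ext ζ
    rw [← hball1]
    constructor
    · rintro ⟨⟨-, -, h⟩, -⟩
      exact h
    · intro h
      exact ⟨⟨trivial, (hball _ h).1.1, h⟩, trivial⟩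
  have hSv : ∀ ζ, S ζ = p + Λ (Ψ (η • ζ)) := fun ζ => by
    rw [← heΨ]; rfl
  have h0s : (0 : Cn n) ∈ S.source := by rw [hSs]; simp
  have hS0 : S 0 = p := by simp [hSv, h0]
  refine ⟨S.symm, η, hη, ⟨?_, ?_⟩, ?_, ?_, hSs, ?_, hSv⟩
  · intro z hz
    have hζ : S.symm z ∈ S.source := S.map_target hz
    rw [hSs, ← hball1] at hζ
    set w := η • S.symm z with hw
    have hzA : p + Λ (Ψ w) = z := by rw [← hSv]; exact S.right_inv hz
    have hy : Λ.symm (z - p) ∈ e.target ∧ e.symm (Λ.symm (z - p)) = w := by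
      rw [← hzA, add_sub_cancel_left, Λ.symm_apply_apply, ← heΨ]
      exact ⟨e.map_source (hball _ hζ).1.1, e.left_inv (hball _ hζ).1.1⟩
    obtain ⟨B, hB⟩ := hed w (hball _ hζ).1.1
    have hBc := ((hh.differentiableAt
      (Metric.isOpen_ball.mem_nhds (hball _ hζ).1.2)).hasFDerivAt.restrictScalars ℝ).unique hB
    -- The inverse of a complex linear bijection is complex linear, so the local inverse,
    -- differentiable over the reals, is holomorphic.
    have hBI : ∀ v, B.symm (Complex.I • v) = Complex.I • B.symm v := by
      intro v
      rw [ContinuousLinearEquiv.symm_apply_eq]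
      have e1 : ∀ u, B u = fderiv ℂ Ψ w u := fun u => by
        rw [← ContinuousLinearEquiv.coe_coe, ← hBc]; rfl
      rw [e1, map_smul, ← e1, B.apply_symm_apply]
    have hes : DifferentiableAt ℂ e.symm (Λ.symm (z - p)) := by
      exact HasFDerivAt.differentiableAt_complex
        (e.hasFDerivAt_symm (f' := B) hy.1 (by rw [heΨ, hy.2]; exact hB)) hBI
    have hSe : ∀ᶠ z' in 𝓝 z, S.symm z' = η⁻¹ • e.symm (Λ.symm (z' - p)) := by
      refine Filter.Eventually.of_forall fun z' => ?_
      have : S.symm z' = η⁻¹ • e.symm (Λ.symm (-p + z')) := rfl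
      rw [this, neg_add_eq_sub]
    refine DifferentiableAt.differentiableWithinAt ?_
    refine DifferentiableAt.congr_of_eventuallyEq ?_ hSe
    have h1 : DifferentiableAt ℂ (fun z' => Λ.symm (z' - p)) z := by fun_prop
    have h2 : DifferentiableAt ℂ (fun z' => e.symm (Λ.symm (z' - p))) z := hes.comp z h1
    exact h2.const_smul η⁻¹
  · intro ζ hζ
    have hζ' : ζ ∈ S.source := hζ
    rw [hSs, ← hball1] at hζ'
    refine DifferentiableAt.differentiableWithinAt ?_
    have hSe : (S : Cn n → Cn n) = fun ζ => p + Λ (Ψ (η • ζ)) := funext hSv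
    rw [OpenPartialHomeomorph.symm_symm, hSe]
    have h1 := hh.differentiableAt (Metric.isOpen_ball.mem_nhds (hball _ hζ').1.2)
    have h2 : DifferentiableAt ℂ (fun ζ : Cn n => η • ζ) ζ := differentiableAt_id.const_smul η
    have h3 : DifferentiableAt ℂ (fun ζ => Ψ (η • ζ)) ζ := h1.comp ζ h2
    fun_prop
  · rw [← hS0]; exact S.map_source h0s
  · intro z hz
    have hζ : S.symm z ∈ S.source := S.map_target hz
    have : S (S.symm z) = z := S.right_inv hz
    rw [← this, hSv]
    rw [hSs, ← hball1] at hζ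
    exact (hball _ hζ).2
  · rw [← hS0]; exact S.left_inv h0s

end Chart
end

noncomputable section

/-! ### The principal branch of the power `2/3` -/

section CpowTwoThirds

theorem Complex.re_cpow_two_thirds {w : ℂ} (hw : w ≠ 0) :
    ∃ c : ℝ, 0 < c ∧ (w ^ (2 / 3 : ℂ)).re = c * Real.cos (|w.arg| * (2 / 3)) := by
  refine ⟨_, Real.exp_pos (Complex.log w * (2 / 3)).re, ?_⟩
  have h : (Complex.log w * (2 / 3)).im = w.arg * (2 / 3) := by
    have : (2 / 3 : ℂ) = ((2 / 3 : ℝ) : ℂ) := by push_cast; rfl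
    rw [this, Complex.im_mul_ofReal, Complex.log_im]
  have h2 : Real.cos (|w.arg| * (2 / 3)) = Real.cos (w.arg * (2 / 3)) := by
    rw [← Real.cos_abs (w.arg * (2 / 3)), abs_mul, abs_of_pos (by norm_num : (0 : ℝ) < 2 / 3)]
  rw [Complex.cpow_def_of_ne_zero hw, Complex.exp_re, h, h2]

theorem Complex.norm_mul_sin_abs_arg_add {w : ℂ} :
    w.re + |w.im| = ‖w‖ * (Real.cos |w.arg| + Real.sin |w.arg|) := by
  rw [mul_add, Real.cos_abs, Complex.norm_mul_cos_arg, ← Complex.norm_mul_sin_arg w, abs_mul,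
    abs_norm, Real.abs_sin_eq_sin_abs_of_abs_le_pi (Complex.abs_arg_le_pi w)]

theorem Real.cos_add_sin_eq (x : ℝ) :
    Real.cos x + Real.sin x = √2 * Real.sin (x + Real.pi / 4) := by
  rw [Real.sin_add, Real.cos_pi_div_four, Real.sin_pi_div_four]
  have := Real.mul_self_sqrt (show (0 : ℝ) ≤ 2 by norm_num)
  linear_combination (-(Real.cos x + Real.sin x) / 2) * this

/-- Since `Re w + |Im w| = √2 |w| sin(|arg w| + π/4)`, positivity means `|arg w| < 3π/4`, and then
`(2/3)|arg w| < π/2`, where the cosine is positive. -/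
theorem Complex.re_cpow_two_thirds_pos {w : ℂ} (h : 0 < w.re + |w.im|) :
    0 < (w ^ (2 / 3 : ℂ)).re := by
  have hw : w ≠ 0 := by rintro rfl; simp at h
  obtain ⟨c, hc, hcw⟩ := Complex.re_cpow_two_thirds hw
  rw [Complex.norm_mul_sin_abs_arg_add, Real.cos_add_sin_eq] at h
  have h1 : |w.arg| < 3 * Real.pi / 4 := by
    by_contra! hge
    have : Real.sin (|w.arg| + Real.pi / 4) ≤ 0 := by
      have h2 := Complex.abs_arg_le_pi w
      rw [← neg_nonneg, ← Real.sin_sub_pi]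
      exact Real.sin_nonneg_of_nonneg_of_le_pi (by linarith) (by linarith [Real.pi_pos])
    have h3 : ‖w‖ * (√2 * Real.sin (|w.arg| + Real.pi / 4)) ≤ 0 :=
      mul_nonpos_of_nonneg_of_nonpos (norm_nonneg w)
        (mul_nonpos_of_nonneg_of_nonpos (Real.sqrt_nonneg 2) this)
    linarith
  rw [hcw]
  exact mul_pos hc (Real.cos_pos_of_mem_Ioo
    ⟨by linarith [Real.pi_pos, abs_nonneg w.arg], by linarith⟩)

theorem Complex.re_cpow_two_thirds_nonneg {w : ℂ} (h : 0 ≤ w.re + |w.im|) :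
    0 ≤ (w ^ (2 / 3 : ℂ)).re := by
  rcases eq_or_ne w 0 with rfl | hw
  · simp
  obtain ⟨c, hc, hcw⟩ := Complex.re_cpow_two_thirds hw
  rw [Complex.norm_mul_sin_abs_arg_add, Real.cos_add_sin_eq] at h
  have h1 : |w.arg| ≤ 3 * Real.pi / 4 := by
    by_contra! hge
    have : Real.sin (|w.arg| + Real.pi / 4) < 0 := by
      have h2 := Complex.abs_arg_le_pi w
      rw [← neg_pos, ← Real.sin_sub_pi]
      exact Real.sin_pos_of_pos_of_lt_pi (by linarith) (by linarith [Real.pi_pos])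
    have h3 : ‖w‖ * (√2 * Real.sin (|w.arg| + Real.pi / 4)) < 0 :=
      mul_neg_of_pos_of_neg (norm_pos_iff.2 hw)
        (mul_neg_of_pos_of_neg (by positivity) this)
    linarith
  rw [hcw]
  exact mul_nonneg hc.le (Real.cos_nonneg_of_mem_Icc
    ⟨by linarith [Real.pi_pos, abs_nonneg w.arg], by linarith⟩)

theorem Complex.mem_slitPlane_of_re_add_pos {w : ℂ} (h : 0 < w.re + |w.im|) :
    w ∈ Complex.slitPlane := by
  rw [Complex.mem_slitPlane_iff]
  by_contra! h'
  rw [h'.2, abs_zero] at h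
  linarith [h'.1]

theorem Complex.re_nonneg_or_im_ne_zero {w : ℂ} (h : 0 ≤ w.re + |w.im|) :
    0 ≤ w.re ∨ w.im ≠ 0 := by
  by_contra! h'
  rw [h'.2, abs_zero] at h
  linarith [h'.1]

end CpowTwoThirds

/-! ### The peak function -/

section Peak

variable {n : ℕ} [NeZero n] {l : ℕ}

theorem norm_modelPeak (ζ : Cn n) :
    ‖modelPeak ζ‖ = Real.exp (-((-(ζ 0)) ^ (2 / 3 : ℂ)).re) := by
  rw [modelPeak, Complex.norm_exp, Complex.neg_re]

theorem modelPeak_zero : modelPeak (0 : Cn n) = 1 := by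
  simp [modelPeak]

/-- Near `0` the quadratic term dominates `C(|ζ'|²|ζ''| + |ζ'|³)`, because its coefficients have a
positive minimum, and `C|Im ζ₁||ζ| ≤ |Im ζ₁|`. -/
theorem HasLeviNormalForm.eventually_le {ρ : Cn n → ℝ} (h : HasLeviNormalForm l ρ) :
    ∀ᶠ ζ in 𝓝 (0 : Cn n), (ζ 0).re - |(ζ 0).im| ≤ ρ ζ := by
  obtain ⟨lam, hlam, hO⟩ := h
  obtain ⟨C, hC, hb⟩ := hO.exists_nonneg
  obtain ⟨m, hm, hml⟩ : ∃ m : ℝ, 0 < m ∧ ∀ j ∈ primeIndices n l, m ≤ lam j := by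
    rcases (primeIndices n l).eq_empty_or_nonempty with he | hne
    · exact ⟨1, one_pos, by simp [he]⟩
    · obtain ⟨i, hi, him⟩ := Finset.exists_min_image _ lam hne
      exact ⟨lam i, hlam i hi, him⟩
  have h1 : ∀ᶠ ζ in 𝓝 (0 : Cn n), C * ‖ζ‖ < 1 :=
    ContinuousAt.eventually_lt (by fun_prop) continuousAt_const (by simp)
  have h2 : ∀ᶠ ζ in 𝓝 (0 : Cn n), 2 * C * ‖ζ‖ < m :=
    ContinuousAt.eventually_lt (by fun_prop) continuousAt_const (by simpa using hm)
  filter_upwards [hb.bound, h1, h2] with ζ hζ h1 h2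
  have hP := partNorm_nonneg (primeIndices n l) ζ
  have hD := partNorm_nonneg (doublePrimeIndices n l) ζ
  have hPN := partNorm_le_norm (primeIndices n l) ζ
  have hDN := partNorm_le_norm (doublePrimeIndices n l) ζ
  have hy := abs_nonneg (ζ 0).im
  rw [Real.norm_eq_abs, Real.norm_of_nonneg (by positivity)] at hζ
  have hsum : m * partNorm (primeIndices n l) ζ ^ 2 ≤
      ∑ j ∈ primeIndices n l, lam j * ‖ζ j‖ ^ 2 := by
    rw [partNorm_sq, Finset.mul_sum]
    exact Finset.sum_le_sum fun j hj => by gcongr; exact hml j hj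
  set P := partNorm (primeIndices n l) ζ
  set D := partNorm (doublePrimeIndices n l) ζ
  have e1 : C * (P ^ 2 * D + P ^ 3) ≤ m * P ^ 2 := by
    have : C * (D + P) ≤ m := by nlinarith
    nlinarith [sq_nonneg P]
  have e2 : C * (|(ζ 0).im| * ‖ζ‖) ≤ |(ζ 0).im| := by nlinarith
  linarith [(abs_le.1 hζ).1]

theorem IsNormalFormChart.exists_isLocalWeakPeakFunction {Ω : Set (Cn n)} {p : Cn n}
    {Φ : OpenPartialHomeomorph (Cn n) (Cn n)} (h : IsNormalFormChart l Ω p Φ) :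
    ∃ U : Set (Cn n), U ⊆ Φ.source ∧
      IsLocalWeakPeakFunction Ω p U (fun z => modelPeak (Φ z)) := by
  obtain ⟨ε, ρ, hε, hε1, hρ, hnf⟩ := h.normalForm
  obtain ⟨η, hη, hball⟩ := Metric.eventually_nhds_iff_ball.1 hnf.eventually_le
  set δ := min ε η with hδ
  have hδ0 : 0 < δ := lt_min hε hη
  have hδε : Metric.ball (0 : Cn n) δ ⊆ Metric.ball 0 ε :=
    Metric.ball_subset_ball (min_le_left _ _)
  have hδη : Metric.ball (0 : Cn n) δ ⊆ Metric.ball 0 η :=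
    Metric.ball_subset_ball (min_le_right _ _)
  set U := Φ.source ∩ Φ ⁻¹' Metric.ball 0 δ with hU
  have hUo : IsOpen U := Φ.isOpen_inter_preimage Metric.isOpen_ball
  have hneg : ∀ z ∈ Ω ∩ U, ρ (Φ z) < 0 := fun z hz =>
    (hρ.mem_iff _ (hδε hz.2.2)).1 (Set.mem_image_of_mem Φ ⟨hz.1, hz.2.1⟩)
  have hnonpos : ∀ z ∈ closure Ω ∩ U, ρ (Φ z) ≤ 0 := by
    rintro z ⟨hzΩ, hzU⟩
    by_contra! hpos
    have hc : ContinuousAt (fun z => ρ (Φ z)) z :=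
      (hρ.smooth.continuousOn.continuousAt (Metric.isOpen_ball.mem_nhds (hδε hzU.2))).comp
        (Φ.continuousAt hzU.1)
    have hev : ∀ᶠ z' in 𝓝 z, 0 < ρ (Φ z') ∧ z' ∈ U :=
      (hc.eventually (lt_mem_nhds hpos)).and (hUo.mem_nhds hzU)
    obtain ⟨z', ⟨h1, h2⟩, h3⟩ := mem_closure_iff_nhds.1 hzΩ _ hev
    linarith [hneg z' ⟨h3, h2⟩]
  have hpos : ∀ z ∈ Ω ∩ U, 0 < (-(Φ z 0)).re + |(-(Φ z 0)).im| := fun z hz => by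
    rw [Complex.neg_re, Complex.neg_im, abs_neg]
    linarith [hneg z hz, hball _ (hδη hz.2.2)]
  have hnn : ∀ z ∈ closure Ω ∩ U, 0 ≤ (-(Φ z 0)).re + |(-(Φ z 0)).im| := fun z hz => by
    rw [Complex.neg_re, Complex.neg_im, abs_neg]
    linarith [hnonpos z hz, hball _ (hδη hz.2.2)]
  refine ⟨U, Set.inter_subset_left, hUo, ⟨h.mem_source, ?_⟩, ?_, ?_, ?_, ?_, ?_⟩
  · rw [Set.mem_preimage, h.map_zero]
    exact Metric.mem_ball_self hδ0
  · intro z hz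
    refine DifferentiableAt.differentiableWithinAt ?_
    have h1 : DifferentiableAt ℂ Φ z :=
      h.biholomorphism.1.differentiableAt (Φ.open_source.mem_nhds hz.2.1)
    have h2 : DifferentiableAt ℂ (fun z => -(Φ z 0)) z :=
      ((EuclideanSpace.proj (𝕜 := ℂ) (0 : Fin n)).differentiableAt.comp z h1).neg
    exact ((h2.cpow_const (Complex.mem_slitPlane_of_re_add_pos (hpos z hz))).neg).cexp
  · intro z hz
    refine ContinuousAt.continuousWithinAt ?_
    have h1 : ContinuousAt (fun z => -(Φ z 0)) z :=
      ((EuclideanSpace.proj (𝕜 := ℂ) (0 : Fin n)).continuous.continuousAt.comp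
        (Φ.continuousAt hz.2.1)).neg
    -- On the closure `-ζ₁` avoids the open negative axis, where the branch jumps. At `0` the power
    -- is continuous since the exponent has positive real part.
    have h2 := Complex.continuousAt_cpow_const_of_re_pos (w := 2 / 3)
      (Complex.re_nonneg_or_im_ne_zero (hnn z hz)) (by norm_num)
    exact (ContinuousAt.comp (f := fun z => -(Φ z 0)) h2 h1).neg.cexp
  · rw [h.map_zero, modelPeak_zero]
  · intro z hz
    rw [norm_modelPeak, Real.exp_lt_one_iff, neg_lt_zero]
    exact Complex.re_cpow_two_thirds_pos (hpos z hz)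
  · intro z hz
    rw [norm_modelPeak, Real.exp_le_one_iff, neg_nonpos]
    exact Complex.re_cpow_two_thirds_nonneg (hnn z hz)

end Peak
end

noncomputable section

/-! ### Second order estimates for the sub-mean value argument -/

section Taylor

theorem ContDiffAt.eventually_norm_sub_lt {E F : Type*} [NormedAddCommGroup E] [NormedSpace ℝ E]
    [NormedAddCommGroup F] [NormedSpace ℝ F] {f : E → F} {z : E} {k : WithTop ℕ∞}
    (hf : ContDiffAt ℝ k f z) {ε : ℝ} (hε : 0 < ε) : ∀ᶠ y in 𝓝 z, ‖f y - f z‖ < ε := by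
  filter_upwards [hf.continuousAt (Metric.ball_mem_nhds _ hε)] with y hy
  rwa [Set.mem_preimage, mem_ball_iff_norm] at hy

theorem ContDiffAt.exists_abs_taylor_two_le {E : Type*} [NormedAddCommGroup E] [NormedSpace ℝ E]
    {g : E → ℝ} {z : E} (hg : ContDiffAt ℝ 2 g z) {ε : ℝ} (hε : 0 < ε) :
    ∃ η : ℝ, 0 < η ∧ ∀ v, ‖v‖ < η →
      |g (z + v) - g z - fderiv ℝ g z v - fderiv ℝ (fderiv ℝ g) z v v / 2| ≤ ε * ‖v‖ ^ 2 := by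
  have h2 : ContDiffAt ℝ 0 (fderiv ℝ (fderiv ℝ g)) z :=
    (hg.fderiv_right (m := 1) one_add_one_eq_two.le).fderiv_right (m := 0) (zero_add 1).le
  have hev : ∀ᶠ y in 𝓝 z, ContDiffAt ℝ 2 g y ∧
      ‖fderiv ℝ (fderiv ℝ g) y - fderiv ℝ (fderiv ℝ g) z‖ < ε := by
    exact (hg.eventually (by simp)).and (h2.eventually_norm_sub_lt hε)
  obtain ⟨η, hη, hball⟩ := Metric.eventually_nhds_iff_ball.1 hev
  refine ⟨η, hη, fun v hv => ?_⟩
  have hmem : ∀ t ∈ Set.Icc (0 : ℝ) 1, z + t • v ∈ Metric.ball z η := by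
    intro t ht
    rw [mem_ball_iff_norm, add_sub_cancel_left, norm_smul, Real.norm_of_nonneg ht.1]
    nlinarith [ht.2, norm_nonneg v]
  refine abs_taylor_two_le (fun t ht => (hball _ (hmem t ht)).1) (fun t ht => ?_)
  calc |fderiv ℝ (fderiv ℝ g) (z + t • v) v v - fderiv ℝ (fderiv ℝ g) z v v|
      = ‖(fderiv ℝ (fderiv ℝ g) (z + t • v) - fderiv ℝ (fderiv ℝ g) z) v v‖ := rfl
    _ ≤ ‖fderiv ℝ (fderiv ℝ g) (z + t • v) - fderiv ℝ (fderiv ℝ g) z‖ * ‖v‖ * ‖v‖ :=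
      ContinuousLinearMap.le_opNorm₂ _ _ _
    _ ≤ ε * ‖v‖ * ‖v‖ := by
      gcongr
      exact (hball _ (hmem t ht)).2.le
    _ = ε * ‖v‖ ^ 2 := by ring

/-- The product equals a quarter of the squared sum minus the squared difference. The sum of the
lower bounds is `2g + σQ/4`, a first order gain in `σ`; their difference contributes only `O(σ²K²)`,
which the smallness of `σ` controls. So `B₁` and `B₂` need no individual sign. -/
theorem lt_mul_of_second_order {g σ Q K B₁ B₂ G₁ G₂ : ℝ} (hg : 0 < g) (hσ : 0 < σ) (hQ : 0 < Q)
    (hB : B₁ + B₂ = Q) (hB₁ : |B₁| ≤ K) (hB₂ : |B₂| ≤ K) (h1 : σ * (K + Q) ≤ g)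
    (h2 : σ * K ^ 2 ≤ g * Q / 2) (hG₁ : g + σ * B₁ / 2 - σ * Q / 8 ≤ G₁)
    (hG₂ : g + σ * B₂ / 2 - σ * Q / 8 ≤ G₂) :
    0 < G₁ ∧ 0 < G₂ ∧ g ^ 2 + g * σ * Q / 8 ≤ G₁ * G₂ := by
  obtain ⟨hB₁l, hB₁u⟩ := abs_le.1 hB₁
  obtain ⟨hB₂l, hB₂u⟩ := abs_le.1 hB₂
  have hσQ : 0 < σ * Q := mul_pos hσ hQ
  have p1 : 0 < g + σ * B₁ / 2 - σ * Q / 8 := by nlinarith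
  have p2 : 0 < g + σ * B₂ / 2 - σ * Q / 8 := by nlinarith
  refine ⟨p1.trans_le hG₁, p2.trans_le hG₂, ?_⟩
  refine le_trans ?_ (mul_le_mul hG₁ hG₂ p2.le (p1.le.trans hG₁))
  have hd : (B₁ - B₂) ^ 2 ≤ 4 * K ^ 2 := by
    rw [show 4 * K ^ 2 = (2 * K) ^ 2 by ring]
    exact sq_le_sq' (by linarith) (by linarith)
  have e : (g + σ * B₁ / 2 - σ * Q / 8) * (g + σ * B₂ / 2 - σ * Q / 8) =
      ((2 * g + σ * Q / 4) ^ 2 - σ ^ 2 * (B₁ - B₂) ^ 2 / 4) / 4 := by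
    rw [← hB]; ring
  rw [e]
  have h3 : σ ^ 2 * (B₁ - B₂) ^ 2 ≤ σ ^ 2 * (4 * K ^ 2) := by gcongr
  have h4 : σ * (σ * K ^ 2) ≤ σ * (g * Q / 2) := by gcongr
  nlinarith [sq_nonneg (σ * Q)]

end Taylor

/-! ### Plurisubharmonic functions touched from above -/

section Pseudoconvex

variable {n : ℕ}

theorem leviC_self_re (r : Cn n → ℝ) (z v : Cn n) : (leviC r z v v).re =
    fderiv ℝ (fderiv ℝ r) z v v +
      fderiv ℝ (fderiv ℝ r) z (Complex.I • v) (Complex.I • v) := by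
  simp only [leviC, leviTwoForm, mulI_apply, I_smul_I_smul, map_neg]
  ring

theorem fderiv_fderiv_smul_add {g : Cn n → ℝ} {z : Cn n} (hg : ContDiffAt ℝ 2 g z) (τ : ℂ)
    (w : Cn n) : fderiv ℝ (fderiv ℝ g) z (τ • w) (τ • w) +
      fderiv ℝ (fderiv ℝ g) z (τ • Complex.I • w) (τ • Complex.I • w) =
      ‖τ‖ ^ 2 * (leviC g z w w).re := by
  have hI : τ • Complex.I • w = Complex.I • τ • w := smul_comm _ _ _
  rw [hI, ← leviC_self_re, leviC_smul_left hg, leviC_smul_right, ← mul_assoc, Complex.mul_conj',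
    ← Complex.ofReal_pow, Complex.re_ofReal_mul]

/-- If `-(log g) / 2`, up to a constant, touches a plurisubharmonic function from above, then the
Levi form of `g` is nonpositive on the complex tangent space of the level set of `g`. -/
theorem IsContinuousPlurisubharmonicOn.leviC_nonpos {u g : Cn n → ℝ} {Ω : Set (Cn n)} {z : Cn n}
    (hu : IsContinuousPlurisubharmonicOn u Ω) (hΩ : IsOpen Ω) (hz : z ∈ Ω)
    (hg : ContDiffAt ℝ 2 g z) (hgz : 0 < g z) {c : ℝ}
    (hle : ∀ᶠ z' in 𝓝 z, 2 * u z' ≤ c - Real.log (g z')) (heq : 2 * u z = c - Real.log (g z))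
    {w : Cn n} (hw : dC g z w = 0) : (leviC g z w w).re ≤ 0 := by
  by_contra! hQ
  set Q := (leviC g z w w).re with hQdef
  have hw0 : 0 < ‖w‖ := by
    rw [norm_pos_iff]
    rintro rfl
    rw [leviC_zero_left] at hQdef
    rw [hQdef] at hQ
    exact lt_irrefl _ hQ
  set N := ‖w‖ ^ 2 with hN
  have hN0 : 0 < N := by positivity
  -- With this constant the Taylor error at distance `s‖w‖` is `s²Q/8`, as `lt_mul_of_second_order`
  -- requires.
  obtain ⟨η₁, hη₁, hT⟩ := hg.exists_abs_taylor_two_le (show 0 < Q / (8 * N) by positivity)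
  obtain ⟨η₂, hη₂, hball⟩ := Metric.eventually_nhds_iff_ball.1
    (hle.and (show ∀ᶠ z' in 𝓝 z, z' ∈ Ω from hΩ.mem_nhds hz))
  set K := ‖fderiv ℝ (fderiv ℝ g) z‖ * N with hK
  have hK0 : 0 ≤ K := by positivity
  have hev : ∀ᶠ s : ℝ in 𝓝 0, s ^ 2 * (K + Q) < g z ∧ s ^ 2 * K ^ 2 < g z * Q / 2 ∧
      s * ‖w‖ < η₁ ∧ s * ‖w‖ < η₂ := by
    refine ((ContinuousAt.eventually_lt (by fun_prop) continuousAt_const ?_).and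
      ((ContinuousAt.eventually_lt (by fun_prop) continuousAt_const ?_).and
      ((ContinuousAt.eventually_lt (by fun_prop) continuousAt_const ?_).and
      (ContinuousAt.eventually_lt (by fun_prop) continuousAt_const ?_))))
    · simpa using hgz
    · simp only [ne_eq, OfNat.ofNat_ne_zero, not_false_eq_true, zero_pow, zero_mul]; positivity
    · simpa using hη₁
    · simpa using hη₂
  obtain ⟨s, hs, hs0⟩ := ((hev.filter_mono nhdsWithin_le_nhds).and
    (self_mem_nhdsWithin : ∀ᶠ s : ℝ in 𝓝[>] 0, s ∈ Set.Ioi 0)).exists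
  obtain ⟨hs1, hs2, hs3, hs4⟩ := hs
  replace hs0 : 0 < s := hs0
  have hnorm : ∀ (τ : ℂ) (v : Cn n), ‖v‖ = ‖w‖ → ‖τ • s • v‖ = ‖τ‖ * (s * ‖w‖) := by
    intro τ v hv
    rw [norm_smul, norm_smul, Real.norm_of_nonneg hs0.le, hv]
  have hIw : ‖Complex.I • w‖ = ‖w‖ := by rw [norm_smul, Complex.norm_I, one_mul]
  have hmem : ∀ (τ : ℂ) (v : Cn n), ‖v‖ = ‖w‖ → ‖τ‖ ≤ 1 →
      z + τ • s • v ∈ Metric.ball z η₂ := by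
    intro τ v hv hτ
    rw [mem_ball_iff_norm, add_sub_cancel_left, hnorm τ v hv]
    exact (mul_le_of_le_one_left (by positivity) hτ).trans_lt hs4
  have hint : ∀ v : Cn n, ‖v‖ = ‖w‖ →
      CircleIntegrable (fun τ : ℂ => u (z + τ • s • v)) 0 1 := by
    intro v hv
    refine ContinuousOn.circleIntegrable zero_le_one (hu.continuousOn.comp ?_ ?_)
    · fun_prop
    · intro τ hτ
      rw [mem_sphere_zero_iff_norm] at hτ
      exact (hball _ (hmem τ v hv hτ.le)).2
  have hsub : ∀ v : Cn n, ‖v‖ = ‖w‖ →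
      u z ≤ Real.circleAverage (fun τ : ℂ => u (z + τ • s • v)) 0 1 := fun v hv =>
    hu.le_circleAverage z (s • v) fun τ hτ => (hball _ (hmem τ v hv hτ)).2
  have hlow : ∀ (τ : ℂ) (v : Cn n), ‖v‖ = ‖w‖ → ‖τ‖ = 1 → dC g z v = 0 →
      g z + s ^ 2 * (fderiv ℝ (fderiv ℝ g) z (τ • v) (τ • v)) / 2 - s ^ 2 * Q / 8 ≤
        g (z + τ • s • v) := by
    intro τ v hv hτ hdv
    have h1 := hT (τ • s • v) (by rwa [hnorm τ v hv, hτ, one_mul])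
    have h2 : fderiv ℝ g z (τ • s • v) = 0 := by
      rw [← dC_re, map_smul, ← Complex.coe_smul, map_smul, hdv]; simp
    have h3 : τ • s • v = s • τ • v := smul_comm _ _ _
    have h5 : fderiv ℝ (fderiv ℝ g) z (s • τ • v) (s • τ • v) =
        s ^ 2 * fderiv ℝ (fderiv ℝ g) z (τ • v) (τ • v) := by
      generalize τ • v = x
      rw [map_smul, map_smul, smul_apply, smul_eq_mul, smul_eq_mul]
      ring
    rw [h2, hnorm τ v hv, hτ, one_mul, h3, h5, mul_pow, ← hN] at h1
    have h4 : Q / (8 * N) * (s ^ 2 * N) = s ^ 2 * Q / 8 := by field_simp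
    rw [h4] at h1
    rw [h3]
    have := (abs_le.1 h1).1
    linarith
  have hBK : ∀ (τ : ℂ) (v : Cn n), ‖v‖ = ‖w‖ → ‖τ‖ = 1 →
      |fderiv ℝ (fderiv ℝ g) z (τ • v) (τ • v)| ≤ K := by
    intro τ v hv hτ
    have h1 := (fderiv ℝ (fderiv ℝ g) z).le_opNorm₂ (τ • v) (τ • v)
    rw [Real.norm_eq_abs, norm_smul, hv, hτ, one_mul] at h1
    rw [hK, hN]
    linarith
  have hdI : dC g z (Complex.I • w) = 0 := by rw [map_smul, hw, smul_zero]
  -- Pairing the discs in the directions `w` and `iw` makes the two Hessian values add up to `Q` for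
  -- every `τ` on the circle. The sum is then bounded by a constant pointwise, and averaging gives
  -- `2 u(z) < c - log g(z)`, a contradiction.
  have hbound : ∀ τ ∈ Metric.sphere (0 : ℂ) |1|,
      u (z + τ • s • w) + u (z + τ • s • Complex.I • w) ≤
        c - Real.log (g z ^ 2 + g z * s ^ 2 * Q / 8) / 2 := by
    intro τ hτ
    rw [abs_one, mem_sphere_zero_iff_norm] at hτ
    obtain ⟨p1, p2, p3⟩ := lt_mul_of_second_order hgz (pow_pos hs0 2) hQ
      (by rw [fderiv_fderiv_smul_add hg, hτ, one_pow, one_mul]) (hBK τ w rfl hτ)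
      (hBK τ _ hIw hτ) hs1.le hs2.le (hlow τ w rfl hτ hw) (hlow τ _ hIw hτ hdI)
    have l1 := (hball _ (hmem τ w rfl hτ.le)).1
    have l2 := (hball _ (hmem τ _ hIw hτ.le)).1
    have l3 := Real.log_le_log (by positivity) p3
    rw [Real.log_mul p1.ne' p2.ne'] at l3
    linarith
  have havg := Real.circleAverage_mono_on_of_le_circle ((hint w rfl).add (hint _ hIw)) hbound
  have hadd := Real.circleAverage_fun_add (hint w rfl) (hint _ hIw)
  have hlt : Real.log (g z ^ 2) < Real.log (g z ^ 2 + g z * s ^ 2 * Q / 8) :=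
    Real.log_lt_log (by positivity) (lt_add_of_pos_right _ (by positivity))
  rw [Real.log_pow] at hlt
  push_cast at hlt
  have a1 := hsub w rfl
  have a2 := hsub _ hIw
  have havg' : Real.circleAverage (fun τ : ℂ => u (z + τ • s • w) + u (z + τ • s • Complex.I • w))
    0 1 ≤ c - Real.log (g z ^ 2 + g z * s ^ 2 * Q / 8) / 2 := havg
  linarith

end Pseudoconvex
end

noncomputable section

/-! ### Smooth barriers touching the boundary distance; positivity of the Levi form -/

section Touching

variable {n : ℕ}

theorem exists_lt_of_fderiv_neg {r : Cn n → ℝ} {p ν : Cn n} (hr : DifferentiableAt ℝ r p)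
    (hp : r p = 0) {c : ℝ} (hc : 0 < c) (hν : fderiv ℝ r p ν = -(2 * c)) :
    ∀ᶠ τ in 𝓝[>] (0 : ℝ), r (p + τ • ν) ≤ -(c * τ) := by
  have hline : HasDerivAt (fun τ : ℝ => p + τ • ν) ν 0 := by
    simpa using ((hasDerivAt_id (0 : ℝ)).smul_const ν).const_add p
  have h1 : HasDerivAt (fun τ : ℝ => r (p + τ • ν)) (-(2 * c)) 0 := by
    rw [← hν]
    refine HasFDerivAt.comp_hasDerivAt (l := r) (0 : ℝ) ?_ hline
    rw [zero_smul, add_zero]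
    exact hr.hasFDerivAt
  have h2 := h1.isLittleO.bound hc
  filter_upwards [h2.filter_mono nhdsWithin_le_nhds, self_mem_nhdsWithin] with τ hτ hτ0
  replace hτ0 : 0 < τ := hτ0
  simp only [zero_smul, add_zero, hp, sub_zero, smul_eq_mul, Real.norm_eq_abs,
    abs_of_pos hτ0] at hτ
  have := (abs_le.1 hτ).2
  linarith

/-- Near a smooth boundary point, `-r - t - ε |z - p|²` touches a multiple of the squared boundary
distance from below, at a point of `Ω` close to `p`, for a suitable `t`. -/
theorem IsSmoothDefiningFunctionOn.exists_touching {Ω V : Set (Cn n)} {r : Cn n → ℝ}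
    (hr : IsSmoothDefiningFunctionOn Ω V r) (hV : IsOpen V) {p : Cn n}
    (hp : p ∈ frontier Ω ∩ V) {ε : ℝ} (hε : 0 < ε) {W : Set (Cn n)} (hW : W ∈ 𝓝 p) :
    ∃ z ∈ W ∩ Ω, ∃ t c : ℝ, 0 < -r z - ε * ‖z - p‖ ^ 2 - t ∧
      (∀ᶠ z' in 𝓝 z, 2 * -Real.log (Metric.infDist z' (frontier Ω)) ≤
        c - Real.log (-r z' - ε * ‖z' - p‖ ^ 2 - t)) ∧
      2 * -Real.log (Metric.infDist z (frontier Ω)) =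
        c - Real.log (-r z - ε * ‖z - p‖ ^ 2 - t) := by
  have hrp : ContDiffAt ℝ ∞ r p := hr.smooth.contDiffAt (hV.mem_nhds hp.2)
  have hr0 : r p = 0 := (hr.frontier_iff p hp.2).1 hp.1
  have hFne : (frontier Ω).Nonempty := ⟨p, hp.1⟩
  have hFcl : IsClosed (frontier Ω) := isClosed_frontier
  obtain ⟨K, T, hT, hLip⟩ := (hrp.of_le (m := 1) (by exact_mod_cast le_top)).exists_lipschitzOnWith
  obtain ⟨η, hη, hball⟩ := Metric.mem_nhds_iff.1
    (Filter.inter_mem (Filter.inter_mem hT hW) (hV.mem_nhds hp.2))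
  -- A nearest boundary point to a point of the closed `ρ`-ball is within `2ρ < η` of `p`, where the
  -- Lipschitz bound for `r` holds.
  set ρ := η / 3 with hρ
  have hρ0 : 0 < ρ := by positivity
  have hsub : Metric.closedBall p ρ ⊆ Metric.ball p η :=
    Metric.closedBall_subset_ball (by linarith)
  set d : Cn n → ℝ := fun z => Metric.infDist z (frontier Ω) with hd
  have hdc : Continuous d := Metric.continuous_infDist_pt _
  have hrd : ∀ z ∈ Metric.closedBall p ρ, |r z| ≤ K * d z := by
    intro z hz
    obtain ⟨q, hq, hzq⟩ := hFcl.exists_infDist_eq_dist hFne z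
    have h1 : dist z q ≤ ρ := by
      rw [← hzq]
      exact (Metric.infDist_le_dist_of_mem hp.1).trans hz
    have hqb : q ∈ Metric.ball p η := by
      rw [Metric.mem_ball]
      have := dist_triangle_left q p z
      rw [Metric.mem_closedBall] at hz
      linarith
    have h2 := hLip.dist_le_mul z (hball (hsub hz)).1.1 q (hball hqb).1.1
    rwa [(hr.frontier_iff q (hball hqb).2).1 hq, Real.dist_eq, sub_zero, ← hzq] at h2
  have hdp : ∀ z ∈ Metric.ball p η, r z < 0 → 0 < d z := by
    intro z hz hrz
    rw [← hFcl.notMem_iff_infDist_pos hFne, hr.frontier_iff z (hball hz).2]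
    exact hrz.ne
  obtain ⟨ν₀, hν₀⟩ : ∃ ν, fderiv ℝ r p ν ≠ 0 := by
    by_contra! h
    exact hr.fderiv_ne_zero p hp.2 hp.1 (ContinuousLinearMap.ext h)
  obtain ⟨ν, hν⟩ : ∃ ν, fderiv ℝ r p ν = -(2 * 1) :=
    ⟨(-2 / fderiv ℝ r p ν₀) • ν₀, by rw [map_smul, smul_eq_mul, div_mul_cancel₀ _ hν₀]; ring⟩
  -- At `q = p + τν` one has `-r ≥ τ`. The shift `τ/4` and the quadratic term, at most `τ/4`, leave
  -- `g q ≥ τ/2`. The last condition excludes maxima on the sphere.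
  have hev : ∀ᶠ τ : ℝ in 𝓝 0, τ * ‖ν‖ < ρ ∧ ε * (τ * ‖ν‖ ^ 2) < 1 / 4 ∧
      K ^ 2 * (2 * (τ * ‖ν‖ ^ 2)) < ε * ρ ^ 2 := by
    refine ((ContinuousAt.eventually_lt (by fun_prop) continuousAt_const ?_).and
      ((ContinuousAt.eventually_lt (by fun_prop) continuousAt_const ?_).and
      (ContinuousAt.eventually_lt (by fun_prop) continuousAt_const ?_)))
    · simpa using hρ0
    · simp
    · simp only [zero_mul, mul_zero]; positivity
  obtain ⟨τ, hτν, ⟨hτ1, hτ2, hτ3⟩, hτ0⟩ :=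
    ((exists_lt_of_fderiv_neg (hrp.differentiableAt (by simp)) hr0 one_pos hν).and
    ((hev.filter_mono nhdsWithin_le_nhds).and
    (self_mem_nhdsWithin : ∀ᶠ s : ℝ in 𝓝[>] 0, s ∈ Set.Ioi 0))).exists
  replace hτ0 : 0 < τ := hτ0
  rw [one_mul] at hτν
  have hν0 : 0 < ‖ν‖ := by
    rw [norm_pos_iff]
    rintro rfl
    norm_num at hν
  set g : Cn n → ℝ := fun z => -r z - ε * ‖z - p‖ ^ 2 - τ / 4 with hg
  have hgc : ContinuousOn g (Metric.closedBall p ρ) := by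
    have : ContinuousOn r (Metric.closedBall p ρ) :=
      hr.smooth.continuousOn.mono fun z hz => (hball (hsub hz)).2
    fun_prop
  have hgr : ∀ z, 0 ≤ g z → r z < 0 := by
    intro z hz
    simp only [hg] at hz
    have : 0 ≤ ε * ‖z - p‖ ^ 2 := by positivity
    linarith
  set S := Metric.closedBall p ρ ∩ g ⁻¹' Set.Ici 0 with hS
  have hScl : IsCompact S := (isCompact_closedBall p ρ).of_isClosed_subset
    (hgc.preimage_isClosed_of_isClosed Metric.isClosed_closedBall isClosed_Ici)
    Set.inter_subset_left
  have hSd : ∀ z ∈ S, 0 < d z := fun z hz => hdp z (hsub hz.1) (hgr z hz.2)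
  set q := p + τ • ν with hq
  have hqp : ‖q - p‖ = τ * ‖ν‖ := by
    rw [hq, add_sub_cancel_left, norm_smul, Real.norm_of_nonneg hτ0.le]
  have hgq : τ / 2 ≤ g q := by
    simp only [hg, hqp]
    have : ε * (τ * ‖ν‖) ^ 2 ≤ τ * (1 / 4) := by
      calc ε * (τ * ‖ν‖) ^ 2 = τ * (ε * (τ * ‖ν‖ ^ 2)) := by ring
        _ ≤ τ * (1 / 4) := by gcongr
    linarith
  have hqS : q ∈ S := by
    refine ⟨?_, (by positivity : (0 : ℝ) ≤ τ / 2).trans hgq⟩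
    rw [mem_closedBall_iff_norm, hqp]
    exact hτ1.le
  -- The square of `d` is essential: since `d q ≤ τ‖ν‖`, the maximum `M` is at least of order `1/τ`,
  -- whereas `g / d` would only stay bounded below by a constant.
  obtain ⟨z, hzS, hzmax⟩ := hScl.exists_isMaxOn ⟨q, hqS⟩ (f := fun z => g z / d z ^ 2)
    ((hgc.mono Set.inter_subset_left).div (by fun_prop) fun z hz => (pow_pos (hSd z hz) 2).ne')
  set M := g z / d z ^ 2 with hM
  have hdz := hSd z hzS
  have hmM : 1 / (2 * (τ * ‖ν‖ ^ 2)) ≤ M := by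
    refine le_trans ?_ (hzmax hqS)
    have hdq : d q ≤ τ * ‖ν‖ := by
      rw [← hqp, ← dist_eq_norm]
      exact Metric.infDist_le_dist_of_mem hp.1
    have hdq0 := hSd q hqS
    rw [div_le_div_iff₀ (by positivity) (by positivity)]
    calc 1 * d q ^ 2 ≤ 1 * (τ * ‖ν‖) ^ 2 := by gcongr
      _ = τ / 2 * (2 * (τ * ‖ν‖ ^ 2)) := by ring
      _ ≤ g q * (2 * (τ * ‖ν‖ ^ 2)) := by gcongr
  have hM0 : 0 < M := lt_of_lt_of_le (by positivity) hmM
  have hgz : g z = M * d z ^ 2 := by rw [hM, div_mul_cancel₀]; positivity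
  have hgz0 : 0 < g z := by rw [hgz]; positivity
  -- On the sphere `ερ² ≤ -r` and `M d² ≤ -r`, while `-r ≤ K d`. Together these give `M ε ρ² ≤ K²`,
  -- which fails for the large `M` obtained from small `τ`.
  have hzb : z ∈ Metric.ball p ρ := by
    by_contra hzn
    have hzρ : ‖z - p‖ = ρ := by
      have h1 := mem_closedBall_iff_norm.1 hzS.1
      rw [mem_ball_iff_norm, not_lt] at hzn
      exact le_antisymm h1 hzn
    have h1 : ε * ρ ^ 2 + M * d z ^ 2 ≤ -r z := by
      rw [← hgz]
      simp only [hg, hzρ]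
      linarith
    have h2 := hrd z hzS.1
    rw [abs_of_neg (hgr z hzS.2)] at h2
    have h3 : M * (ε * ρ ^ 2) ≤ K ^ 2 := by
      have hpos : 0 < -r z := by linarith [hgr z hzS.2]
      have a0 : 0 ≤ M * d z ^ 2 := by positivity
      have a1 : (-r z) ^ 2 ≤ (K * d z) ^ 2 := by gcongr
      have a2 : M * d z ^ 2 ≤ -r z := by nlinarith
      have a3 : M * (-r z) * (-r z) ≤ K ^ 2 * (-r z) := by
        calc M * (-r z) * (-r z) = M * (-r z) ^ 2 := by ring
          _ ≤ M * (K * d z) ^ 2 := by gcongr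
          _ = K ^ 2 * (M * d z ^ 2) := by ring
          _ ≤ K ^ 2 * (-r z) := by gcongr
      have a4 : M * (-r z) ≤ K ^ 2 := le_of_mul_le_mul_right a3 hpos
      refine le_trans ?_ a4
      gcongr
      linarith
    have h4 : 1 / (2 * (τ * ‖ν‖ ^ 2)) * (ε * ρ ^ 2) ≤ K ^ 2 :=
      le_trans (by gcongr) h3
    rw [one_div, inv_mul_le_iff₀ (by positivity)] at h4
    linarith
  refine ⟨z, ⟨(hball (hsub hzS.1)).1.2, (hr.mem_iff z (hball (hsub hzS.1)).2).2 (hgr z hzS.2)⟩,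
    τ / 4, Real.log M, hgz0, ?_, ?_⟩
  · have hgcz : ContinuousAt g z :=
      (hgc.mono Metric.ball_subset_closedBall).continuousAt (Metric.isOpen_ball.mem_nhds hzb)
    have hgev : ∀ᶠ z' in 𝓝 z, 0 < g z' := continuousAt_const.eventually_lt hgcz hgz0
    filter_upwards [hgev, Metric.isOpen_ball.mem_nhds hzb] with z' h1 h2
    have hz'S : z' ∈ S := ⟨Metric.ball_subset_closedBall h2, h1.le⟩
    have h3 : g z' / d z' ^ 2 ≤ M := hzmax hz'S
    have hd' := hSd z' hz'S
    rw [div_le_iff₀ (by positivity)] at h3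
    have h4 := Real.log_le_log h1 h3
    rw [Real.log_mul hM0.ne' (by positivity), Real.log_pow] at h4
    push_cast at h4
    change 2 * -Real.log (d z') ≤ Real.log M - Real.log (g z')
    linarith
  · change 2 * -Real.log (d z) = Real.log M - Real.log (g z)
    rw [hgz, Real.log_mul hM0.ne' (by positivity), Real.log_pow]
    push_cast
    ring

theorem fderiv_neg_sub_mul {a b : Cn n → ℝ} {z : Cn n} (ha : DifferentiableAt ℝ a z)
    (hb : DifferentiableAt ℝ b z) (ε : ℝ) :
    fderiv ℝ (fun z => -a z - ε * b z) z = -fderiv ℝ a z - ε • fderiv ℝ b z :=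
  (ha.hasFDerivAt.neg.sub (hb.hasFDerivAt.const_mul ε)).fderiv

theorem leviC_neg_sub_mul_re {a b : Cn n → ℝ} {z : Cn n} (ha : ContDiffAt ℝ 2 a z)
    (hb : ContDiffAt ℝ 2 b z) (ε : ℝ) (v : Cn n) :
    (leviC (fun z => -a z - ε * b z) z v v).re =
      -(leviC a z v v).re - ε * (leviC b z v v).re := by
  have hd : ∀ {f : Cn n → ℝ}, ContDiffAt ℝ 2 f z → (∀ᶠ y in 𝓝 z, DifferentiableAt ℝ f y) ∧
      HasFDerivAt (fderiv ℝ f) (fderiv ℝ (fderiv ℝ f) z) z := fun hf =>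
    ⟨(hf.eventually (by simp)).mono fun y hy => hy.differentiableAt (by simp),
      ((hf.fderiv_right (m := 1) one_add_one_eq_two.le).differentiableAt (by simp)).hasFDerivAt⟩
  have h1 : fderiv ℝ (fun z => -a z - ε * b z) =ᶠ[𝓝 z] fun y =>
      -fderiv ℝ a y - ε • fderiv ℝ b y := by
    filter_upwards [(hd ha).1, (hd hb).1] with y h1 h2 using fderiv_neg_sub_mul h1 h2 ε
  have h2 : HasFDerivAt (fun y => -fderiv ℝ a y - ε • fderiv ℝ b y)
      (-fderiv ℝ (fderiv ℝ a) z - ε • fderiv ℝ (fderiv ℝ b) z) z :=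
    (hd ha).2.neg.sub ((hd hb).2.const_smul ε)
  simp only [leviC_self_re, h1.fderiv_eq, h2.fderiv, sub_apply, neg_apply, smul_apply, smul_eq_mul]
  ring

/-- The Levi form of a defining function is positive semidefinite at the smooth boundary points of
a pseudoconvex open set. -/
theorem IsSmoothDefiningFunctionOn.leviC_nonneg {Ω V : Set (Cn n)} {r : Cn n → ℝ}
    (hr : IsSmoothDefiningFunctionOn Ω V r) (hΩ : IsOpen Ω) (hpsc : IsPseudoconvex Ω)
    (hV : IsOpen V) {p : Cn n} (hp : p ∈ frontier Ω ∩ V) {X : Cn n} (hX : dC r p X = 0) :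
    0 ≤ (leviC r p X X).re := by
  by_contra! hneg
  have hrp : ContDiffAt ℝ ∞ r p := hr.smooth.contDiffAt (hV.mem_nhds hp.2)
  set q : Cn n → ℝ := fun z => ‖z - p‖ ^ 2 with hq
  have hqs : ContDiff ℝ ∞ q := (contDiff_norm_sq ℂ).comp (contDiff_id.sub contDiff_const)
  have hqp : fderiv ℝ q p = 0 := by
    refine IsLocalMin.fderiv_eq_zero (Filter.Eventually.of_forall fun z => ?_)
    simp only [hq, sub_self, norm_zero, zero_pow two_ne_zero]
    positivity
  set ε := -(leviC r p X X).re / (2 * (|(leviC q p X X).re| + 1)) with hε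
  have hε0 : 0 < ε := div_pos (by linarith) (by positivity)
  set g : Cn n → ℝ := fun z => -r z - ε * q z with hg
  have hgp : ContDiffAt ℝ ∞ g p :=
    hrp.neg.sub (contDiffAt_const.mul hqs.contDiffAt)
  have hdg : ∀ u, fderiv ℝ g p u = -fderiv ℝ r p u := by
    intro u
    rw [hg, fderiv_neg_sub_mul (hrp.differentiableAt (by simp))
      (hqs.contDiffAt.differentiableAt (by simp)), hqp, smul_zero, sub_zero, neg_apply]
  have hdC : ∀ u, dC g p u = -dC r p u := by
    intro u
    rw [dC_apply, dC_apply, hdg, hdg]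
    push_cast
    ring
  have hlev : 0 < (leviC g p X X).re := by
    rw [leviC_neg_sub_mul_re (hrp.of_le two_le_infty) (hqs.contDiffAt.of_le two_le_infty)]
    have h1 : ε * (leviC q p X X).re < -(leviC r p X X).re := by
      calc ε * (leviC q p X X).re ≤ ε * |(leviC q p X X).re| := by gcongr; exact le_abs_self _
        _ < ε * (2 * (|(leviC q p X X).re| + 1)) := by
          gcongr
          linarith [abs_nonneg (leviC q p X X).re]
        _ = -(leviC r p X X).re := by rw [hε]; exact div_mul_cancel₀ _ (by positivity)
    linarith
  obtain ⟨Y, hY⟩ : ∃ Y, dC g p Y ≠ 0 := by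
    by_contra! h
    refine hr.fderiv_ne_zero p hp.2 hp.1 (ContinuousLinearMap.ext fun u => ?_)
    have := congrArg Complex.re (h u)
    rw [hdC, Complex.neg_re, dC_re] at this
    simpa using this
  set w : Cn n → Cn n := fun z => X - ((dC g z Y)⁻¹ * dC g z X) • Y with hw
  have hdCs : ∀ u, ContDiffAt ℝ ∞ (fun z => dC g z u) p := fun u =>
    (contDiffAt_dC hgp).clm_apply_const u
  have hws : ContDiffAt ℝ ∞ w p :=
    contDiffAt_const.sub ((((hdCs Y).inv hY).mul (hdCs X)).smul contDiffAt_const)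
  have hwp : w p = X := by
    simp only [hw, hdC X, hX, neg_zero, mul_zero, zero_smul, sub_zero]
  have hlc : ContinuousAt (fun z => (leviC g z (w z) (w z)).re) p :=
    Complex.continuous_re.continuousAt.comp (contDiffAt_leviC hgp hws hws).continuousAt
  have hW : ∀ᶠ z in 𝓝 p, 0 < (leviC g z (w z) (w z)).re ∧ dC g z Y ≠ 0 ∧ ContDiffAt ℝ 2 g z :=
    (continuousAt_const.eventually_lt hlc (by rwa [hwp])).and
      (((hdCs Y).continuousAt.eventually_ne hY).and
        ((hgp.of_le two_le_infty).eventually (by simp)))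
  obtain ⟨z, ⟨⟨h1, h2, h3⟩, hzΩ⟩, t, c, ht, hle, heq⟩ := hr.exists_touching hV hp hε0 hW
  have hfd : fderiv ℝ (fun z => g z - t) = fderiv ℝ g := by
    funext y
    exact fderiv_sub_const _
  have key := hpsc.leviC_nonpos (g := fun z => g z - t) hΩ hzΩ (h3.sub contDiffAt_const) ht hle heq
    (w := w z) (by
      simp only [dC, hfd]
      change dC g z (w z) = 0
      simp only [hw, map_sub, map_smul, smul_eq_mul]
      rw [mul_right_comm, inv_mul_cancel₀ h2, one_mul, sub_self])
  have : leviC (fun z => g z - t) z (w z) (w z) = leviC g z (w z) (w z) := by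
    simp only [leviC, leviTwoForm, hfd]
  rw [this] at key
  linarith

end Touching
end

noncomputable section

/-! ### Comparison with the Levi form in Wirtinger derivatives -/

section LeviForm

variable {n : ℕ} {r : Cn n → ℝ} {z : Cn n}

theorem fderiv_ofReal_comp (hr : DifferentiableAt ℝ r z) (u : Cn n) :
    fderiv ℝ (fun w => (r w : ℂ)) z u = (fderiv ℝ r z u : ℂ) := by
  have h : HasFDerivAt (fun w => (r w : ℂ)) (Complex.ofRealCLM.comp (fderiv ℝ r z)) z :=
    Complex.ofRealCLM.hasFDerivAt.comp z hr.hasFDerivAt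
  rw [h.fderiv]
  rfl

theorem complexGradient_eq (hr : DifferentiableAt ℝ r z) (j : Fin n) :
    complexGradient r z j = dC r z (coordVec j) / 2 := by
  rw [complexGradient, dz, fderiv_ofReal_comp hr, fderiv_ofReal_comp hr, dC_apply]

theorem mem_complexTangent_iff (hr : DifferentiableAt ℝ r z) {X : Cn n} :
    X ∈ complexTangent r z ↔ dC r z X = 0 := by
  have h : ∑ j, complexGradient r z j * X j = dC r z X / 2 := by
    conv_rhs => rw [← sum_smul_coordVec X, map_sum, Finset.sum_div]
    refine Finset.sum_congr rfl fun j _ => ?_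
    rw [complexGradient_eq hr, map_smul, smul_eq_mul]
    ring
  change ∑ j, complexGradient r z j * X j = 0 ↔ _
  rw [h, div_eq_zero_iff]
  simp

theorem complexHessian_eq (hr : ContDiffAt ℝ 2 r z) (j k : Fin n) :
    complexHessian r z j k = leviC r z (coordVec j) (coordVec k) / 4 := by
  have hs := hr.isSymmSndFDerivAt (by simp)
  have hev : (fun w => dzbar k (fun v => (r v : ℂ)) w) =ᶠ[𝓝 z] fun w =>
      ((fderiv ℝ r w (coordVec k) : ℂ) +
        Complex.I * (fderiv ℝ r w (Complex.I • coordVec k) : ℂ)) / 2 := by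
    filter_upwards [hr.eventually (by simp)] with w hw
    have hw' := hw.differentiableAt (by simp)
    rw [dzbar, fderiv_ofReal_comp hw', fderiv_ofReal_comp hw']
  have hd : HasFDerivAt (fderiv ℝ r) (fderiv ℝ (fderiv ℝ r) z) z :=
    ((hr.fderiv_right (m := 1) one_add_one_eq_two.le).differentiableAt (by simp)).hasFDerivAt
  have hv : ∀ v : Cn n, HasFDerivAt (fun w => (fderiv ℝ r w v : ℂ))
      (Complex.ofRealCLM.comp ((ContinuousLinearMap.apply ℝ ℝ v).comp
        (fderiv ℝ (fderiv ℝ r) z))) z := fun v =>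
    Complex.ofRealCLM.hasFDerivAt.comp z ((ContinuousLinearMap.apply ℝ ℝ v).hasFDerivAt.comp z hd)
  have hfd : ∀ u, fderiv ℝ (fun w => dzbar k (fun v => (r v : ℂ)) w) z u =
      ((fderiv ℝ (fderiv ℝ r) z u (coordVec k) : ℂ) +
        Complex.I * (fderiv ℝ (fderiv ℝ r) z u (Complex.I • coordVec k) : ℂ)) / 2 := by
    intro u
    have h3 : HasFDerivAt (fun w => (2⁻¹ : ℂ) * ((fderiv ℝ r w (coordVec k) : ℂ) +
        Complex.I * (fderiv ℝ r w (Complex.I • coordVec k) : ℂ))) _ z :=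
      ((hv (coordVec k)).add ((hv (Complex.I • coordVec k)).const_mul Complex.I)).const_mul 2⁻¹
    simp only [div_eq_inv_mul] at hev ⊢
    rw [hev.fderiv_eq, h3.fderiv]
    rfl
  rw [complexHessian, dz, hfd, hfd]
  apply Complex.ext
  · simp [leviC, leviTwoForm, I_smul_I_smul,
      hs.eq (Complex.I • coordVec k) (Complex.I • coordVec j)]
    ring
  · simp [leviC, leviTwoForm, I_smul_I_smul, hs.eq (coordVec k) (Complex.I • coordVec j)]
    ring

theorem leviC_zero_right (r : Cn n → ℝ) (z u : Cn n) : leviC r z u 0 = 0 := by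
  simp [leviC_eq_zero_iff, leviTwoForm]

theorem leviC_sum_right {ι : Type*} (s : Finset ι) (r : Cn n → ℝ) (z u : Cn n) (v : ι → Cn n) :
    leviC r z u (∑ i ∈ s, v i) = ∑ i ∈ s, leviC r z u (v i) := by
  classical
  induction s using Finset.induction_on with
  | empty => simp [leviC_zero_right]
  | insert a s ha ih => rw [Finset.sum_insert ha, Finset.sum_insert ha, leviC_add_right, ih]

theorem leviForm_apply (hr : ContDiffAt ℝ 2 r z) (X Y : complexTangent r z) :
    leviForm r z X Y = leviC r z X Y / 4 := by
  have e : leviC r z X Y = ∑ j, ∑ k,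
      leviC r z (coordVec j) (coordVec k) * (X : Cn n) j * star ((Y : Cn n) k) := by
    conv_lhs => rw [← sum_smul_coordVec (X : Cn n), ← sum_smul_coordVec (Y : Cn n),
      leviC_sum_left]
    refine Finset.sum_congr rfl fun j _ => ?_
    rw [leviC_sum_right]
    refine Finset.sum_congr rfl fun k _ => ?_
    rw [leviC_smul_left hr, leviC_smul_right, Complex.star_def]
    ring
  change ∑ j, ∑ k, complexHessian r z j k * (X : Cn n) j * star ((Y : Cn n) k) = _
  rw [e, Finset.sum_div]
  refine Finset.sum_congr rfl fun j _ => ?_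
  rw [Finset.sum_div]
  refine Finset.sum_congr rfl fun k _ => ?_
  rw [complexHessian_eq hr]
  ring

/-- The null space of the Levi form, in the complex tangent space. -/
def leviNull (r : Cn n → ℝ) (z : Cn n) : Submodule ℂ (Cn n) :=
  (LinearMap.ker (leviForm r z)).map (complexTangent r z).subtype

theorem mem_leviNull_iff (hr : ContDiffAt ℝ 2 r z) {u : Cn n} :
    u ∈ leviNull r z ↔ dC r z u = 0 ∧ ∀ v, dC r z v = 0 → leviC r z u v = 0 := by
  have hd := hr.differentiableAt (by simp)
  simp only [leviNull, Submodule.mem_map, LinearMap.mem_ker, Submodule.subtype_apply,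
    Subtype.exists, exists_and_right, exists_eq_right, mem_complexTangent_iff hd]
  constructor
  · rintro ⟨h, h0⟩
    refine ⟨h, fun v hv => ?_⟩
    have h1 := leviForm_apply hr ⟨u, (mem_complexTangent_iff hd).2 h⟩
      ⟨v, (mem_complexTangent_iff hd).2 hv⟩
    rw [h0, LinearMap.zero_apply, eq_comm, div_eq_zero_iff] at h1
    simpa using h1
  · rintro ⟨h, h0⟩
    refine ⟨h, LinearMap.ext fun v => ?_⟩
    rw [leviForm_apply hr, h0 _ ((mem_complexTangent_iff hd).1 v.2), zero_div]
    rfl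

theorem finrank_complexTangent (hr : DifferentiableAt ℝ r z) (h0 : dC r z ≠ 0) :
    Module.finrank ℂ (complexTangent r z) + 1 = n := by
  have e : complexTangent r z = LinearMap.ker (dC r z : Cn n →ₗ[ℂ] ℂ) := by
    ext X
    rw [mem_complexTangent_iff hr]
    rfl
  have h1 := (dC r z : Cn n →ₗ[ℂ] ℂ).finrank_range_add_finrank_ker
  have h2 : LinearMap.range (dC r z : Cn n →ₗ[ℂ] ℂ) = ⊤ :=
    LinearMap.range_eq_top.2 (LinearMap.surjective (fun h => h0 (ContinuousLinearMap.coe_injective h)))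
  rw [h2, finrank_top, Module.finrank_self, finrank_euclideanSpace_fin] at h1
  rw [e]
  omega

/-- Rank-nullity on the complex tangent space of dimension `n - 1`: `(n - 1) - (n - l - 1) = l`. -/
theorem finrank_leviNull {l : ℕ} (hl : l < n) (hr : DifferentiableAt ℝ r z) (h0 : dC r z ≠ 0)
    (hrank : leviRank r z = n - l - 1) : Module.finrank ℂ (leviNull r z) = l := by
  have h1 := (leviForm r z).finrank_range_add_finrank_ker
  have h2 := finrank_complexTangent hr h0
  rw [leviRank] at hrank
  rw [leviNull, Submodule.finrank_map_subtype_eq]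
  omega

end LeviForm

/-! ### Linear coordinates diagonalizing the Levi form -/

section OrthonormalBasis

theorem InnerProductSpace.Core.exists_basis {K : Type*} [AddCommGroup K] [Module ℂ K]
    [FiniteDimensional ℂ K] (c : InnerProductSpace.Core ℂ K) {ι : Type*} [Fintype ι]
    [DecidableEq ι] (hι : Fintype.card ι = Module.finrank ℂ K) :
    ∃ b : Module.Basis ι ℂ K, ∀ i j, c.inner (b i) (b j) = if i = j then 1 else 0 := by
  let _ : NormedAddCommGroup K := c.toNormedAddCommGroup
  let _ : InnerProductSpace ℂ K := InnerProductSpace.ofCore c.toCore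
  let b := (stdOrthonormalBasis ℂ K).reindex (Fintype.equivFinOfCardEq hι).symm
  exact ⟨b.toBasis, fun i j => by
    have := orthonormal_iff_ite.1 b.orthonormal i j
    rwa [← b.coe_toBasis] at this⟩

end OrthonormalBasis
end

noncomputable section

section Cards

variable {n l : ℕ}

theorem card_primeIndices : (primeIndices n l).card = n - l - 1 := by
  have : (primeIndices n l).map Fin.valEmbedding = Finset.Ioo 0 (n - l) := by
    ext k
    simp only [primeIndices, Finset.mem_map, Finset.mem_filter, Finset.mem_univ, true_and,
      Fin.valEmbedding_apply, Finset.mem_Ioo]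
    constructor
    · rintro ⟨j, hj, rfl⟩
      exact hj
    · intro hk
      exact ⟨⟨k, by omega⟩, hk, rfl⟩
  rw [← Finset.card_map, this, Nat.card_Ioo, Nat.sub_zero]

end Cards

section AdaptedFrame

variable {n : ℕ} {r : Cn n → ℝ} {z : Cn n}

theorem conj_leviC (hr : ContDiffAt ℝ 2 r z) (u v : Cn n) :
    (starRingEnd ℂ) (leviC r z u v) = leviC r z v u := by
  have hs := hr.isSymmSndFDerivAt (by simp)
  apply Complex.ext
  · simp only [leviC, leviTwoForm, Complex.conj_re, mulI_apply, I_smul_I_smul, map_neg,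
      hs.eq u v, hs.eq (Complex.I • u) (Complex.I • v)]
  · simp only [leviC, leviTwoForm, Complex.conj_im]
    ring

/-- The positive semidefinite Levi form on the complex tangent space, as a pre-inner product. -/
@[reducible] def leviPreCore (hr : ContDiffAt ℝ 2 r z)
    (hpsd : ∀ X, dC r z X = 0 → 0 ≤ (leviC r z X X).re) (S : Submodule ℂ (Cn n))
    (hS : ∀ u ∈ S, dC r z u = 0) : PreInnerProductSpace.Core ℂ S where
  -- The arguments are exchanged because an inner product is conjugate linear in its first argument
  -- and `leviC` in its second.
  inner x y := leviC r z y x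
  conj_inner_symm _ _ := conj_leviC hr _ _
  re_inner_nonneg x := hpsd _ (hS _ x.2)
  add_left _ _ _ := leviC_add_right _ _ _ _ _
  smul_left _ _ _ := leviC_smul_right _ _ _

/-- Cauchy-Schwarz for a positive semidefinite form. It makes the Levi form definite on any
complement of its null space. -/
theorem leviC_eq_zero_of_self (hr : ContDiffAt ℝ 2 r z)
    (hpsd : ∀ X, dC r z X = 0 → 0 ≤ (leviC r z X X).re) {u : Cn n} (hu : dC r z u = 0)
    (huu : leviC r z u u = 0) {v : Cn n} (hv : dC r z v = 0) : leviC r z u v = 0 := by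
  let S : Submodule ℂ (Cn n) := LinearMap.ker (dC r z : Cn n →ₗ[ℂ] ℂ)
  let c := leviPreCore hr hpsd S fun u hu => hu
  have h := @InnerProductSpace.Core.inner_mul_inner_self_le ℂ S _ _ _ c ⟨u, hu⟩ ⟨v, hv⟩
  change ‖leviC r z v u‖ * ‖leviC r z u v‖ ≤ (leviC r z u u).re * (leviC r z v v).re at h
  rw [huu, Complex.zero_re, zero_mul, ← conj_leviC hr, RCLike.norm_conj] at h
  exact norm_eq_zero.1 (mul_self_eq_zero.1 (le_antisymm h (by positivity)))

variable [NeZero n] {l : ℕ}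

/-- Linear coordinates in which the Levi form is the identity modulo its null space. -/
theorem exists_adaptedFrame (hl : l < n) (hr : ContDiffAt ℝ 2 r z) (h0 : dC r z ≠ 0)
    (hpsd : ∀ X, dC r z X = 0 → 0 ≤ (leviC r z X X).re)
    (hN : Module.finrank ℂ (leviNull r z) = l) :
    ∃ Λ : Cn n ≃L[ℂ] Cn n, (∀ u, dC r z (Λ u) = u 0) ∧ ∀ u, ∀ i ∈ primeIndices n l,
      leviC r z (Λ (u - u 0 • coordVec 0)) (Λ (coordVec i)) = u i := by
  set H : Submodule ℂ (Cn n) := complexTangent r z with hH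
  have hd := hr.differentiableAt (by simp)
  have hHm : ∀ {u}, u ∈ H ↔ dC r z u = 0 := mem_complexTangent_iff hd
  set N := leviNull r z with hNdef
  have hNm : ∀ {u}, u ∈ N ↔ dC r z u = 0 ∧ ∀ v, dC r z v = 0 → leviC r z u v = 0 :=
    mem_leviNull_iff hr
  have hNH : N ≤ H := fun u hu => hHm.2 (hNm.1 hu).1
  obtain ⟨K', hK'⟩ := Submodule.exists_isCompl N
  set K := K' ⊓ H with hK
  have hKN : K ⊓ N = ⊥ := by
    rw [← le_bot_iff, ← hK'.symm.inf_eq_bot]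
    exact inf_le_inf_right _ inf_le_left
  have hKNs : K ⊔ N = H := by
    rw [hK, sup_comm, ← sup_inf_assoc_of_le _ hNH, hK'.sup_eq_top, top_inf_eq]
  have hKm : ∀ u ∈ K, dC r z u = 0 := fun u hu => hHm.1 hu.2
  have hKf : Module.finrank ℂ K = n - l - 1 := by
    have h1 := Submodule.finrank_sup_add_finrank_inf_eq K N
    have h2 : Module.finrank ℂ H + 1 = n := finrank_complexTangent hd h0
    rw [hKN, hKNs, finrank_bot, hN] at h1
    omega
  let c : InnerProductSpace.Core ℂ K :=
    { leviPreCore hr hpsd K hKm with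
      definite := fun x hx => by
        have hxN : (x : Cn n) ∈ N := hNm.2 ⟨hKm x x.2, fun v hv =>
          leviC_eq_zero_of_self hr hpsd (hKm x x.2) hx hv⟩
        have : (x : Cn n) ∈ K ⊓ N := ⟨x.2, hxN⟩
        rw [hKN] at this
        exact Subtype.ext this }
  obtain ⟨b, hb⟩ := c.exists_basis (ι := primeIndices n l) (by
    rw [Fintype.card_coe, card_primeIndices, hKf])
  replace hb : ∀ i j, leviC r z (b j) (b i) = if i = j then 1 else 0 := hb
  let bN : Module.Basis (doublePrimeIndices n l) ℂ N := (Module.finBasis ℂ N).reindex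
    (Fintype.equivFinOfCardEq (by rw [Fintype.card_coe, card_doublePrimeIndices hl, hN])).symm
  obtain ⟨Y, hY⟩ : ∃ Y, dC r z Y = 1 := by
    obtain ⟨Y, hY⟩ : ∃ Y, dC r z Y ≠ 0 := by
      by_contra! h
      exact h0 (ContinuousLinearMap.ext h)
    exact ⟨(dC r z Y)⁻¹ • Y, by rw [map_smul, smul_eq_mul, inv_mul_cancel₀ hY]⟩
  let A : Cn n → Cn n := fun u => ∑ j : primeIndices n l, u j • (b j : Cn n)
  let B : Cn n → Cn n := fun u => ∑ j : doublePrimeIndices n l, u j • (bN j : Cn n)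
  have hAK : ∀ u, A u ∈ K := fun u => K.sum_mem fun j _ => K.smul_mem _ (b j).2
  have hBN : ∀ u, B u ∈ N := fun u => N.sum_mem fun j _ => N.smul_mem _ (bN j).2
  -- The vector `e₁` goes to `Y` with `2∂r(Y) = 1`, the `ζ'` directions to a Levi-orthonormal basis
  -- of a complement `K` of the null space, the `ζ''` directions to a basis of the null space.
  let Λ₀ : Cn n →ₗ[ℂ] Cn n :=
    { toFun := fun u => u 0 • Y + A u + B u
      map_add' := fun u v => by
        simp only [A, B, PiLp.add_apply, add_smul, Finset.sum_add_distrib]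
        abel
      map_smul' := fun c u => by
        simp only [A, B, PiLp.smul_apply, smul_eq_mul, mul_smul, ← Finset.smul_sum, smul_add,
          RingHom.id_apply] }
  have hdC : ∀ u, dC r z (Λ₀ u) = u 0 := fun u => by
    change dC r z (u 0 • Y + A u + B u) = u 0
    rw [map_add, map_add, hKm _ (hAK u), (hNm.1 (hBN u)).1, map_smul, hY, smul_eq_mul, mul_one,
      add_zero, add_zero]
  have hinj : Function.Injective Λ₀ := by
    rw [← LinearMap.ker_eq_bot, LinearMap.ker_eq_bot']
    intro u hu
    have hu0 : u 0 = 0 := by rw [← hdC u, hu, map_zero]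
    have hsum : A u + B u = 0 := by
      have : u 0 • Y + A u + B u = 0 := hu
      rwa [hu0, zero_smul, zero_add] at this
    have hA0 : A u = 0 := by
      have : A u ∈ K ⊓ N := ⟨hAK u, by
        rw [eq_neg_of_add_eq_zero_left hsum]
        exact N.neg_mem (hBN u)⟩
      rwa [hKN] at this
    have hB0 : B u = 0 := by rwa [hA0, zero_add] at hsum
    have hAc : ∀ j : primeIndices n l, u j = 0 := by
      refine Fintype.linearIndependent_iff.1 b.linearIndependent (fun j => u (j : Fin n)) ?_
      apply Subtype.ext
      simpa [A] using hA0
    have hBc : ∀ j : doublePrimeIndices n l, u j = 0 := by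
      refine Fintype.linearIndependent_iff.1 bN.linearIndependent (fun j => u (j : Fin n)) ?_
      apply Subtype.ext
      simpa [B] using hB0
    ext i
    by_cases hi0 : i = 0
    · rw [hi0, hu0]; rfl
    · by_cases hi : i ∈ primeIndices n l
      · exact hAc ⟨i, hi⟩
      · exact hBc ⟨i, mem_doublePrimeIndices_of_notMem hi0 hi⟩
  let Λ := (LinearEquiv.ofInjectiveEndo Λ₀ hinj).toContinuousLinearEquiv
  have hΛ : ∀ u, Λ u = u 0 • Y + A u + B u := fun u => rfl
  refine ⟨Λ, hdC, fun u i hi => ?_⟩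
  set w := u - u 0 • coordVec 0 with hw
  have hw0 : w 0 = 0 := by simp [hw, coordVec_apply]
  have hi0 : i ≠ 0 := fun h => zero_notMem_primeIndices (h ▸ hi)
  have hwi : ∀ j ≠ 0, w j = u j := fun j hj => by simp [hw, coordVec_apply, hj]
  have hΛi : Λ (coordVec i) = b ⟨i, hi⟩ := by
    have h1 : A (coordVec i) = b ⟨i, hi⟩ := by
      simp only [A, coordVec_apply]
      rw [Finset.sum_eq_single ⟨i, hi⟩]
      · simp
      · intro j _ hj
        rw [if_neg fun h => hj (Subtype.ext h), zero_smul]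
      · simp
    have h2 : B (coordVec i) = 0 := Finset.sum_eq_zero fun j _ => by
      rw [coordVec_apply, if_neg, zero_smul]
      rintro h
      exact notMem_primeIndices_of_mem j.2 (h ▸ hi)
    rw [hΛ, h1, h2, coordVec_apply, if_neg (Ne.symm hi0), zero_smul, zero_add, add_zero]
  have hbd : dC r z (b ⟨i, hi⟩) = 0 := hKm _ (b ⟨i, hi⟩).2
  rw [hΛi, hΛ, hw0, zero_smul, zero_add, leviC_add_left, (hNm.1 (hBN w)).2 _ hbd, add_zero,
    leviC_sum_left, Finset.sum_eq_single ⟨i, hi⟩]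
  · rw [leviC_smul_left hr, hb, if_pos rfl, mul_one, hwi i hi0]
  · intro j _ hj
    rw [leviC_smul_left hr, hb, if_neg hj.symm, mul_zero]
  · simp

end AdaptedFrame

/-! ### Invariance under complex affine changes of coordinates -/

section AffineChange

variable {n : ℕ} {r : Cn n → ℝ} {p ζ : Cn n}

theorem fderiv_comp_affine (r : Cn n → ℝ) (p : Cn n) (Λ : Cn n ≃L[ℂ] Cn n) (ζ u : Cn n) :
    fderiv ℝ (fun ζ => r (p + Λ ζ)) ζ u = fderiv ℝ r (p + Λ ζ) (Λ u) := by
  have h := (Λ.restrictScalars ℝ).comp_right_fderiv (f := fun w => r (p + w)) (x := ζ)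
  have h2 : fderiv ℝ (fun w => r (p + w)) (Λ ζ) = fderiv ℝ r (p + Λ ζ) := fderiv_comp_add_left p
  calc fderiv ℝ (fun ζ => r (p + Λ ζ)) ζ u
      = fderiv ℝ (fun w => r (p + w)) (Λ ζ) (Λ u) := congrArg (fun L => L u) h
    _ = _ := by rw [h2]

theorem contDiffAt_comp_affine {k : WithTop ℕ∞} {Λ : Cn n ≃L[ℂ] Cn n}
    (hr : ContDiffAt ℝ k r (p + Λ ζ)) : ContDiffAt ℝ k (fun ζ => r (p + Λ ζ)) ζ :=
  ContDiffAt.comp (g := r) ζ hr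
    (contDiffAt_const.add (Λ.restrictScalars ℝ).contDiff.contDiffAt)

theorem fderiv_fderiv_comp_affine {Λ : Cn n ≃L[ℂ] Cn n} (hr : ContDiffAt ℝ 2 r (p + Λ ζ))
    (u v : Cn n) : fderiv ℝ (fderiv ℝ fun ζ => r (p + Λ ζ)) ζ u v =
      fderiv ℝ (fderiv ℝ r) (p + Λ ζ) (Λ u) (Λ v) := by
  have hc : ∀ {f : Cn n → ℝ} {z : Cn n}, ContDiffAt ℝ 2 f z → ∀ u v : Cn n,
      fderiv ℝ (fun w => fderiv ℝ f w v) z u = fderiv ℝ (fderiv ℝ f) z u v := by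
    intro f z hf u v
    have := fderiv_fderiv_apply hf (differentiableAt_const v) u
    rwa [fderiv_const_apply, zero_apply, map_zero, add_zero] at this
  rw [← hc (contDiffAt_comp_affine hr), ← hc hr, ← fderiv_comp_affine]
  simp only [fderiv_comp_affine r p Λ]

theorem dC_comp_affine (r : Cn n → ℝ) (p : Cn n) (Λ : Cn n ≃L[ℂ] Cn n) (ζ u : Cn n) :
    dC (fun ζ => r (p + Λ ζ)) ζ u = dC r (p + Λ ζ) (Λ u) := by
  rw [dC_apply, dC_apply, fderiv_comp_affine, fderiv_comp_affine, map_smul]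

theorem leviC_comp_affine {Λ : Cn n ≃L[ℂ] Cn n} (hr : ContDiffAt ℝ 2 r (p + Λ ζ)) (u v : Cn n) :
    leviC (fun ζ => r (p + Λ ζ)) ζ u v = leviC r (p + Λ ζ) (Λ u) (Λ v) := by
  simp only [leviC, leviTwoForm, mulI_apply, fderiv_fderiv_comp_affine hr, map_smul]

theorem hasLeviNullSpace_comp_affine {l : ℕ} {Λ : Cn n ≃L[ℂ] Cn n}
    (hr : ContDiffAt ℝ 2 r (p + Λ ζ)) (h : Module.finrank ℂ (leviNull r (p + Λ ζ)) = l) :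
    HasLeviNullSpace l (fun ζ => r (p + Λ ζ)) ζ := by
  refine ⟨(leviNull r (p + Λ ζ)).map (Λ.symm.toLinearEquiv : Cn n →ₗ[ℂ] Cn n), ?_, ?_⟩
  · rw [LinearEquiv.finrank_map_eq, h]
  · rintro _ ⟨u, hu, rfl⟩
    obtain ⟨h1, h2⟩ := (mem_leviNull_iff hr).1 hu
    have e : Λ (Λ.symm u) = u := Λ.apply_symm_apply u
    refine ⟨?_, fun v hv => ?_⟩
    · rw [dC_comp_affine]
      exact (congrArg _ e).trans h1
    · rw [dC_comp_affine] at hv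
      rw [leviC_comp_affine hr]
      change leviC r (p + Λ ζ) (Λ (Λ.symm u)) (Λ v) = 0
      rw [e]
      exact h2 _ hv

end AffineChange
end

noncomputable section

/-! ### Assembly of the normal form chart -/

section NormalForm

variable {n : ℕ} {Ω V : Set (Cn n)} {r : Cn n → ℝ} {p : Cn n}

theorem IsSmoothDefiningFunctionOn.dC_ne_zero (hr : IsSmoothDefiningFunctionOn Ω V r) {z : Cn n}
    (hz : z ∈ frontier Ω ∩ V) : dC r z ≠ 0 := by
  intro h
  refine hr.fderiv_ne_zero z hz.2 hz.1 (ContinuousLinearMap.ext fun u => ?_)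
  rw [← dC_re, h]
  rfl

theorem IsSmoothDefiningFunctionOn.image_chart {Φ : OpenPartialHomeomorph (Cn n) (Cn n)}
    (hr : IsSmoothDefiningFunctionOn Ω V r) (hΦV : Φ.source ⊆ V) {B : Set (Cn n)}
    (hB : B ⊆ Φ.target) {ρ : Cn n → ℝ} (hρ : ContDiffOn ℝ ∞ ρ B)
    (hiff : ∀ ζ ∈ B, (r (Φ.symm ζ) < 0 ↔ ρ ζ < 0) ∧ (r (Φ.symm ζ) = 0 ↔ ρ ζ = 0) ∧
      fderiv ℝ ρ ζ ≠ 0) :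
    IsSmoothDefiningFunctionOn (Φ '' (Ω ∩ Φ.source)) B ρ := by
  have himg : Φ.IsImage Ω (Φ '' (Ω ∩ Φ.source)) := by
    intro z hz
    constructor
    · rintro ⟨w, hw, hwz⟩
      rw [← Φ.injOn hw.2 hz hwz]
      exact hw.1
    · intro hzΩ
      exact ⟨z, ⟨hzΩ, hz⟩, rfl⟩
  have hmem : ∀ ζ ∈ B, Φ.symm ζ ∈ Φ.source ∧ Φ (Φ.symm ζ) = ζ := fun ζ hζ =>
    ⟨Φ.map_target (hB hζ), Φ.right_inv (hB hζ)⟩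
  refine ⟨hρ, fun ζ hζ => ?_, fun ζ hζ => ?_, fun ζ hζ _ => (hiff ζ hζ).2.2⟩
  · have h1 := himg (hmem ζ hζ).1
    rw [(hmem ζ hζ).2] at h1
    rw [h1, hr.mem_iff _ (hΦV (hmem ζ hζ).1), (hiff ζ hζ).1]
  · have h1 := himg.frontier (hmem ζ hζ).1
    rw [(hmem ζ hζ).2] at h1
    rw [h1, hr.frontier_iff _ (hΦV (hmem ζ hζ).1), (hiff ζ hζ).2.1]

variable [NeZero n] {l : ℕ}

theorem IsSmoothDefiningFunctionOn.exists_isLeviNormalized (hl : l < n)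
    (hr : IsSmoothDefiningFunctionOn Ω V r) (hV : IsOpen V)
    (hrank : ∀ z ∈ frontier Ω ∩ V, leviRank r z = n - l - 1) (hp : p ∈ frontier Ω ∩ V)
    (hpsd : ∀ X, dC r p X = 0 → 0 ≤ (leviC r p X X).re) :
    ∃ Λ : Cn n ≃L[ℂ] Cn n, IsLeviNormalized l (fun ζ => r (p + Λ ζ)) := by
  have hs : ∀ z ∈ V, ContDiffAt ℝ ∞ r z := fun z hz => hr.smooth.contDiffAt (hV.mem_nhds hz)
  have hnull : ∀ z ∈ frontier Ω ∩ V, Module.finrank ℂ (leviNull r z) = l := fun z hz =>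
    finrank_leviNull hl ((hs z hz.2).differentiableAt (by simp)) (hr.dC_ne_zero hz) (hrank z hz)
  have hp2 : ContDiffAt ℝ 2 r p := (hs p hp.2).of_le two_le_infty
  obtain ⟨Λ, hΛ, hΛL⟩ := exists_adaptedFrame hl hp2 (hr.dC_ne_zero hp) hpsd (hnull p hp)
  have hp0 : p + Λ 0 = p := by rw [map_zero, add_zero]
  have hc : ContinuousAt (fun ζ => p + Λ ζ) 0 := by fun_prop
  have hev : ∀ᶠ ζ in 𝓝 (0 : Cn n), p + Λ ζ ∈ V :=
    hc.eventually (by beta_reduce; rw [hp0]; exact hV.mem_nhds hp.2)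
  refine ⟨Λ, hev.mono fun ζ hζ => contDiffAt_comp_affine (hs _ hζ), ?_, fun u => ?_,
    fun u i hi => ?_, hev.mono fun ζ hζ h0 => ?_⟩
  · rw [hp0]
    exact (hr.frontier_iff p hp.2).1 hp.1
  · rw [fderiv_comp_affine, hp0, ← dC_re, hΛ]
  · rw [leviC_comp_affine (by rwa [hp0]), hp0]
    exact hΛL u i hi
  · exact hasLeviNullSpace_comp_affine ((hs _ hζ).of_le two_le_infty)
      (hnull _ ⟨(hr.frontier_iff _ hζ).2 h0, hζ⟩)

theorem IsSmoothDefiningFunctionOn.exists_isNormalFormChart (hl : l < n)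
    (hr : IsSmoothDefiningFunctionOn Ω V r) (hV : IsOpen V)
    (hrank : ∀ z ∈ frontier Ω ∩ V, leviRank r z = n - l - 1) (hp : p ∈ frontier Ω ∩ V)
    (hpsd : ∀ X, dC r p X = 0 → 0 ≤ (leviC r p X X).re) :
    ∃ Φ : OpenPartialHomeomorph (Cn n) (Cn n), IsNormalFormChart l Ω p Φ := by
  obtain ⟨Λ, hΛ⟩ := hr.exists_isLeviNormalized hl hV hrank hp hpsd
  obtain ⟨Ψ, δ, hδ, hΨ0, hΨs, hΨh, hΨd, hjet⟩ := hΛ.exists_adaptedMap hl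
  obtain ⟨Φ, η, hη, hbi, hpΦ, hΦV, hΦt, hΦp, hΦ⟩ := exists_chart_of_hasFDerivAt_id hδ hΨ0 hΨs hΨh
    hΨd p Λ (hV.mem_nhds hp.2)
  obtain ⟨ε, ρ, hε, hε1, hρs, hρ, hnf⟩ :=
    (hjet.dilate hη).exists_hasLeviNormalForm hl (by positivity)
  refine ⟨Φ, hbi, hpΦ, hΦt, hΦp, ε, ρ, hε, hε1, hr.image_chart hΦV ?_ hρs fun ζ hζ => ?_, hnf⟩
  · rw [hΦt]
    exact Metric.ball_subset_ball hε1
  · obtain ⟨h1, h2, h3⟩ := hρ ζ hζ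
    -- The dilated function is `η⁻¹` times `r ∘ Φ.symm`, and a positive factor affects neither signs
    -- nor zeros.
    have hη' : 0 < η⁻¹ := inv_pos.2 hη
    rw [← mul_zero η⁻¹, mul_lt_mul_iff_right₀ hη', mul_zero, ← hΦ] at h1
    rw [mul_eq_zero_iff_left hη'.ne', ← hΦ] at h2
    exact ⟨h1, h2, h3⟩

end NormalForm
end

theorem corollary3p3 (n l : ℕ) [NeZero n] (hl : l < n)
    (Ω : Set (Cn n)) (hΩ_open : IsOpen Ω) (hΩ_conn : IsConnected Ω)
    (hΩ_bdd : Bornology.IsBounded Ω) (hΩ_psc : IsPseudoconvex Ω)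
    (z₀ : Cn n) (hz₀ : z₀ ∈ frontier Ω)
    (V : Set (Cn n)) (hV_open : IsOpen V) (hz₀V : z₀ ∈ V)
    (r : Cn n → ℝ) (hr : IsSmoothDefiningFunctionOn Ω V r)
    (hrank : ∀ z ∈ frontier Ω ∩ V, leviRank r z = n - l - 1)
    (p : Cn n) (hp : p ∈ frontier Ω ∩ V) :
    IsLocalWeakPeakPoint Ω p ∧
      ∃ Φ : OpenPartialHomeomorph (Cn n) (Cn n), IsNormalFormChart l Ω p Φ ∧
        ∃ U : Set (Cn n), U ⊆ Φ.source ∧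
          IsLocalWeakPeakFunction Ω p U (fun z => modelPeak (Φ z)) := by
  obtain ⟨Φ, hΦ⟩ := hr.exists_isNormalFormChart hl hV_open hrank hp fun X hX =>
    hr.leviC_nonneg hΩ_open hΩ_psc hV_open hp hX
  obtain ⟨U, hU, hpeak⟩ := hΦ.exists_isLocalWeakPeakFunction
  exact ⟨⟨hp.1, U, _, hpeak⟩, Φ, hΦ, U, hU, hpeak⟩
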